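/- Let $m,n\ge 1$. Write points of $\mathbb R^{m}\times\mathbb R^{n}$ as $(t,x)$, let $g=-\sum_{i}dt_i^2+\sum_j dx_j^2$ and $\square=-\sum_{i=1}^m\partial_{t_i}^2+\sum_{j=1}^n\partial_{x_j}^2$. For $p=(t(p),x(p))$ put $$r_p=|x-x(p)|,\qquad f_p=\tfrac14\big(|x-x(p)|^2-|t-t(p)|^2\big),\qquad \mathfrak D_p=\{f_p>0\}.$$ For $T>0$ let $G=(-T,T)^m$. Let $\mathfrak U\subset G\times\mathbb R^n$ be of one of the following two kinds, where $\partial\mathfrak U$ always denotes the spatial part of the boundary, i.e. the set of boundary points $(t,x)$ with $t\in G$. * (Static.) $\mathfrak U=G\times\Omega$ with $\Omega\subset\mathbb R^n$ non-empty, open and bounded with smooth boundary; then $\partial\mathfrak U=G\times\partial\Omega$. * (Moving along one time coordinate $t_j$.) $\mathfrak U=\{(t,x): t\in G,\ x\in\Omega_{t_j}\}$ is open, each $\Omega_s$ ($-T<s<T$) is non-empty, open and bounded, $\partial\mathfrak U$ is smooth and timelike (its $g$-normals are spacelike), and there is a vector field $\mathcal Y$, smooth on $\overline{\mathfrak U}$,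 timelike, with positive $t_j$-component and tangent to $\partial\mathfrak U$. Let $\mathcal N$ be the outward pointing unit normal of $\mathfrak U$ on $\partial\mathfrak U$ with respect to $g$, and for $\varepsilon>0$ let $$\Gamma_p^\varepsilon=\partial\mathfrak U\cap\mathfrak D_p\cap\{(1-\varepsilon r_p)\,\mathcal N f_p+\varepsilon f_p\,\mathcal N r_p>0\}.$$ **Theorem.** There is a constant $c>0$ depending only on $m,n$ such that the following holds. Let $\mathfrak U$ and $p\in\mathbb R^{m+n}$ be as above, with $\mathfrak U\cap\mathfrak D_p\neq\emptyset$. Suppose $R_+:=\sup_{\mathfrak U\cap\mathfrak D_p}r_p$ satisfies $T>R_++\max_i|t_i(p)|$ (so $T>R_+$ if $t(p)=0$), and let $0<\varepsilon\le c/R_+$. Let $\mathcal X,V,F$ be smooth on $\overline{\mathfrak U}$ (with values in $\mathbb R^{m+n}$, $\mathbb R$, $\mathbb R$), with $\mathcal X=0$ on $\mathfrak U\cap\{f_p=0\}=\mathfrak U\cap\partial\mathfrak D_p$, and let $H$ be a real function on $\partial\mathfrak U$. Let $z_1,z_2\in C^2(\mathfrak U)\cap C^1(\mathfrak U\cup\partial\mathfrak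 U)$ both satisfy $$\square z+\nabla_{\mathcal X}z+Vz=F\ \text{ in }\mathfrak U,\qquad z=H\ \text{ on }\partial\mathfrak U .$$ If $\mathcal N z_1=\mathcal N z_2$ on $\Gamma_p^\varepsilon$, then $z_1=z_2$ on $\mathfrak U\cap\mathfrak D_p$. -/

import Mathlib

open Set Filter Topology
open scoped ContDiff

noncomputable section

/-- `ℝ^m × ℝ^n`; a point is `(t, x)` with `m` time and `n` space coordinates. -/
abbrev Spacetime (m n : ℕ) : Type :=
  EuclideanSpace ℝ (Fin m) × EuclideanSpace ℝ (Fin n)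

namespace Ultrahyperbolic

variable {m n : ℕ}

/-- The metric `g = -dt₁² - ⋯ - dt_m² + dx₁² + ⋯ + dx_n²`. -/
def metric (v w : Spacetime m n) : ℝ := inner ℝ v.2 w.2 - inner ℝ v.1 w.1

/-- The coordinate vector `∂_{t_i}`. -/
def dt (i : Fin m) : Spacetime m n := (EuclideanSpace.single i 1, 0)

/-- The coordinate vector `∂_{x_j}`. -/
def dx (j : Fin n) : Spacetime m n := (0, EuclideanSpace.single j 1)

/-- The ultrahyperbolic operator `□z = -∑ ∂²z/∂t_i² + ∑ ∂²z/∂x_j²`. -/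
def box (z : Spacetime m n → ℝ) (q : Spacetime m n) : ℝ :=
  -(∑ i : Fin m, fderiv ℝ (fderiv ℝ z) q (dt i) (dt i))
    + ∑ j : Fin n, fderiv ℝ (fderiv ℝ z) q (dx j) (dx j)

/-- `f_p = (|x - x(p)|² - |t - t(p)|²) / 4`. -/
def fFun (p q : Spacetime m n) : ℝ := (‖q.2 - p.2‖ ^ 2 - ‖q.1 - p.1‖ ^ 2) / 4

/-- `r_p = |x - x(p)|`. -/
def rFun (p q : Spacetime m n) : ℝ := ‖q.2 - p.2‖

/-- `𝔇_p = {f_p > 0}`, the exterior of the null cone at `p`. -/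
def nullExterior (p : Spacetime m n) : Set (Spacetime m n) := {q | 0 < fFun p q}

/-- The time cube `G = (-T, T)^m`. -/
def timeCube (m : ℕ) (T : ℝ) : Set (EuclideanSpace ℝ (Fin m)) :=
  {t | ∀ i, -T < t i ∧ t i < T}

/-- The spatial part of the boundary of `U`, i.e. the boundary points whose time lies in the open
cube `G`. For `U = G × Ω` this is `G × ∂Ω`. -/
def lateralBoundary (T : ℝ) (U : Set (Spacetime m n)) : Set (Spacetime m n) :=
  {q | q ∈ frontier U ∧ q.1 ∈ timeCube m T}

/-- `φ` is a smooth defining function of the set `S` near its boundary point `x`: it is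
negative exactly on `S` near `x`, and its differential at `x` does not vanish. -/
def IsDefiningFunctionAt {E : Type*} [NormedAddCommGroup E] [NormedSpace ℝ E]
    (S : Set E) (x : E) (φ : E → ℝ) : Prop :=
  ContDiff ℝ ∞ φ ∧ φ x = 0 ∧ fderiv ℝ φ x ≠ 0 ∧ ∀ᶠ y in 𝓝 x, (y ∈ S ↔ φ y < 0)

/-- `S` has smooth boundary at all the boundary points in `B`. -/
def SmoothBoundaryOn {E : Type*} [NormedAddCommGroup E] [NormedSpace ℝ E]
    (S B : Set E) : Prop :=
  ∀ x ∈ B, ∃ φ : E → ℝ, IsDefiningFunctionAt S x φ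

/-- `N` is a normal of `U` at the boundary point `q` with respect to the metric `g`: it is the
`g`-gradient of a defining function. If `g(N, N) > 0`, such an `N` points out of `U`. -/
def IsNormal (U : Set (Spacetime m n)) (q N : Spacetime m n) : Prop :=
  ∃ φ : Spacetime m n → ℝ, IsDefiningFunctionAt U q φ ∧ ∀ w, fderiv ℝ φ q w = metric N w

/-- `N` is the outward pointing unit normal of `U` at `q` with respect to `g`. -/
def IsOuterUnitNormal (U : Set (Spacetime m n)) (q N : Spacetime m n) : Prop :=
  IsNormal U q N ∧ metric N N = 1

/-- Time static domains `U = G × Ω`. -/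
def IsStaticDomain (T : ℝ) (U : Set (Spacetime m n)) : Prop :=
  ∃ Ω : Set (EuclideanSpace ℝ (Fin n)),
    Ω.Nonempty ∧ IsOpen Ω ∧ Bornology.IsBounded Ω ∧ SmoothBoundaryOn Ω (frontier Ω) ∧
      U = timeCube m T ×ˢ Ω

/-- Domains that move along one time coordinate `t_j`: the slice of `U` at the time `t ∈ G` is
`Ω_{t_j}`, the boundary is smooth and timelike (its normals are spacelike), and there is a
smooth timelike vector field `Y` with positive `t_j`-component which is tangent to the boundary. -/
def IsMovingDomain (T : ℝ) (U : Set (Spacetime m n)) : Prop :=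
  ∃ (j : Fin m) (Ω : ℝ → Set (EuclideanSpace ℝ (Fin n))),
    (∀ s ∈ Ioo (-T) T, (Ω s).Nonempty ∧ IsOpen (Ω s) ∧ Bornology.IsBounded (Ω s)) ∧
    U = {q | q.1 ∈ timeCube m T ∧ q.2 ∈ Ω (q.1 j)} ∧
    IsOpen U ∧
    SmoothBoundaryOn U (lateralBoundary T U) ∧
    (∀ q ∈ lateralBoundary T U, ∀ N, IsNormal U q N → 0 < metric N N) ∧
    ∃ Y : Spacetime m n → Spacetime m n,
      ContDiffOn ℝ ∞ Y (closure U) ∧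
      (∀ q ∈ closure U, metric (Y q) (Y q) < 0 ∧ 0 < (Y q).1 j) ∧
      ∀ q ∈ lateralBoundary T U, ∀ N, IsNormal U q N → metric (Y q) N = 0

/-- `z ∈ C²(U)`, `z` is `C¹` up to the spatial boundary, `□z + ∇_X z + V z = F` in `U`, and
`z = H` on the spatial boundary. -/
structure IsSolution (T : ℝ) (U : Set (Spacetime m n)) (X : Spacetime m n → Spacetime m n)
    (V F H z : Spacetime m n → ℝ) : Prop where
  contDiffOn_two : ContDiffOn ℝ 2 z U
  contDiffOn_one : ContDiffOn ℝ 1 z (U ∪ lateralBoundary T U)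
  equation : ∀ q ∈ U, box z q + fderiv ℝ z q (X q) + V q * z q = F q
  dirichlet : ∀ q ∈ lateralBoundary T U, z q = H q

/-- The derivative of `z` at a spatial boundary point `q` in the direction `N`, taken
from within `U` and its spatial boundary. -/
def boundaryDeriv (T : ℝ) (U : Set (Spacetime m n)) (z : Spacetime m n → ℝ)
    (q N : Spacetime m n) : ℝ :=
  fderivWithin ℝ z (U ∪ lateralBoundary T U) q N

/-- `Γ_p^ε = ∂U ∩ 𝔇_p ∩ {(1 - ε r_p) 𝒩 f_p + ε f_p 𝒩 r_p > 0}`, with `𝒩` the outward pointing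
unit normal. -/
def Gam (T : ℝ) (U : Set (Spacetime m n)) (p : Spacetime m n) (ε : ℝ) :
    Set (Spacetime m n) :=
  {q | q ∈ lateralBoundary T U ∧ q ∈ nullExterior p ∧ ∃ N, IsOuterUnitNormal U q N ∧
    0 < (1 - ε * rFun p q) * fderiv ℝ (fFun p) q N + ε * fFun p q * fderiv ℝ (rFun p) q N}

end Ultrahyperbolic

end

/-! The proof is a global Carleman estimate on W = 𝔘 ∩ 𝔇_p for the difference z of the two
solutions, which solves the homogeneous equation with zero Dirichlet data. Write f = f_p, r = r_p, e
= 1 - εr, k = εf/r. The weight is h^a with h = f/e and a a large natural number. Put w = h^a z, and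
let Y be the g-gradient direction of h, that is Y = e∇f + εf∇r.

Pointwise estimate. Multiply □w by Yw + γw/2 and write the result as a divergence
(`divergence_current`). For ε = 0 the field Y = ∇f is a homothety of g, so its deformation tensor is
a multiple of g and has no sign; all positivity has to come from ε. With γ = div Y - e - k the
indefinite multiples of g(∇w,∇w) combine to (k/2)(|∇_t w|² + |∇_x w|² - 2ρ), where ρ is the squared
radial derivative of w. Conjugation by h^a contributes 2a/(fe) times the square of Yw + γw/2. This
square compensates the possibly negative |∇_t w|² - ρ, since on 𝔇_p the radial derivative is
controlled by Yw and ∇_t w (`time_gradient_gain`). The zeroth order terms singular in f cancel, and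
what is left is at least a²(ε/r)w²/4 (`zeroth_order_bound`). The lower order terms are absorbed for
large a (`absorption`), provided that |𝒳|² ≤ C f. The outcome is `carleman_pointwise`: the
divergence of the weighted current is at least a²(ε/r)w²/16.

The bound |𝒳|² ≤ C f holds because 𝒳 vanishes on the null cone inside 𝔘. As the boundary is
timelike, from a nearby point of 𝔘 one reaches the cone along a timelike segment inside 𝔘 of length
at most a multiple of r - |t - t(p)|, and (r - |t - t(p)|)² ≤ 4f
(`IsTimelikeDomain.exists_velocity`, `IsTimelikeDomain.exists_local_bound`).

Boundary. The condition on T keeps the closure of W away from the ends of the time cube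
(`IsTimelikeDomain.closure_region_subset`), so W is bounded only by the null cone and the spatial
boundary. On the cone the current is O(f²) because of the weight (`exists_flux_bound`). On the
spatial boundary z = 0, hence dz is a multiple κ dφ of the differential of a defining function, and
the outward flux is h^{2a}κ² g(∇φ,∇φ) dφ(Y)/2 (`sum_mul_flux`). The normal is spacelike, so this has
the sign of dφ(Y), which is positive exactly on Γ_p^ε, where the Neumann condition gives κ = 0.

Integration. Since z is only C¹ up to the boundary, the divergence theorem is replaced by a weak
inequality tested against cutoffs: near the boundary (`localWeakDiv_of_boundary`), glued by a
partition of unity (`weakDiv_of_local`), and then cut off at the null cone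
(`integral_nonpos_of_localWeakDiv`). If z(q₀) ≠ 0, a positive bump at q₀ lies below the divergence
and would have a nonpositive integral, a contradiction (`IsTimelikeDomain.eq_zero`). -/

noncomputable section

namespace Ultrahyperbolic

section

variable {m n : ℕ}

/-! ### Coordinates -/

/-- The basis of coordinate vectors of `ℝ^m × ℝ^n`. -/
def bv : Fin m ⊕ Fin n → Spacetime m n := Sum.elim dt dx

/-- The signs of the metric. -/
def sg : Fin m ⊕ Fin n → ℝ := Sum.elim (fun _ => -1) (fun _ => 1)

/-- The indicator of the space coordinates. -/
def sp : Fin m ⊕ Fin n → ℝ := Sum.elim (fun _ => 0) (fun _ => 1)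

/-- The coordinates of a vector. -/
def co (v : Spacetime m n) : Fin m ⊕ Fin n → ℝ := Sum.elim (fun i => v.1 i) (fun j => v.2 j)

@[simp] lemma sg_inl (i : Fin m) : (sg (Sum.inl i : Fin m ⊕ Fin n)) = -1 := rfl
@[simp] lemma sg_inr (i : Fin n) : (sg (Sum.inr i : Fin m ⊕ Fin n)) = 1 := rfl
@[simp] lemma sp_inl (i : Fin m) : (sp (Sum.inl i : Fin m ⊕ Fin n)) = 0 := rfl
@[simp] lemma sp_inr (i : Fin n) : (sp (Sum.inr i : Fin m ⊕ Fin n)) = 1 := rfl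
@[simp] lemma co_inl (v : Spacetime m n) (i : Fin m) : co v (Sum.inl i) = v.1 i := rfl
@[simp] lemma co_inr (v : Spacetime m n) (i : Fin n) : co v (Sum.inr i) = v.2 i := rfl
@[simp] lemma bv_inl (i : Fin m) : (bv (Sum.inl i) : Spacetime m n) = dt i := rfl
@[simp] lemma bv_inr (i : Fin n) : (bv (Sum.inr i) : Spacetime m n) = dx i := rfl

lemma sg_mul_self (i : Fin m ⊕ Fin n) : sg i * sg i = 1 := by
  rcases i with i | i <;> simp

lemma sum_co_smul_bv (v : Spacetime m n) : ∑ i, co v i • bv i = v := by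
  simp only [Fintype.sum_sum_type, co_inl, co_inr, bv_inl, bv_inr, dt, dx]
  ext i
  · simp [Prod.fst_sum, Finset.sum_apply, Pi.single_apply]
  · simp [Prod.snd_sum, Finset.sum_apply, Pi.single_apply]

lemma map_eq_sum_co {F : Type*} [NormedAddCommGroup F] [NormedSpace ℝ F]
    (L : Spacetime m n →L[ℝ] F) (v : Spacetime m n) : L v = ∑ i, co v i • L (bv i) := by
  conv_lhs => rw [← sum_co_smul_bv v]
  simp [map_sum]

lemma metric_eq_sum (v w : Spacetime m n) : metric v w = ∑ i, sg i * co v i * co w i := by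
  simp [metric, Fintype.sum_sum_type, PiLp.inner_apply, mul_comm]
  ring

lemma norm_sq_fst (v : Spacetime m n) : ‖v.1‖ ^ 2 = ∑ i : Fin m, v.1 i ^ 2 := by
  simp [EuclideanSpace.norm_sq_eq]

lemma norm_sq_snd (v : Spacetime m n) : ‖v.2‖ ^ 2 = ∑ i : Fin n, v.2 i ^ 2 := by
  simp [EuclideanSpace.norm_sq_eq]

/-! ### Partial derivatives -/

/-- `u` is differentiable at `q` with the partial derivatives `u'`. -/
def HasPD (u : Spacetime m n → ℝ) (u' : Fin m ⊕ Fin n → ℝ) (q : Spacetime m n) : Prop :=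
  DifferentiableAt ℝ u q ∧ ∀ i, fderiv ℝ u q (bv i) = u' i

variable {u v : Spacetime m n → ℝ} {u' v' : Fin m ⊕ Fin n → ℝ} {q : Spacetime m n}

lemma HasPD.congr (h : HasPD u u' q) (hv : ∀ i, u' i = v' i) : HasPD u v' q :=
  ⟨h.1, fun i => (h.2 i).trans (hv i)⟩

lemma DifferentiableAt.hasPD (h : DifferentiableAt ℝ u q) :
    HasPD u (fun i => fderiv ℝ u q (bv i)) q := ⟨h, fun _ => rfl⟩

lemma hasPD_const (c : ℝ) (q : Spacetime m n) : HasPD (fun _ => c) (fun _ => 0) q :=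
  ⟨differentiableAt_const c, fun i => by simp⟩

lemma HasPD.add (hu : HasPD u u' q) (hv : HasPD v v' q) :
    HasPD (fun y => u y + v y) (fun i => u' i + v' i) q :=
  ⟨hu.1.add hv.1, fun i => by rw [fderiv_fun_add hu.1 hv.1]; simp [hu.2, hv.2]⟩

lemma HasPD.sub (hu : HasPD u u' q) (hv : HasPD v v' q) :
    HasPD (fun y => u y - v y) (fun i => u' i - v' i) q :=
  ⟨hu.1.sub hv.1, fun i => by rw [fderiv_fun_sub hu.1 hv.1]; simp [hu.2, hv.2]⟩

lemma HasPD.mul (hu : HasPD u u' q) (hv : HasPD v v' q) :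
    HasPD (fun y => u y * v y) (fun i => u' i * v q + u q * v' i) q :=
  ⟨hu.1.mul hv.1, fun i => by
    rw [fderiv_fun_mul hu.1 hv.1]
    simp [hu.2, hv.2]
    ring⟩

lemma HasPD.const_mul (c : ℝ) (hu : HasPD u u' q) :
    HasPD (fun y => c * u y) (fun i => c * u' i) q :=
  ((hasPD_const c q).mul hu).congr fun i => by ring

lemma HasPD.inv (hu : HasPD u u' q) (h0 : u q ≠ 0) :
    HasPD (fun y => (u y)⁻¹) (fun i => -u' i / u q ^ 2) q :=
  ⟨hu.1.inv h0, fun i => by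
    have h := (hasDerivAt_inv h0).comp_hasFDerivAt q hu.1.hasFDerivAt
    rw [show (fun y => (u y)⁻¹) = (fun y => y⁻¹) ∘ u from rfl, h.fderiv]
    simp [hu.2]
    ring⟩

lemma HasPD.pow (hu : HasPD u u' q) (k : ℕ) :
    HasPD (fun y => u y ^ k) (fun i => k * u q ^ (k - 1) * u' i) q :=
  ⟨hu.1.pow k, fun i => by
    rw [(hu.1.hasFDerivAt.pow k).fderiv]
    simp [hu.2]⟩

lemma HasPD.sum {ι : Type*} {s : Finset ι} {u : ι → Spacetime m n → ℝ}
    {u' : ι → Fin m ⊕ Fin n → ℝ} (h : ∀ j ∈ s, HasPD (u j) (u' j) q) :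
    HasPD (fun y => ∑ j ∈ s, u j y) (fun i => ∑ j ∈ s, u' j i) q :=
  ⟨DifferentiableAt.fun_sum fun j hj => (h j hj).1, fun i => by
    rw [fderiv_fun_sum fun j hj => (h j hj).1]
    simp only [sum_apply]
    exact Finset.sum_congr rfl fun j hj => (h j hj).2 i⟩

lemma hasPD_co (p q : Spacetime m n) (j : Fin m ⊕ Fin n) :
    HasPD (fun y => co (y - p) j) (fun i => if i = j then 1 else 0) q := by
  rcases j with j | j
  · have h : HasFDerivAt (fun y : Spacetime m n => co (y - p) (Sum.inl j))
        ((EuclideanSpace.proj j).comp (ContinuousLinearMap.fst ℝ _ _)) q := by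
      have := (((EuclideanSpace.proj (𝕜 := ℝ) j).comp
        (ContinuousLinearMap.fst ℝ (EuclideanSpace ℝ (Fin m))
          (EuclideanSpace ℝ (Fin n)))).hasFDerivAt (x := q)).sub_const (p.1 j)
      exact this
    refine ⟨h.differentiableAt, fun i => ?_⟩
    rw [h.fderiv]
    rcases i with i | i <;> simp [dt, dx, eq_comm]
  · have h : HasFDerivAt (fun y : Spacetime m n => co (y - p) (Sum.inr j))
        ((EuclideanSpace.proj j).comp (ContinuousLinearMap.snd ℝ _ _)) q := by
      have := (((EuclideanSpace.proj (𝕜 := ℝ) j).comp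
        (ContinuousLinearMap.snd ℝ (EuclideanSpace ℝ (Fin m))
          (EuclideanSpace ℝ (Fin n)))).hasFDerivAt (x := q)).sub_const (p.2 j)
      exact this
    refine ⟨h.differentiableAt, fun i => ?_⟩
    rw [h.fderiv]
    rcases i with i | i <;> simp [dt, dx, eq_comm]

lemma fFun_eq_sum (p q : Spacetime m n) :
    fFun p q = (∑ j, sg j * (co (q - p) j * co (q - p) j)) / 4 := by
  have h1 := norm_sq_fst (q - p)
  have h2 := norm_sq_snd (q - p)
  simp only [Prod.fst_sub, Prod.snd_sub] at h1 h2
  rw [fFun, h1, h2]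
  simp [Fintype.sum_sum_type, pow_two]
  ring

lemma hasPD_fFun (p q : Spacetime m n) :
    HasPD (fFun p) (fun i => sg i * co (q - p) i / 2) q := by
  have h : HasPD (fun y => (1 / 4) * ∑ j, sg j * (co (y - p) j * co (y - p) j)) _ q :=
    HasPD.const_mul (1 / 4) (HasPD.sum (s := Finset.univ) (fun j _ =>
      ((hasPD_co p q j).mul (hasPD_co p q j)).const_mul (sg j)))
  have he : fFun p = (fun y => (1 / 4) * ∑ j, sg j * (co (y - p) j * co (y - p) j)) := by
    funext y
    rw [fFun_eq_sum]; ring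
  rw [he]
  refine h.congr fun i => ?_
  rw [Finset.sum_eq_single i (fun j _ hj => by simp [hj.symm]) (by simp)]
  simp
  ring

lemma rFun_sq (p q : Spacetime m n) : rFun p q ^ 2 = ∑ j : Fin n, co (q - p) (Sum.inr j) ^ 2 := by
  have h2 := norm_sq_snd (q - p)
  simp only [Prod.snd_sub] at h2
  rw [rFun, h2]
  rfl

lemma rFun_nonneg (p q : Spacetime m n) : 0 ≤ rFun p q := norm_nonneg _

lemma four_fFun (p q : Spacetime m n) : 4 * fFun p q = rFun p q ^ 2 - ‖q.1 - p.1‖ ^ 2 := by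
  rw [fFun, rFun]; ring

lemma rFun_pos {p q : Spacetime m n} (h : 0 < fFun p q) : 0 < rFun p q := by
  refine lt_of_le_of_ne (rFun_nonneg p q) fun h0 => ?_
  have := four_fFun p q
  rw [← h0] at this
  nlinarith [sq_nonneg ‖q.1 - p.1‖]

lemma hasPD_rFun {p q : Spacetime m n} (h : 0 < rFun p q) :
    HasPD (rFun p) (fun i => sp i * co (q - p) i / rFun p q) q := by
  have hd : DifferentiableAt ℝ (rFun p) q := by
    have h0 : q.2 - p.2 ≠ 0 := norm_pos_iff.1 h
    exact ((differentiableAt_snd (p := q)).sub_const p.2).norm ℝ h0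
  refine ⟨hd, fun i => ?_⟩
  -- The square r² is a polynomial in the coordinates: differentiate it in two ways and cancel 2r.
  have h2 : HasPD (fun y => rFun p y ^ 2) _ q := (DifferentiableAt.hasPD hd).pow 2
  have h3 : HasPD (fun y => ∑ j : Fin n, co (y - p) (Sum.inr j) ^ 2) _ q :=
    HasPD.sum (s := Finset.univ) (fun j _ => (hasPD_co p q (Sum.inr j)).pow 2)
  have he : (fun y => rFun p y ^ 2) = (fun y => ∑ j : Fin n, co (y - p) (Sum.inr j) ^ 2) := by
    funext y; exact rFun_sq p y
  rw [← he] at h3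
  have h4 := (h2.2 i).symm.trans (h3.2 i)
  have h5 : rFun p q * fderiv ℝ (rFun p) q (bv i) = sp i * co (q - p) i := by
    rcases i with i | i
    · simp at h4 ⊢
      rcases h4 with h4 | h4
      · exact absurd h4 h.ne'
      · exact Or.inr h4
    · simp at h4 ⊢
      linarith
  field_simp
  linarith

/-- `box` in terms of iterated partial derivatives. -/
lemma box_eq_sum {u'' : Fin m ⊕ Fin n → Fin m ⊕ Fin n → ℝ}
    {U' : Fin m ⊕ Fin n → Spacetime m n → ℝ}
    (hd : DifferentiableAt ℝ (fderiv ℝ u) q)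
    (h1 : ∀ᶠ y in 𝓝 q, HasPD u (fun i => U' i y) y) (h2 : ∀ i, HasPD (U' i) (u'' i) q) :
    box u q = ∑ i, sg i * u'' i i := by
  have key : ∀ i, fderiv ℝ (fderiv ℝ u) q (bv i) (bv i) = u'' i i := by
    intro i
    have e1 : (fun y => fderiv ℝ u y (bv i)) =ᶠ[𝓝 q] U' i := by
      filter_upwards [h1] with y hy using hy.2 i
    have e2 := (h2 i).2 i
    rw [← e1.fderiv_eq, fderiv_clm_apply hd (differentiableAt_const _)] at e2
    simpa using e2
  rw [box, Fintype.sum_sum_type]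
  simp only [sg_inl, sg_inr, ← key, bv_inl, bv_inr]
  simp

end

section

variable {m n : ℕ}

/-! ### The divergence identity for a vector field multiplier -/

/-- The current of the multiplier `Y w + γ w / 2` with the zeroth order potential `A`, at a point
where `w` has the value `w` and the partial derivatives `ζ`. -/
def current (Y : Fin m ⊕ Fin n → ℝ) (γ : ℝ) (γ' : Fin m ⊕ Fin n → ℝ) (A : ℝ)
    (w : ℝ) (ζ : Fin m ⊕ Fin n → ℝ) (i : Fin m ⊕ Fin n) : ℝ :=
  sg i * ((∑ j, Y j * ζ j) * ζ i) - 1 / 2 * ((∑ j, sg j * (ζ j * ζ j)) * Y i)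
    + sg i * (1 / 2 * (γ * (w * ζ i)) - 1 / 4 * (w * w * γ' i)) + 1 / 2 * (A * (w * w) * Y i)

/-- Energy identity for the multiplier Yw + γw/2. The factors of `∑ i, sg i * w2 i i` give □w times
the multiplier; the deformation of Y and the trace term give the quadratic form in ∇w. The potential
term A w² Y / 2 is included so that its A w Yw cancels the zeroth order part of the conjugated
operator. -/
theorem divergence_current {q : Spacetime m n} {Y ζ γ' : Fin m ⊕ Fin n → Spacetime m n → ℝ}
    {γ A w : Spacetime m n → ℝ} {dY w2 γ2 : Fin m ⊕ Fin n → Fin m ⊕ Fin n → ℝ}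
    {dA : Fin m ⊕ Fin n → ℝ}
    (hw : HasPD w (fun i => ζ i q) q) (hζ : ∀ i, HasPD (ζ i) (w2 i) q)
    (hsym : ∀ i j, w2 i j = w2 j i)
    (hY : ∀ i, HasPD (Y i) (dY i) q) (hγ : HasPD γ (fun i => γ' i q) q)
    (hγ' : ∀ i, HasPD (γ' i) (γ2 i) q) (hA : HasPD A dA q) :
    (∑ i, fderiv ℝ (fun y => current (fun j => Y j y) (γ y) (fun j => γ' j y) (A y) (w y)
        (fun j => ζ j y) i) q (bv i)) =
      (∑ j, Y j q * ζ j q) * (∑ i, sg i * w2 i i)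
      + (∑ i, ∑ j, sg i * ζ i q * dY j i * ζ j q)
      - 1 / 2 * (∑ i, dY i i) * (∑ j, sg j * (ζ j q * ζ j q))
      + 1 / 2 * γ q * w q * (∑ i, sg i * w2 i i)
      + 1 / 2 * γ q * (∑ j, sg j * (ζ j q * ζ j q))
      - 1 / 4 * w q ^ 2 * (∑ i, sg i * γ2 i i)
      + 1 / 2 * w q ^ 2 * ((∑ i, Y i q * dA i) + A q * ∑ i, dY i i)
      + A q * w q * (∑ j, Y j q * ζ j q) := by
  have hP : ∀ i, HasPD (fun y => current (fun j => Y j y) (γ y) (fun j => γ' j y) (A y) (w y)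
        (fun j => ζ j y) i) _ q := fun i =>
    ((((((HasPD.sum (s := Finset.univ) fun j _ => (hY j).mul (hζ j)).mul (hζ i)).const_mul
      (sg i))).sub
      (((HasPD.sum (s := Finset.univ) fun j _ => ((hζ j).mul (hζ j)).const_mul (sg j)).mul
        (hY i)).const_mul (1 / 2))).add
      ((((hγ.mul (hw.mul (hζ i))).const_mul (1 / 2)).sub
        (((hw.mul hw).mul (hγ' i)).const_mul (1 / 4))).const_mul (sg i))).add
      (((hA.mul (hw.mul hw)).mul (hY i)).const_mul (1 / 2))
  have hsum : ∀ i, fderiv ℝ (fun y => current (fun j => Y j y) (γ y) (fun j => γ' j y) (A y) (w y)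
        (fun j => ζ j y) i) q (bv i) =
      (∑ j, Y j q * ζ j q) * (sg i * w2 i i) + (∑ j, sg i * ζ i q * dY j i * ζ j q)
      + ((∑ j, sg i * ζ i q * w2 j i * Y j q) - (∑ j, sg j * ζ j q * w2 j i * Y i q))
      + (- 1 / 2 * ∑ j, sg j * (ζ j q * ζ j q)) * dY i i
      + (1 / 2 * γ q * w q) * (sg i * w2 i i)
      + (1 / 2 * γ q) * (sg i * (ζ i q * ζ i q))
      + (- 1 / 4 * w q ^ 2) * (sg i * γ2 i i)
      + (1 / 2 * w q ^ 2) * (Y i q * dA i) + (1 / 2 * w q ^ 2 * A q) * dY i i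
      + (A q * w q) * (Y i q * ζ i q) := by
    intro i
    rw [(hP i).2 i]
    have e1 : (∑ j, (dY j i * ζ j q + Y j q * w2 j i)) * (sg i * ζ i q) =
        (∑ j, sg i * ζ i q * dY j i * ζ j q) + ∑ j, sg i * ζ i q * w2 j i * Y j q := by
      rw [← Finset.sum_add_distrib, Finset.sum_mul]
      exact Finset.sum_congr rfl fun j _ => by ring
    have e2 : (∑ j, sg j * (w2 j i * ζ j q + ζ j q * w2 j i)) * (1 / 2 * Y i q) =
        ∑ j, sg j * ζ j q * w2 j i * Y i q := by
      rw [Finset.sum_mul]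
      exact Finset.sum_congr rfl fun j _ => by ring
    linear_combination e1 - e2
  -- The two occurrences of Hess w(Y, ∇w) cancel by symmetry of the Hessian.
  have hswap : (∑ i, ∑ j, sg i * ζ i q * w2 j i * Y j q) =
      ∑ i, ∑ j, sg j * ζ j q * w2 j i * Y i q := by
    rw [Finset.sum_comm]
    refine Finset.sum_congr rfl fun i _ => Finset.sum_congr rfl fun j _ => ?_
    rw [hsym]
  simp only [hsum, Finset.sum_add_distrib, Finset.sum_sub_distrib, ← Finset.mul_sum, hswap]
  ring

/-- The product rule for `box`, in terms of partial derivatives. -/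
lemma hasPD_mul_second {q : Spacetime m n} {u v : Spacetime m n → ℝ}
    {u' v' : Fin m ⊕ Fin n → Spacetime m n → ℝ} {u2 v2 : Fin m ⊕ Fin n → Fin m ⊕ Fin n → ℝ}
    (hu : HasPD u (fun i => u' i q) q) (hv : HasPD v (fun i => v' i q) q)
    (hu' : ∀ i, HasPD (u' i) (u2 i) q) (hv' : ∀ i, HasPD (v' i) (v2 i) q) (i : Fin m ⊕ Fin n) :
    HasPD (fun y => u' i y * v y + u y * v' i y)
      (fun j => u2 i j * v q + u' i q * v' j q + u' j q * v' i q + u q * v2 i j) q :=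
  (((hu' i).mul hv).add (hu.mul (hv' i))).congr fun j => by ring

end

section

variable {m n : ℕ}

/-! ### The weight and the multiplier -/

/-- `1 - ε r_p`. -/
def eF (p : Spacetime m n) (ε : ℝ) (q : Spacetime m n) : ℝ := 1 - ε * rFun p q

/-- `ε f_p / r_p`. -/
def kF (p : Spacetime m n) (ε : ℝ) (q : Spacetime m n) : ℝ := ε * (fFun p q * (rFun p q)⁻¹)

/-- The partial derivatives of `kF`. -/
def dkF (p : Spacetime m n) (ε : ℝ) (i : Fin m ⊕ Fin n) (q : Spacetime m n) : ℝ :=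
  ε * (sg i / 2 * (co (q - p) i * (rFun p q)⁻¹)
    - sp i * (fFun p q * (co (q - p) i * (rFun p q)⁻¹ ^ 3)))

/-- The components of `(1 - ε r_p) ∇f_p + ε f_p ∇r_p`. -/
def Yv (p : Spacetime m n) (ε : ℝ) (j : Fin m ⊕ Fin n) (q : Spacetime m n) : ℝ :=
  (1 / 2 * eF p ε q + sp j * kF p ε q) * co (q - p) j

/-- The zeroth order coefficient of the multiplier. -/
def gamF (p : Spacetime m n) (ε : ℝ) (q : Spacetime m n) : ℝ :=
  ((m : ℝ) + n - 2) / 2 * eF p ε q + ((n : ℝ) - 2) * kF p ε q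

/-- The partial derivatives of `gamF`. -/
def dgamF (p : Spacetime m n) (ε : ℝ) (i : Fin m ⊕ Fin n) (q : Spacetime m n) : ℝ :=
  -(((m : ℝ) + n - 2) / 2 * (ε * (sp i * (co (q - p) i * (rFun p q)⁻¹))))
    + ((n : ℝ) - 2) * dkF p ε i q

/-- The zeroth order potential produced by the weight `(f_p / (1 - ε r_p)) ^ a`. -/
def AF (p : Spacetime m n) (ε a : ℝ) (q : Spacetime m n) : ℝ :=
  a ^ 2 * (fFun p q * eF p ε q)⁻¹ + (a ^ 2 - a) * ε ^ 2 * (eF p ε q ^ 2)⁻¹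
    - a * ε * (rFun p q * eF p ε q)⁻¹

variable {p q : Spacetime m n} {ε a : ℝ}

lemma hasPD_rInv (h : 0 < rFun p q) : HasPD (fun y => (rFun p y)⁻¹)
    (fun i => -(sp i * (co (q - p) i * (rFun p q)⁻¹ ^ 3))) q :=
  ((hasPD_rFun h).inv h.ne').congr fun i => by field_simp

lemma hasPD_eF (h : 0 < rFun p q) : HasPD (eF p ε)
    (fun i => -(ε * (sp i * (co (q - p) i * (rFun p q)⁻¹)))) q :=
  ((hasPD_const 1 q).sub ((hasPD_rFun h).const_mul ε)).congr fun i => by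
    field_simp
    ring

lemma hasPD_kF (h : 0 < rFun p q) : HasPD (kF p ε) (fun i => dkF p ε i q) q :=
  (((hasPD_fFun p q).mul (hasPD_rInv h)).const_mul ε).congr fun i => by
    rw [dkF]; ring

lemma hasPD_Yv (h : 0 < rFun p q) (j : Fin m ⊕ Fin n) : HasPD (Yv p ε j)
    (fun i => (-(1 / 2 * (ε * (sp i * (co (q - p) i * (rFun p q)⁻¹)))) + sp j * dkF p ε i q)
        * co (q - p) j
      + (1 / 2 * eF p ε q + sp j * kF p ε q) * (if i = j then 1 else 0)) q :=
  ((((hasPD_eF h).const_mul (1 / 2)).add ((hasPD_kF h).const_mul (sp j))).mul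
    (hasPD_co p q j)).congr fun i => by ring

lemma hasPD_gamF (h : 0 < rFun p q) : HasPD (gamF p ε) (fun i => dgamF p ε i q) q :=
  (((hasPD_eF h).const_mul _).add ((hasPD_kF h).const_mul _)).congr fun i => by
    rw [dgamF]; ring

lemma hasPD_dkF (h : 0 < rFun p q) (j : Fin m ⊕ Fin n) : HasPD (dkF p ε j)
    (fun i => ε * (sg j / 2 * ((if i = j then 1 else 0) * (rFun p q)⁻¹
        - co (q - p) j * (sp i * (co (q - p) i * (rFun p q)⁻¹ ^ 3)))
      - sp j * (sg i * co (q - p) i / 2 * (co (q - p) j * (rFun p q)⁻¹ ^ 3)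
        + fFun p q * ((if i = j then 1 else 0) * (rFun p q)⁻¹ ^ 3
          - 3 * co (q - p) j * (sp i * (co (q - p) i * (rFun p q)⁻¹ ^ 5)))))) q :=
  (((((hasPD_co p q j).mul (hasPD_rInv h)).const_mul (sg j / 2)).sub
    (((hasPD_fFun p q).mul ((hasPD_co p q j).mul ((hasPD_rInv h).pow 3))).const_mul
      (sp j))).const_mul ε).congr fun i => by
    push_cast
    ring

lemma hasPD_dgamF (h : 0 < rFun p q) (j : Fin m ⊕ Fin n) : HasPD (dgamF p ε j)
    (fun i => -(((m : ℝ) + n - 2) / 2 * (ε * (sp j * ((if i = j then 1 else 0) * (rFun p q)⁻¹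
        - co (q - p) j * (sp i * (co (q - p) i * (rFun p q)⁻¹ ^ 3))))))
      + ((n : ℝ) - 2) * (ε * (sg j / 2 * ((if i = j then 1 else 0) * (rFun p q)⁻¹
        - co (q - p) j * (sp i * (co (q - p) i * (rFun p q)⁻¹ ^ 3)))
      - sp j * (sg i * co (q - p) i / 2 * (co (q - p) j * (rFun p q)⁻¹ ^ 3)
        + fFun p q * ((if i = j then 1 else 0) * (rFun p q)⁻¹ ^ 3
          - 3 * co (q - p) j * (sp i * (co (q - p) i * (rFun p q)⁻¹ ^ 5))))))) q := by
  have h1 := (((((hasPD_co p q j).mul (hasPD_rInv h)).const_mul (sp j)).const_mul ε).const_mul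
    (-(((m : ℝ) + n - 2) / 2))).add ((hasPD_dkF (ε := ε) h j).const_mul ((n : ℝ) - 2))
  have he : dgamF p ε j = fun y => -(((m : ℝ) + n - 2) / 2) *
      (ε * (sp j * (co (y - p) j * (rFun p y)⁻¹))) + ((n : ℝ) - 2) * dkF p ε j y := by
    funext y
    rw [dgamF]; ring
  rw [he]
  exact h1.congr fun i => by ring

lemma hasPD_AF (hf : 0 < fFun p q) (he : 0 < eF p ε q) : HasPD (AF p ε a)
    (fun i => -(a ^ 2 / (2 * fFun p q ^ 2 * eF p ε q)) * (sg i * co (q - p) i)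
      + (a ^ 2 * ε / (fFun p q * eF p ε q ^ 2 * rFun p q)
        + 2 * (a ^ 2 - a) * ε ^ 3 / (eF p ε q ^ 3 * rFun p q)
        + a * ε * (eF p ε q - ε * rFun p q) / (rFun p q ^ 3 * eF p ε q ^ 2))
          * (sp i * co (q - p) i)) q := by
  have hr := rFun_pos hf
  have hE := hasPD_eF (ε := ε) hr
  have h1 := (((hasPD_fFun p q).mul hE).inv (mul_pos hf he).ne').const_mul (a ^ 2)
  have h2 := ((hE.pow 2).inv (pow_pos he 2).ne').const_mul ((a ^ 2 - a) * ε ^ 2)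
  have h3 := (((hasPD_rFun hr).mul hE).inv (mul_pos hr he).ne').const_mul (a * ε)
  refine ((h1.add h2).sub h3).congr fun i => ?_
  have hr0 := hr.ne'
  have he0 := he.ne'
  have hf0 := hf.ne'
  field_simp
  push_cast
  ring

/-! ### Contractions -/

lemma sum_time_co_sq (p q : Spacetime m n) :
    ∑ i : Fin m, co (q - p) (Sum.inl i) ^ 2 = rFun p q ^ 2 - 4 * fFun p q := by
  have := norm_sq_fst (q - p)
  have h4 := four_fFun p q
  simp only [Prod.fst_sub] at this
  rw [h4, this]
  simp

lemma sum_space_co_sq (p q : Spacetime m n) :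
    ∑ i : Fin n, co (q - p) (Sum.inr i) ^ 2 = rFun p q ^ 2 := (rFun_sq p q).symm

/-- The contractions evaluated through this lemma are diagonal, with one expression quadratic in the
coordinate for time indices and another for space indices, so only |t - t(p)|² = r² - 4f and r²
survive. -/
lemma sum_quadratic (g : Fin m ⊕ Fin n → ℝ) (c₁ c₂ d₁ d₂ : ℝ)
    (h1 : ∀ i : Fin m, g (Sum.inl i) = c₁ * co (q - p) (Sum.inl i) ^ 2 + d₁)
    (h2 : ∀ i : Fin n, g (Sum.inr i) = c₂ * co (q - p) (Sum.inr i) ^ 2 + d₂) :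
    ∑ i, g i = c₁ * (rFun p q ^ 2 - 4 * fFun p q) + c₂ * rFun p q ^ 2 + m * d₁ + n * d₂ := by
  rw [Fintype.sum_sum_type]
  simp only [h1, h2, Finset.sum_add_distrib, ← Finset.mul_sum, sum_time_co_sq, sum_space_co_sq]
  simp
  ring

/-- The coefficient `gamF` is this divergence minus `eF + kF`. Together with `deformation_Yv` that
removes the part of the quadratic form proportional to `eF`, which has no sign. -/
lemma divergence_Yv (h : 0 < rFun p q) :
    ∑ i, ((-(1 / 2 * (ε * (sp i * (co (q - p) i * (rFun p q)⁻¹)))) + sp i * dkF p ε i q)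
        * co (q - p) i
      + (1 / 2 * eF p ε q + sp i * kF p ε q) * (if i = i then 1 else 0)) =
    ((m : ℝ) + n) / 2 * eF p ε q + ((n : ℝ) - 1) * kF p ε q := by
  rw [sum_quadratic (p := p) (q := q) _ 0 (-(ε * fFun p q * (rFun p q)⁻¹ ^ 3))
    (1 / 2 * eF p ε q) (1 / 2 * eF p ε q + kF p ε q)]
  · rw [kF]
    field_simp
    ring
  · intro i
    simp
  · intro i
    simp [dkF]
    ring

lemma box_gamF (h : 0 < rFun p q) :
    ∑ i, sg i * (-(((m : ℝ) + n - 2) / 2 * (ε * (sp i * ((if i = i then 1 else 0) * (rFun p q)⁻¹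
        - co (q - p) i * (sp i * (co (q - p) i * (rFun p q)⁻¹ ^ 3))))))
      + ((n : ℝ) - 2) * (ε * (sg i / 2 * ((if i = i then 1 else 0) * (rFun p q)⁻¹
        - co (q - p) i * (sp i * (co (q - p) i * (rFun p q)⁻¹ ^ 3)))
      - sp i * (sg i * co (q - p) i / 2 * (co (q - p) i * (rFun p q)⁻¹ ^ 3)
        + fFun p q * ((if i = i then 1 else 0) * (rFun p q)⁻¹ ^ 3
          - 3 * co (q - p) i * (sp i * (co (q - p) i * (rFun p q)⁻¹ ^ 5))))))) =
    -(((m : ℝ) + n - 2) / 2 * (ε * ((n - 1) / rFun p q)))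
      + ((n : ℝ) - 2) * (ε * ((m + n - 2) / (2 * rFun p q)
        - (n - 3) * fFun p q / rFun p q ^ 3)) := by
  rw [sum_quadratic (p := p) (q := q) _ 0
    (((m : ℝ) + n - 2) / 2 * (ε * (rFun p q)⁻¹ ^ 3)
      + ((n : ℝ) - 2) * (ε * (-(rFun p q)⁻¹ ^ 3 + 3 * fFun p q * (rFun p q)⁻¹ ^ 5)))
    (((n : ℝ) - 2) * (ε * (1 / 2 * (rFun p q)⁻¹)))
    (-(((m : ℝ) + n - 2) / 2 * (ε * (rFun p q)⁻¹))
      + ((n : ℝ) - 2) * (ε * (1 / 2 * (rFun p q)⁻¹ - fFun p q * (rFun p q)⁻¹ ^ 3)))]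
  · field_simp
    ring
  · intro i
    simp
    ring
  · intro i
    simp
    ring

/-- The derivative of a function with differential `α df + β dr` along the multiplier. -/
lemma sum_Yv_mul (h : 0 < rFun p q) (α β : ℝ) :
    ∑ i, Yv p ε i q * (α * (sg i * co (q - p) i) + β * (sp i * co (q - p) i)) =
      α * (2 * fFun p q * (1 - ε * rFun p q / 2))
        + β * (rFun p q * (eF p ε q * rFun p q / 2 + ε * fFun p q)) := by
  rw [sum_quadratic (p := p) (q := q) _ (-(1 / 2 * eF p ε q * α))
    ((1 / 2 * eF p ε q + kF p ε q) * (α + β)) 0 0]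
  · rw [kF, eF]
    field_simp
    ring
  · intro i
    simp [Yv]
    ring
  · intro i
    simp [Yv]
    ring

lemma sum_Yv_gradient (ζ : Fin m ⊕ Fin n → ℝ) :
    ∑ i, Yv p ε i q * ζ i = 1 / 2 * eF p ε q * ((∑ i, co (q - p) (Sum.inl i) * ζ (Sum.inl i))
      + ∑ i, co (q - p) (Sum.inr i) * ζ (Sum.inr i))
      + kF p ε q * ∑ i, co (q - p) (Sum.inr i) * ζ (Sum.inr i) := by
  rw [Fintype.sum_sum_type, mul_add, add_assoc, ← add_mul, Finset.mul_sum, Finset.mul_sum]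
  congr 1 <;> refine Finset.sum_congr rfl fun i _ => ?_ <;> simp [Yv] <;> ring

lemma sum_sg_sq (ζ : Fin m ⊕ Fin n → ℝ) :
    ∑ i, sg i * (ζ i * ζ i) = (∑ i, ζ (Sum.inr i) ^ 2) - ∑ i, ζ (Sum.inl i) ^ 2 := by
  rw [Fintype.sum_sum_type]
  simp [pow_two]
  ring

/-- The deformation of the multiplier, contracted with a gradient. -/
lemma deformation_Yv (h : 0 < rFun p q) (ζ : Fin m ⊕ Fin n → ℝ) :
    ∑ i, ∑ j, sg i * ζ i * ((-(1 / 2 * (ε * (sp i * (co (q - p) i * (rFun p q)⁻¹))))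
        + sp j * dkF p ε i q) * co (q - p) j
      + (1 / 2 * eF p ε q + sp j * kF p ε q) * (if i = j then 1 else 0)) * ζ j =
    1 / 2 * eF p ε q * ((∑ i, ζ (Sum.inr i) ^ 2) - ∑ i, ζ (Sum.inl i) ^ 2)
      + kF p ε q * ((∑ i, ζ (Sum.inr i) ^ 2)
        - (∑ i, co (q - p) (Sum.inr i) * ζ (Sum.inr i)) ^ 2 / rFun p q ^ 2) := by
  set R1 := ∑ i, co (q - p) (Sum.inr i) * ζ (Sum.inr i) with hR1
  set T1 := ∑ i, co (q - p) (Sum.inl i) * ζ (Sum.inl i) with hT1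
  clear_value R1 T1
  have hj : ∀ i, (∑ j, sg i * ζ i * ((-(1 / 2 * (ε * (sp i * (co (q - p) i * (rFun p q)⁻¹))))
        + sp j * dkF p ε i q) * co (q - p) j
      + (1 / 2 * eF p ε q + sp j * kF p ε q) * (if i = j then 1 else 0)) * ζ j) =
      sg i * ζ i * (-(1 / 2 * (ε * (sp i * (co (q - p) i * (rFun p q)⁻¹))))) * (T1 + R1)
      + sg i * ζ i * dkF p ε i q * R1 + sg i * (1 / 2 * eF p ε q + sp i * kF p ε q) * ζ i ^ 2 := by
    intro i
    have e1 : T1 + R1 = ∑ j, co (q - p) j * ζ j := by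
      rw [Fintype.sum_sum_type, hT1, hR1]
    have e2 : R1 = ∑ j, sp j * (co (q - p) j * ζ j) := by rw [Fintype.sum_sum_type]; simp [hR1]
    have e3 : ζ i = ∑ j, (if i = j then 1 else 0) * ζ j := by simp
    have e4 : sg i * (1 / 2 * eF p ε q + sp i * kF p ε q) * ζ i ^ 2 =
        ∑ j, sg i * ζ i * ((1 / 2 * eF p ε q + sp j * kF p ε q) * (if i = j then 1 else 0)) * ζ j := by
      rw [Finset.sum_eq_single i (fun j _ hj => by simp [hj.symm]) (by simp)]
      simp
      ring
    rw [e4, e1, e2, Finset.mul_sum, Finset.mul_sum, ← Finset.sum_add_distrib,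
      ← Finset.sum_add_distrib]
    exact Finset.sum_congr rfl fun j _ => by ring
  simp only [hj, Fintype.sum_sum_type]
  have t1 : (∑ i : Fin m, (sg (Sum.inl i : Fin m ⊕ Fin n) * ζ (Sum.inl i)
        * (-(1 / 2 * (ε * (sp (Sum.inl i : Fin m ⊕ Fin n) * (co (q - p) (Sum.inl i) * (rFun p q)⁻¹)))))
        * (T1 + R1)
      + sg (Sum.inl i : Fin m ⊕ Fin n) * ζ (Sum.inl i) * dkF p ε (Sum.inl i) q * R1
      + sg (Sum.inl i : Fin m ⊕ Fin n) * (1 / 2 * eF p ε q + sp (Sum.inl i : Fin m ⊕ Fin n) * kF p ε q)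
        * ζ (Sum.inl i) ^ 2)) =
      1 / 2 * ε * (rFun p q)⁻¹ * R1 * T1 - 1 / 2 * eF p ε q * ∑ i, ζ (Sum.inl i) ^ 2 := by
    have : ∀ c : ℝ, c * T1 = ∑ i, c * (co (q - p) (Sum.inl i) * ζ (Sum.inl i)) := fun c => by
      rw [hT1, Finset.mul_sum]
    rw [this (1 / 2 * ε * (rFun p q)⁻¹ * R1), Finset.mul_sum, ← Finset.sum_sub_distrib]
    refine Finset.sum_congr rfl fun i _ => ?_
    simp [dkF]
    ring
  have t2 : (∑ i : Fin n, (sg (Sum.inr i : Fin m ⊕ Fin n) * ζ (Sum.inr i)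
        * (-(1 / 2 * (ε * (sp (Sum.inr i : Fin m ⊕ Fin n) * (co (q - p) (Sum.inr i) * (rFun p q)⁻¹)))))
        * (T1 + R1)
      + sg (Sum.inr i : Fin m ⊕ Fin n) * ζ (Sum.inr i) * dkF p ε (Sum.inr i) q * R1
      + sg (Sum.inr i : Fin m ⊕ Fin n) * (1 / 2 * eF p ε q + sp (Sum.inr i : Fin m ⊕ Fin n) * kF p ε q)
        * ζ (Sum.inr i) ^ 2)) =
      (-(1 / 2 * ε * (rFun p q)⁻¹ * (T1 + R1))
        + ε * (1 / 2 * (rFun p q)⁻¹ - fFun p q * (rFun p q)⁻¹ ^ 3) * R1) * R1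
      + (1 / 2 * eF p ε q + kF p ε q) * ∑ i, ζ (Sum.inr i) ^ 2 := by
    have : ∀ c : ℝ, c * R1 = ∑ i, c * (co (q - p) (Sum.inr i) * ζ (Sum.inr i)) := fun c => by
      rw [hR1, Finset.mul_sum]
    rw [this (-(1 / 2 * ε * (rFun p q)⁻¹ * (T1 + R1))
        + ε * (1 / 2 * (rFun p q)⁻¹ - fFun p q * (rFun p q)⁻¹ ^ 3) * R1), Finset.mul_sum,
      ← Finset.sum_add_distrib]
    refine Finset.sum_congr rfl fun i _ => ?_
    simp [dkF]
    ring
  rw [t1, t2, kF]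
  field_simp
  ring

end

section

variable {m n : ℕ}

/-! ### Algebraic inequalities -/

/-- Here `S` is the Y-derivative, `T1` and `R1` are the time and space radial derivatives. With X =
2S/e one has (X - T1)e = R1(e + 2k), hence |R1| ≤ |X - T1|. Cauchy–Schwarz for `T1` has the factor
r² - 4f < r², and this deficit leaves room to split the cross term X·T1 and still keep a multiple
f/r² of `WT`. -/
lemma time_gradient_gain {f r e k T1 R1 WT S : ℝ} (hf : 0 < f) (hr : 0 < r) (he : 0 < e)
    (hk : 0 ≤ k) (h4 : 4 * f ≤ r ^ 2) (hWT : 0 ≤ WT) (hT : T1 ^ 2 ≤ (r ^ 2 - 4 * f) * WT)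
    (hS : S = 1 / 2 * e * (T1 + R1) + k * R1) :
    2 * f / r ^ 2 * WT - 2 * S ^ 2 / (f * e ^ 2) ≤ WT - R1 ^ 2 / r ^ 2 := by
  set X := 2 * S / e with hX
  have hXe : X * e = 2 * S := by rw [hX]; field_simp
  have h1 : R1 ^ 2 ≤ (X - T1) ^ 2 := by
    have h2 : (X - T1) * e = R1 * (e + 2 * k) := by
      rw [sub_mul, hXe, hS]; ring
    have h3 : (X - T1) ^ 2 * e ^ 2 = R1 ^ 2 * (e + 2 * k) ^ 2 := by
      rw [← mul_pow, h2, mul_pow]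
    have h5 : R1 ^ 2 * e ^ 2 ≤ (X - T1) ^ 2 * e ^ 2 := by
      rw [h3]
      have : e ^ 2 ≤ (e + 2 * k) ^ 2 := by gcongr; linarith
      exact mul_le_mul_of_nonneg_left this (sq_nonneg _)
    exact le_of_mul_le_mul_right h5 (by positivity)
  have hP : 0 ≤ X ^ 2 * (r ^ 2 - 4 * f) / (2 * f) :=
    div_nonneg (mul_nonneg (sq_nonneg _) (by linarith)) (by linarith)
  -- Arithmetic–geometric mean with weight 2f, chosen so that exactly half of the deficit 4f is
  -- spent.
  have h2 : -2 * X * T1 ≤ X ^ 2 * (r ^ 2 - 4 * f) / (2 * f) + 2 * f * WT := by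
    refine (le_abs_self _).trans (abs_le_of_sq_le_sq ?_ (by positivity))
    have e1 : (X ^ 2 * (r ^ 2 - 4 * f) / (2 * f)) * (2 * f * WT) =
        X ^ 2 * ((r ^ 2 - 4 * f) * WT) := by field_simp
    have e2 : X ^ 2 * T1 ^ 2 ≤ X ^ 2 * ((r ^ 2 - 4 * f) * WT) :=
      mul_le_mul_of_nonneg_left hT (sq_nonneg _)
    nlinarith [sq_nonneg (X ^ 2 * (r ^ 2 - 4 * f) / (2 * f) - 2 * f * WT)]
  have h3 : R1 ^ 2 ≤ (r ^ 2 - 2 * f) * WT + X ^ 2 * (r ^ 2 - 2 * f) / (2 * f) := by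
    have : X ^ 2 * (r ^ 2 - 2 * f) / (2 * f) = X ^ 2 + X ^ 2 * (r ^ 2 - 4 * f) / (2 * f) := by
      field_simp; ring
    nlinarith
  have h4' : X ^ 2 * (r ^ 2 - 2 * f) / (2 * f) ≤ r ^ 2 * (2 * S ^ 2 / (f * e ^ 2)) := by
    have : r ^ 2 * (2 * S ^ 2 / (f * e ^ 2)) = X ^ 2 * r ^ 2 / (2 * f) := by
      rw [hX]; field_simp
    rw [this]
    gcongr
    linarith
  have h5 : R1 ^ 2 / r ^ 2 ≤ (1 - 2 * f / r ^ 2) * WT + 2 * S ^ 2 / (f * e ^ 2) := by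
    rw [div_le_iff₀ (by positivity)]
    have : ((1 - 2 * f / r ^ 2) * WT + 2 * S ^ 2 / (f * e ^ 2)) * r ^ 2 =
        (r ^ 2 - 2 * f) * WT + r ^ 2 * (2 * S ^ 2 / (f * e ^ 2)) := by field_simp
    rw [this]
    linarith
  linarith

/-- The weight f e/(2a) on E² comes from completing the square against the term in (S + γw/2)². It
makes the contribution a²/f · C r² w² only linear in a, so the zeroth order gain a²u w² dominates
it. -/
lemma source_bound {a f r e u C Vb w G E : ℝ} (hf : 0 < f) (he1 : e ≤ 1)
    (hu : 0 < u) (ha : 1 ≤ a) (hC : 96 * C * r ^ 2 ≤ a * u) (hV : 24 * f * Vb ^ 2 ≤ a * u)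
    (hE : E ^ 2 ≤ 3 * (C * f * G + 4 * a ^ 2 / f * (C * r ^ 2) * w ^ 2 + Vb ^ 2 * w ^ 2)) :
    f * e / (2 * a) * E ^ 2 ≤ 3 * f / (2 * a) * (C * f) * G + (a ^ 2 * u / 8) * w ^ 2 := by
  have ha0 : 0 < a := by linarith
  have h1 : f * e / (2 * a) * E ^ 2 ≤ f / (2 * a) * (3 * (C * f * G
      + 4 * a ^ 2 / f * (C * r ^ 2) * w ^ 2 + Vb ^ 2 * w ^ 2)) := by
    have : f * e / (2 * a) ≤ f / (2 * a) := by
      gcongr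
      exact mul_le_of_le_one_right hf.le he1
    exact mul_le_mul this hE (sq_nonneg E) (by positivity)
  have h2 : f / (2 * a) * (3 * (C * f * G
      + 4 * a ^ 2 / f * (C * r ^ 2) * w ^ 2 + Vb ^ 2 * w ^ 2)) =
      3 * f / (2 * a) * (C * f) * G + (6 * a * (C * r ^ 2)) * w ^ 2
        + (3 * (f * Vb ^ 2) / (2 * a)) * w ^ 2 := by
    field_simp
    ring
  have h3 : 6 * a * (C * r ^ 2) ≤ a ^ 2 * u / 16 := by
    linarith [mul_le_mul_of_nonneg_left hC ha0.le]
  have h4 : 3 * (f * Vb ^ 2) / (2 * a) ≤ a ^ 2 * u / 16 := by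
    rw [div_le_iff₀ (by positivity)]
    have h5 : a * u * 1 ≤ a * u * a ^ 2 :=
      mul_le_mul_of_nonneg_left (one_le_pow₀ ha) (by positivity)
    linarith
  have h5 := mul_le_mul_of_nonneg_right h3 (sq_nonneg w)
  have h6 := mul_le_mul_of_nonneg_right h4 (sq_nonneg w)
  linarith

/-- The gradient error carries f², one factor from the weight of E² and one from |𝒳|² ≤ C f. This
matches the gain: u f for the angular part `WS - ρ`, but only u f²/r² for `WT`. The price is a
multiple of S². -/
lemma gradient_absorption {a f r e u C S WT WS ρ : ℝ} (hf : 0 < f) (hr : 0 < r)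
    (he : 1 / 2 ≤ e) (hu : 0 < u) (ha0 : 0 < a) (h4 : 4 * f ≤ r ^ 2) (hC0 : 0 ≤ C)
    (hC : 96 * C * r ^ 2 ≤ a * u) (hWT : 0 ≤ WT) (hρ : ρ ≤ WS)
    (hgain : 2 * f / r ^ 2 * WT - 2 * S ^ 2 / (f * e ^ 2) ≤ WT - ρ) :
    3 * f / (2 * a) * (C * f) * (WT + WS) ≤
      1 / 2 * (u * f) * (WT + WS - 2 * ρ) + 5 * u * S ^ 2 := by
  have he0 : 0 < e := by linarith
  have hSS : 2 * S ^ 2 / (f * e ^ 2) ≤ 8 * S ^ 2 / f := by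
    rw [div_le_div_iff₀ (by positivity) hf]
    have h1 : 1 / 4 ≤ e ^ 2 := by nlinarith
    have h2 := mul_le_mul_of_nonneg_left h1 (by positivity : 0 ≤ 8 * S ^ 2 * f)
    linarith
  have hCf : 384 * (C * f) ≤ a * u := by
    have := mul_le_mul_of_nonneg_left h4 hC0
    linarith
  have h1 : WT + WS ≤ (WS - ρ) + 2 * WT + 8 * S ^ 2 / f := by
    have : 0 ≤ 2 * f / r ^ 2 * WT := by positivity
    linarith
  have hc : 0 ≤ 3 * f / (2 * a) * (C * f) := by positivity
  have h2 := mul_le_mul_of_nonneg_left h1 hc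
  have h3 : 3 * f / (2 * a) * (C * f) ≤ 1 / 2 * (u * f) := by
    rw [div_mul_eq_mul_div, div_le_iff₀ (by positivity)]
    have h5 := mul_le_mul_of_nonneg_left hCf hf.le
    have h6 : 0 ≤ f * (C * f) := by positivity
    linarith
  have h4 := mul_le_mul_of_nonneg_right h3 (sub_nonneg.2 hρ)
  have h5 : 3 * f / (2 * a) * (C * f) * 2 ≤ 1 / 2 * (u * f) * (2 * f / r ^ 2) := by
    have e1 : 1 / 2 * (u * f) * (2 * f / r ^ 2) = u * f ^ 2 / r ^ 2 := by field_simp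
    have e2 : 3 * f / (2 * a) * (C * f) * 2 = 3 * C * f ^ 2 / a := by field_simp
    rw [e1, e2, div_le_div_iff₀ ha0 (by positivity)]
    have h6 : 0 ≤ C * r ^ 2 := by positivity
    have h7 : 3 * C * r ^ 2 ≤ u * a := by linarith
    linarith [mul_le_mul_of_nonneg_left h7 (sq_nonneg f)]
  have h6 := mul_le_mul_of_nonneg_right h5 hWT
  have h7 : 1 / 2 * (u * f) * (2 * f / r ^ 2 * WT - 8 * S ^ 2 / f) ≤
      1 / 2 * (u * f) * (WT - ρ) :=
    mul_le_mul_of_nonneg_left (by linarith) (by positivity)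
  have hcoef : (3 * f / (2 * a) * (C * f) + 1 / 2 * (u * f)) * (8 * S ^ 2 / f) ≤
      5 * u * S ^ 2 := by
    have e1 : (3 * f / (2 * a) * (C * f) + 1 / 2 * (u * f)) * (8 * S ^ 2 / f) =
        (12 * (C * f) / a + 4 * u) * S ^ 2 := by field_simp; ring
    rw [e1]
    refine mul_le_mul_of_nonneg_right ?_ (sq_nonneg S)
    have : 12 * (C * f) / a ≤ u := by
      rw [div_le_iff₀ ha0]
      have : 0 ≤ C * f := by positivity
      linarith
    linarith
  linarith

/-- Bookkeeping of a²u w²: of the available 1/4, the source takes 1/8 and replacing S by S + γw/2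
takes 1/16, which leaves 1/16. Of the coefficient 2a/(fe) of the square, a/(2fe) pays for the cross
term with E, and the rest dominates the 5u S² lost in the gradient terms. -/
lemma absorption {a f r e u C Vb L γ S w WT WS ρ E Z : ℝ} (hf : 0 < f) (hr : 0 < r)
    (he : 1 / 2 ≤ e) (he1 : e ≤ 1) (hu : 0 < u) (ha : 40 ≤ a) (hL : 2 ≤ L) (haL : 7 * L ≤ a)
    (hfu : f * u ≤ 1 / 8) (h4 : 4 * f ≤ r ^ 2) (hC0 : 0 ≤ C)
    (hC : 96 * C * r ^ 2 ≤ a * u) (hV : 24 * f * Vb ^ 2 ≤ a * u)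
    (hγ : |γ| ≤ L) (hWT : 0 ≤ WT) (hρ : ρ ≤ WS)
    (hgain : 2 * f / r ^ 2 * WT - 2 * S ^ 2 / (f * e ^ 2) ≤ WT - ρ)
    (hE : E ^ 2 ≤ 3 * (C * f * (WT + WS) + 4 * a ^ 2 / f * (C * r ^ 2) * w ^ 2 + Vb ^ 2 * w ^ 2))
    (hZ : a ^ 2 * u / 4 ≤ Z) :
    a ^ 2 * u / 16 * w ^ 2 ≤ E * (S + 1 / 2 * γ * w) + 2 * a / (f * e) * (S + 1 / 2 * γ * w) ^ 2
      + 1 / 2 * (u * f) * (WT + WS - 2 * ρ) + w ^ 2 * Z := by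
  have ha0 : 0 < a := by linarith
  have he0 : 0 < e := by linarith
  have hEE := source_bound hf he1 hu (by linarith) hC hV hE
  have hgrad := gradient_absorption hf hr he hu ha0 h4 hC0 hC hWT hρ hgain
  set Sw := S + 1 / 2 * γ * w with hSw
  have hESw : -(a / (2 * (f * e)) * Sw ^ 2) - f * e / (2 * a) * E ^ 2 ≤ E * Sw := by
    have h : 0 ≤ a / (2 * (f * e)) * (Sw + f * e / a * E) ^ 2 := by positivity
    have h2 : a / (2 * (f * e)) * (Sw + f * e / a * E) ^ 2 =
        a / (2 * (f * e)) * Sw ^ 2 + E * Sw + f * e / (2 * a) * E ^ 2 := by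
      field_simp
      ring
    linarith
  have hS2 : S ^ 2 ≤ 2 * Sw ^ 2 + 1 / 2 * L ^ 2 * w ^ 2 := by
    have h1 : S = Sw - 1 / 2 * γ * w := by rw [hSw]; ring
    have h2 : γ ^ 2 ≤ L ^ 2 := by
      rw [← sq_abs γ]
      gcongr
    have h3 := mul_le_mul_of_nonneg_right h2 (sq_nonneg w)
    have h4 : S ^ 2 + (Sw + 1 / 2 * γ * w) ^ 2 = 2 * Sw ^ 2 + 1 / 2 * (γ ^ 2 * w ^ 2) := by
      rw [h1]; ring
    linarith [sq_nonneg (Sw + 1 / 2 * γ * w)]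
  have hfin1 : 10 * u * Sw ^ 2 ≤ (2 * a / (f * e) - a / (2 * (f * e))) * Sw ^ 2 := by
    refine mul_le_mul_of_nonneg_right ?_ (sq_nonneg _)
    have e1 : 2 * a / (f * e) - a / (2 * (f * e)) = 3 * a / (2 * (f * e)) := by
      field_simp; ring
    rw [e1, le_div_iff₀ (by positivity)]
    have : f * u * e ≤ f * u := mul_le_of_le_one_right (by positivity) he1
    linarith
  have hfin2 : 5 / 2 * u * L ^ 2 * w ^ 2 ≤ a ^ 2 * u / 16 * w ^ 2 := by
    refine mul_le_mul_of_nonneg_right ?_ (sq_nonneg _)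
    have h1 : (7 * L) ^ 2 ≤ a ^ 2 := by gcongr
    have h2 := mul_le_mul_of_nonneg_left h1 hu.le
    have h3 : 0 ≤ u * L ^ 2 := by positivity
    linarith
  have hZ2 := mul_le_mul_of_nonneg_right hZ (sq_nonneg w)
  have h5S := mul_le_mul_of_nonneg_left hS2 (by positivity : 0 ≤ 5 * u)
  linarith

/-- The lower bound for the zeroth order coefficient. -/
lemma zeroth_order_bound {a f r ε L G2 e : ℝ} (hf : 0 < f) (hr : 0 < r) (hε : 0 < ε)
    (hr2 : ε * r ≤ 1 / 2) (h4 : 4 * f ≤ r ^ 2) (he : e = 1 - ε * r) (ha : 40 ≤ a)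
    (haL : 7 * L ≤ a) (hG : |G2| ≤ L * (ε / r)) :
    a ^ 2 * (ε / r) / 4 ≤
      (a ^ 2 * (f * e)⁻¹ + (a ^ 2 - a) * ε ^ 2 * (e ^ 2)⁻¹ - a * ε * (r * e)⁻¹)
          * (1 / 2 * (e + ε * (f * r⁻¹)))
      + 1 / 2 * (-(a ^ 2 / (2 * f ^ 2 * e)) * (2 * f * (1 - ε * r / 2))
        + (a ^ 2 * ε / (f * e ^ 2 * r) + 2 * (a ^ 2 - a) * ε ^ 3 / (e ^ 3 * r)
        + a * ε * (e - ε * r) / (r ^ 3 * e ^ 2)) * (r * (e * r / 2 + ε * f)))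
      - 1 / 4 * G2 := by
  have he0 : 1 / 2 ≤ e := by linarith
  have hepos : 0 < e := by linarith
  -- The terms in a²/f cancel exactly, since e = 1 - εr; a factor ε/r can then be taken out, and
  -- a²/(2e) is the leading positive term.
  have key : (a ^ 2 * (f * e)⁻¹ + (a ^ 2 - a) * ε ^ 2 * (e ^ 2)⁻¹ - a * ε * (r * e)⁻¹)
          * (1 / 2 * (e + ε * (f * r⁻¹)))
      + 1 / 2 * (-(a ^ 2 / (2 * f ^ 2 * e)) * (2 * f * (1 - ε * r / 2))
        + (a ^ 2 * ε / (f * e ^ 2 * r) + 2 * (a ^ 2 - a) * ε ^ 3 / (e ^ 3 * r)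
        + a * ε * (e - ε * r) / (r ^ 3 * e ^ 2)) * (r * (e * r / 2 + ε * f))) =
      (ε / r) * (a ^ 2 / (2 * e) + a ^ 2 * ε * r / (2 * e ^ 2)
        + (a ^ 2 - a) * (ε * r / (2 * e ^ 2)) * (e + ε * (f * r⁻¹))
        - a / (2 * e) * (e + ε * (f * r⁻¹))
        + (a ^ 2 - a) * (ε ^ 2 / e ^ 3) * (r * (e * r / 2 + ε * f))
        + 1 / 2 * a * (e - ε * r) / (r * e ^ 2) * (e * r / 2 + ε * f)) := by
    field_simp
    rw [he]
    ring
  rw [key]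
  have hu : 0 < ε / r := by positivity
  have hG' : G2 ≤ L * (ε / r) := (le_abs_self _).trans hG
  have haa : 0 ≤ a ^ 2 - a := by nlinarith
  have h1 : a ^ 2 / 2 ≤ a ^ 2 / (2 * e) := by
    gcongr
    nlinarith [mul_pos hε hr]
  have h2 : 0 ≤ a ^ 2 * ε * r / (2 * e ^ 2) := by positivity
  have h3 : 0 ≤ (a ^ 2 - a) * (ε * r / (2 * e ^ 2)) * (e + ε * (f * r⁻¹)) := by positivity
  have h4' : 0 ≤ (a ^ 2 - a) * (ε ^ 2 / e ^ 3) * (r * (e * r / 2 + ε * f)) := by positivity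
  have h5 : 0 ≤ 1 / 2 * a * (e - ε * r) / (r * e ^ 2) * (e * r / 2 + ε * f) := by
    have : 0 ≤ e - ε * r := by linarith
    have : 0 < a := by linarith
    positivity
  have h6 : a / (2 * e) * (e + ε * (f * r⁻¹)) ≤ 2 * a := by
    have ha0 : 0 < a := by linarith
    have e1 : a / (2 * e) ≤ a := by
      exact div_le_self ha0.le (by linarith)
    have e2 : ε * (f * r⁻¹) ≤ 1 / 8 := by
      rw [← div_eq_mul_inv, ← mul_div_assoc, div_le_iff₀ hr]
      have e3 := mul_le_mul_of_nonneg_left h4 hε.le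
      have e4 := mul_le_mul_of_nonneg_right hr2 hr.le
      linarith
    have e3 : e + ε * (f * r⁻¹) ≤ 2 := by linarith [mul_pos hε hr]
    have e4 : 0 ≤ e + ε * (f * r⁻¹) := by positivity
    linarith [mul_le_mul e1 e3 e4 ha0.le]
  have h9 : L ≤ a ^ 2 / 40 := by
    have := mul_le_mul_of_nonneg_left ha (by linarith : 0 ≤ a)
    linarith
  have h11 : 2 * a ≤ a ^ 2 / 20 := by
    have := mul_le_mul_of_nonneg_left ha (by linarith : 0 ≤ a)
    linarith
  clear key
  revert h1 h2 h3 h4' h5 h6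
  generalize a ^ 2 / (2 * e) = t1
  generalize a ^ 2 * ε * r / (2 * e ^ 2) = t2
  generalize (a ^ 2 - a) * (ε * r / (2 * e ^ 2)) * (e + ε * (f * r⁻¹)) = t3
  generalize (a ^ 2 - a) * (ε ^ 2 / e ^ 3) * (r * (e * r / 2 + ε * f)) = t4
  generalize 1 / 2 * a * (e - ε * r) / (r * e ^ 2) * (e * r / 2 + ε * f) = t5
  generalize a / (2 * e) * (e + ε * (f * r⁻¹)) = t6
  intro h1 h2 h3 h4' h5 h6
  generalize ε / r = u at *
  have h8 : u * (a ^ 2 / 4 + L / 4) ≤ u * (t1 + t2 + t3 - t6 + t4 + t5) :=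
    mul_le_mul_of_nonneg_left (by linarith [sq_nonneg a]) hu.le
  linarith

end

section

variable {m n : ℕ}

/-! ### The pointwise Carleman estimate -/

/-- The weight function `f_p / (1 - ε r_p)`. -/
def hF (p : Spacetime m n) (ε : ℝ) (q : Spacetime m n) : ℝ := fFun p q * (eF p ε q)⁻¹

/-- The partial derivatives of `hF ^ a`. -/
def dWt (p : Spacetime m n) (ε : ℝ) (a : ℕ) (i : Fin m ⊕ Fin n) (q : Spacetime m n) : ℝ :=
  a * (hF p ε q ^ a * (sg i * Yv p ε i q * (fFun p q * eF p ε q)⁻¹))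

variable {p q : Spacetime m n} {ε : ℝ}

/-- The differential of h = f/e is (e df + εf dr)/e², that is Y lowered with g and divided by e².
Hence d(h^a) = a h^a Y♭/(fe): the multiplier is the gradient direction of the weight. -/
lemma hasPD_hF_pow (hf : 0 < fFun p q) (he : 0 < eF p ε q) {a : ℕ} (ha : a ≠ 0) :
    HasPD (fun y => hF p ε y ^ a) (fun i => dWt p ε a i q) q := by
  have hr := rFun_pos hf
  obtain ⟨b, rfl⟩ := Nat.exists_eq_succ_of_ne_zero ha
  have h := ((hasPD_fFun p q).mul ((hasPD_eF (ε := ε) hr).inv he.ne')).pow (b + 1)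
  refine h.congr fun i => ?_
  rw [dWt, hF, Yv, kF]
  simp only [add_tsub_cancel_right, pow_succ]
  rcases i with i | i
  · simp
    field_simp
    ring
  · simp
    field_simp

lemma hasPD_dWt (hf : 0 < fFun p q) (he : 0 < eF p ε q) {a : ℕ} (ha : a ≠ 0)
    (i : Fin m ⊕ Fin n) : HasPD (dWt p ε a i) (fun j => a * (dWt p ε a j q
      * (sg i * Yv p ε i q * (fFun p q * eF p ε q)⁻¹)
      + hF p ε q ^ a * ((sg i * ((-(1 / 2 * (ε * (sp j * (co (q - p) j * (rFun p q)⁻¹))))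
          + sp i * dkF p ε j q) * co (q - p) i
          + (1 / 2 * eF p ε q + sp i * kF p ε q) * (if j = i then 1 else 0)))
          * (fFun p q * eF p ε q)⁻¹
        + sg i * Yv p ε i q * (-(sg j * co (q - p) j / 2 * eF p ε q
          + fFun p q * -(ε * (sp j * (co (q - p) j * (rFun p q)⁻¹))))
            / (fFun p q * eF p ε q) ^ 2)))) q :=
  ((hasPD_hF_pow hf he ha).mul
    (((hasPD_Yv (rFun_pos hf) i).const_mul (sg i)).mul
      (((hasPD_fFun p q).mul (hasPD_eF (rFun_pos hf))).inv (mul_pos hf he).ne'))).const_mul (a : ℝ)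

/-- This is g(Y, Y). It is positive on 𝔇_p where `eF` is, and its factor f cancels one of the two
factors f in the denominator of |∇h^a|²/h^{2a}. -/
lemma sum_sg_Yv_sq (h : 0 < rFun p q) :
    ∑ i, sg i * Yv p ε i q ^ 2 = fFun p q * (eF p ε q + ε ^ 2 * fFun p q) := by
  rw [sum_quadratic (p := p) (q := q) _ (-(1 / 2 * eF p ε q) ^ 2)
    ((1 / 2 * eF p ε q + kF p ε q) ^ 2) 0 0]
  · rw [kF, eF]
    field_simp
    ring
  · intro i
    simp [Yv]
    ring
  · intro i
    simp [Yv]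
    ring

/-- The coefficients e/2 ≤ 1/2 and k ≤ 1/8 are small enough for a Euclidean bound with constant 1;
it is needed for the pairing of 𝒳 with the gradient of the weight. -/
lemma sum_Yv_sq_le (hf : 0 < fFun p q) (hε : 0 < ε) (hr2 : ε * rFun p q ≤ 1 / 2) :
    ∑ i, Yv p ε i q ^ 2 ≤ rFun p q ^ 2 := by
  have h := rFun_pos hf
  have h4 : 4 * fFun p q ≤ rFun p q ^ 2 := by
    rw [four_fFun]; linarith [sq_nonneg ‖q.1 - p.1‖]
  rw [sum_quadratic (p := p) (q := q) _ ((1 / 2 * eF p ε q) ^ 2)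
    ((1 / 2 * eF p ε q + kF p ε q) ^ 2) 0 0]
  · have he0 : 0 ≤ 1 / 2 * eF p ε q := by rw [eF]; linarith
    have he1 : 1 / 2 * eF p ε q ≤ 1 / 2 := by rw [eF]; linarith [mul_pos hε h]
    have hk : kF p ε q ≤ 1 / 8 := by
      rw [kF, ← div_eq_mul_inv, ← mul_div_assoc, div_le_iff₀ h]
      have e3 := mul_le_mul_of_nonneg_left h4 hε.le
      have e4 := mul_le_mul_of_nonneg_right hr2 h.le
      linarith
    have hk0 : 0 ≤ kF p ε q := by rw [kF]; positivity
    have h1 : (1 / 2 * eF p ε q) ^ 2 ≤ (1 / 2) ^ 2 := by gcongr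
    have h2 : (1 / 2 * eF p ε q + kF p ε q) ^ 2 ≤ (1 / 2 + 1 / 8) ^ 2 := by gcongr
    have h3 := mul_le_mul h1 (by linarith : rFun p q ^ 2 - 4 * fFun p q ≤ rFun p q ^ 2)
      (by linarith) (by norm_num)
    have h5 := mul_le_mul_of_nonneg_right h2 (sq_nonneg (rFun p q))
    linarith [sq_nonneg (rFun p q)]
  · intro i
    simp [Yv]
    ring
  · intro i
    simp [Yv]
    ring

/-- `box` of the weight `hF ^ a`, from its partial derivatives. -/
lemma box_hF_pow (hf : 0 < fFun p q) (he : 0 < eF p ε q) (a : ℕ) :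
    ∑ i, sg i * (a * (dWt p ε a i q
      * (sg i * Yv p ε i q * (fFun p q * eF p ε q)⁻¹)
      + hF p ε q ^ a * ((sg i * ((-(1 / 2 * (ε * (sp i * (co (q - p) i * (rFun p q)⁻¹))))
          + sp i * dkF p ε i q) * co (q - p) i
          + (1 / 2 * eF p ε q + sp i * kF p ε q) * (if i = i then 1 else 0)))
          * (fFun p q * eF p ε q)⁻¹
        + sg i * Yv p ε i q * (-(sg i * co (q - p) i / 2 * eF p ε q
          + fFun p q * -(ε * (sp i * (co (q - p) i * (rFun p q)⁻¹))))
            / (fFun p q * eF p ε q) ^ 2)))) =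
      a * hF p ε q ^ a * (a * (eF p ε q + ε ^ 2 * fFun p q) / (fFun p q * eF p ε q ^ 2)
        + (((m : ℝ) + n) / 2 * eF p ε q + ((n : ℝ) - 1) * kF p ε q) / (fFun p q * eF p ε q)
        - (eF p ε q ^ 2 - ε ^ 2 * fFun p q) / (fFun p q * eF p ε q ^ 2)) := by
  have hr := rFun_pos hf
  rw [← divergence_Yv hr]
  have h1 := sum_sg_Yv_sq (p := p) (q := q) (ε := ε) hr
  have h2 := sum_Yv_mul (p := p) (q := q) (ε := ε) hr (eF p ε q / 2) (-(fFun p q * ε / rFun p q))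
  have h3 : eF p ε q / 2 * (2 * fFun p q * (1 - ε * rFun p q / 2)) +
      -(fFun p q * ε / rFun p q) * (rFun p q * (eF p ε q * rFun p q / 2 + ε * fFun p q)) =
      fFun p q * (eF p ε q ^ 2 - ε ^ 2 * fFun p q) := by
    rw [eF]
    field_simp
    ring
  rw [h3] at h2
  have e1 : a * (eF p ε q + ε ^ 2 * fFun p q) / (fFun p q * eF p ε q ^ 2) =
      a / (fFun p q * eF p ε q) ^ 2 * (fFun p q * (eF p ε q + ε ^ 2 * fFun p q)) := by
    field_simp
  have e2 : (eF p ε q ^ 2 - ε ^ 2 * fFun p q) / (fFun p q * eF p ε q ^ 2) =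
      1 / (fFun p q * eF p ε q) ^ 2 * (fFun p q * (eF p ε q ^ 2 - ε ^ 2 * fFun p q)) := by
    field_simp
  rw [e1, e2, ← h1, ← h2, Finset.mul_sum, Finset.mul_sum, Finset.sum_div,
    ← Finset.sum_add_distrib, ← Finset.sum_sub_distrib, Finset.mul_sum]
  refine Finset.sum_congr rfl fun i _ => ?_
  have hs := sg_mul_self i
  rw [dWt]
  generalize Yv p ε i q = Y
  generalize hF p ε q ^ a = W
  field_simp
  rcases i with i | i <;> simp only [sg_inl, sg_inr, sp_inl, sp_inr, if_true] <;> ring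

/-- The constant that bounds the coefficients of the multiplier. -/
def dimC (m n : ℕ) : ℝ := 2 * ((m : ℝ) + n + 2) ^ 2

lemma two_le_dimC (m n : ℕ) : 2 ≤ dimC m n := by
  have : (0 : ℝ) ≤ (m : ℝ) + n := by positivity
  rw [dimC]
  nlinarith

lemma abs_gamF_le (hf : 0 < fFun p q) (hε : 0 < ε) (hr2 : ε * rFun p q ≤ 1 / 2)
    (hk : kF p ε q ≤ 1 / 8) : |gamF p ε q| ≤ dimC m n := by
  have h := rFun_pos hf
  have he0 : 0 ≤ eF p ε q := by rw [eF]; linarith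
  have he1 : eF p ε q ≤ 1 := by rw [eF]; linarith [mul_pos hε h]
  have hk0 : 0 ≤ kF p ε q := by rw [kF]; positivity
  have hm : (0 : ℝ) ≤ m := by positivity
  have hn : (0 : ℝ) ≤ n := by positivity
  have h1 : |((m : ℝ) + n - 2) / 2| ≤ ((m : ℝ) + n + 2) / 2 := by
    rw [abs_le]; constructor <;> linarith
  have h2 : |(n : ℝ) - 2| ≤ (m : ℝ) + n + 2 := by
    rw [abs_le]; constructor <;> linarith
  have h3 : |gamF p ε q| ≤ ((m : ℝ) + n + 2) / 2 * 1 + ((m : ℝ) + n + 2) * (1 / 8) := by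
    rw [gamF]
    refine (abs_add_le _ _).trans (add_le_add ?_ ?_)
    · rw [abs_mul, abs_of_nonneg he0]
      exact mul_le_mul h1 he1 he0 (by positivity)
    · rw [abs_mul, abs_of_nonneg hk0]
      exact mul_le_mul h2 hk hk0 (by positivity)
  rw [dimC]
  nlinarith

/-- By f ≤ r²/4 the term f/r³ is no worse than 1/r, so □γ has the size ε/r of the zeroth order gain
and is beaten by taking a large. -/
lemma abs_box_gamF_le (hf : 0 < fFun p q) (hε : 0 < ε) :
    |-(((m : ℝ) + n - 2) / 2 * (ε * ((n - 1) / rFun p q)))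
      + ((n : ℝ) - 2) * (ε * ((m + n - 2) / (2 * rFun p q)
        - (n - 3) * fFun p q / rFun p q ^ 3))| ≤ dimC m n * (ε / rFun p q) := by
  have h := rFun_pos hf
  have h4 : 4 * fFun p q ≤ rFun p q ^ 2 := by
    rw [four_fFun]; linarith [sq_nonneg ‖q.1 - p.1‖]
  have hm : (0 : ℝ) ≤ m := by positivity
  have hn : (0 : ℝ) ≤ n := by positivity
  set s : ℝ := (m : ℝ) + n + 2 with hs
  have hφ : fFun p q / rFun p q ^ 2 ≤ 1 / 4 := by
    rw [div_le_iff₀ (by positivity)]; linarith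
  have hφ0 : 0 ≤ fFun p q / rFun p q ^ 2 := by positivity
  have e : -(((m : ℝ) + n - 2) / 2 * (ε * ((n - 1) / rFun p q)))
      + ((n : ℝ) - 2) * (ε * ((m + n - 2) / (2 * rFun p q)
        - (n - 3) * fFun p q / rFun p q ^ 3)) =
      (-(((m : ℝ) + n - 2) / 2 * (n - 1)) + ((n : ℝ) - 2) * ((m + n - 2) / 2
        - (n - 3) * (fFun p q / rFun p q ^ 2))) * (ε / rFun p q) := by
    field_simp
  have hu : 0 ≤ ε / rFun p q := by positivity
  rw [e, abs_mul, abs_of_nonneg hu]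
  refine mul_le_mul_of_nonneg_right ?_ hu
  have b1 : |((m : ℝ) + n - 2) / 2| ≤ s := by rw [abs_le]; constructor <;> linarith
  have b2 : |(n : ℝ) - 1| ≤ s := by rw [abs_le]; constructor <;> linarith
  have b3 : |(n : ℝ) - 2| ≤ s := by rw [abs_le]; constructor <;> linarith
  have b5 : |((m : ℝ) + n - 2) / 2| ≤ s / 2 := by rw [abs_le]; constructor <;> linarith
  have b4 : |(m + n - 2) / 2 - (n - 3) * (fFun p q / rFun p q ^ 2)| ≤ s := by
    have c1 : |((n : ℝ) - 3) * (fFun p q / rFun p q ^ 2)| ≤ 2 * s * (1 / 4) := by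
      rw [abs_mul, abs_of_nonneg hφ0]
      refine mul_le_mul ?_ hφ hφ0 (by positivity)
      rw [abs_le]; constructor <;> linarith
    have := abs_sub (((m : ℝ) + n - 2) / 2) (((n : ℝ) - 3) * (fFun p q / rFun p q ^ 2))
    linarith
  refine (abs_add_le _ _).trans ?_
  rw [abs_neg, abs_mul, abs_mul]
  have := mul_le_mul b1 b2 (abs_nonneg _) (by positivity)
  have := mul_le_mul b3 b4 (abs_nonneg _) (by positivity)
  rw [dimC]
  linarith

/-- The partial derivatives of `hF ^ a * z` when `z` has the partial derivatives `z'`. -/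
def zt (p : Spacetime m n) (ε : ℝ) (a : ℕ) (z : ℝ) (z' : Fin m ⊕ Fin n → ℝ)
    (i : Fin m ⊕ Fin n) (q : Spacetime m n) : ℝ :=
  dWt p ε a i q * z + hF p ε q ^ a * z' i

lemma hasPD_weighted {z : Spacetime m n → ℝ} (hz : DifferentiableAt ℝ z q)
    (hf : 0 < fFun p q) (he : 0 < eF p ε q) {a : ℕ} (ha : a ≠ 0) :
    HasPD (fun y => hF p ε y ^ a * z y)
      (fun i => zt p ε a (z q) (fun j => fderiv ℝ z q (bv j)) i q) q :=
  (hasPD_hF_pow hf he ha).mul (DifferentiableAt.hasPD hz)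

/-! ### Regularity of the weight and of the coefficients -/

lemma continuous_fFun (p : Spacetime m n) : Continuous (fFun p) :=
  continuous_iff_continuousAt.2 fun q => (hasPD_fFun p q).1.continuousAt

lemma continuous_rFun (p : Spacetime m n) : Continuous (rFun p) := by
  unfold rFun; fun_prop

lemma continuous_eF (p : Spacetime m n) (ε : ℝ) : Continuous (eF p ε) :=
  continuous_const.sub (continuous_const.mul (continuous_rFun p))

lemma contDiff_co (p : Spacetime m n) (i : Fin m ⊕ Fin n) {k : WithTop ℕ∞} :
    ContDiff ℝ k (fun q => co (q - p) i) := by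
  rcases i with i | i
  · have := (((EuclideanSpace.proj (𝕜 := ℝ) i).comp
      (ContinuousLinearMap.fst ℝ (EuclideanSpace ℝ (Fin m))
        (EuclideanSpace ℝ (Fin n)))).contDiff (n := k)).sub (contDiff_const (c := p.1 i))
    exact this
  · have := (((EuclideanSpace.proj (𝕜 := ℝ) i).comp
      (ContinuousLinearMap.snd ℝ (EuclideanSpace ℝ (Fin m))
        (EuclideanSpace ℝ (Fin n)))).contDiff (n := k)).sub (contDiff_const (c := p.2 i))
    exact this

lemma contDiff_fFun (p : Spacetime m n) {k : WithTop ℕ∞} : ContDiff ℝ k (fFun p) := by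
  have : fFun p = fun q => (∑ j, sg j * (co (q - p) j * co (q - p) j)) / 4 := by
    funext q
    exact fFun_eq_sum p q
  rw [this]
  exact (ContDiff.sum fun j _ =>
    contDiff_const.mul ((contDiff_co p j).mul (contDiff_co p j))).div_const 4

lemma contDiffAt_rFun (h : 0 < rFun p q) {k : WithTop ℕ∞} : ContDiffAt ℝ k (rFun p) q :=
  (contDiffAt_snd.sub contDiffAt_const).norm ℝ (norm_pos_iff.1 h)

lemma contDiffAt_rInv (h : 0 < rFun p q) {k : WithTop ℕ∞} :
    ContDiffAt ℝ k (fun y => (rFun p y)⁻¹) q := (contDiffAt_rFun h).inv h.ne'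

lemma contDiffAt_eF (h : 0 < rFun p q) {k : WithTop ℕ∞} : ContDiffAt ℝ k (eF p ε) q :=
  contDiffAt_const.sub (contDiffAt_const.mul (contDiffAt_rFun h))

lemma contDiffAt_kF (h : 0 < rFun p q) {k : WithTop ℕ∞} : ContDiffAt ℝ k (kF p ε) q :=
  contDiffAt_const.mul ((contDiff_fFun p).contDiffAt.mul (contDiffAt_rInv h))

lemma contDiffAt_dkF (h : 0 < rFun p q) (i : Fin m ⊕ Fin n) {k : WithTop ℕ∞} :
    ContDiffAt ℝ k (dkF p ε i) q :=
  contDiffAt_const.mul ((contDiffAt_const.mul ((contDiff_co p i).contDiffAt.mul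
    (contDiffAt_rInv h))).sub (contDiffAt_const.mul ((contDiff_fFun p).contDiffAt.mul
      ((contDiff_co p i).contDiffAt.mul ((contDiffAt_rInv h).pow 3)))))

lemma contDiffAt_Yv (h : 0 < rFun p q) (i : Fin m ⊕ Fin n) {k : WithTop ℕ∞} :
    ContDiffAt ℝ k (Yv p ε i) q :=
  ((contDiffAt_const.mul (contDiffAt_eF h)).add (contDiffAt_const.mul (contDiffAt_kF h))).mul
    (contDiff_co p i).contDiffAt

lemma contDiffAt_gamF (h : 0 < rFun p q) {k : WithTop ℕ∞} : ContDiffAt ℝ k (gamF p ε) q :=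
  (contDiffAt_const.mul (contDiffAt_eF h)).add (contDiffAt_const.mul (contDiffAt_kF h))

lemma contDiffAt_dgamF (h : 0 < rFun p q) (i : Fin m ⊕ Fin n) {k : WithTop ℕ∞} :
    ContDiffAt ℝ k (dgamF p ε i) q :=
  (contDiffAt_const.mul (contDiffAt_const.mul (contDiffAt_const.mul
    ((contDiff_co p i).contDiffAt.mul (contDiffAt_rInv h))))).neg.add
    (contDiffAt_const.mul (contDiffAt_dkF h i))

lemma contDiffAt_AF (hf : 0 < fFun p q) (he : 0 < eF p ε q) {a : ℝ} {k : WithTop ℕ∞} :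
    ContDiffAt ℝ k (AF p ε a) q := by
  have hr := rFun_pos hf
  have hE : ContDiffAt ℝ k (eF p ε) q := contDiffAt_eF hr
  have h1 := ((contDiff_fFun p).contDiffAt.mul hE).inv (mul_pos hf he).ne'
  have h2 := (hE.pow 2).inv (pow_pos he 2).ne'
  have h3 := ((contDiffAt_rFun hr).mul hE).inv (mul_pos hr he).ne'
  exact ((contDiffAt_const.mul h1).add (contDiffAt_const.mul h2)).sub (contDiffAt_const.mul h3)

lemma contDiffAt_hF_pow (hf : 0 < fFun p q) (he : 0 < eF p ε q) (a : ℕ) {k : WithTop ℕ∞} :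
    ContDiffAt ℝ k (fun y => hF p ε y ^ a) q :=
  ((contDiff_fFun p).contDiffAt.mul ((contDiffAt_eF (rFun_pos hf)).inv he.ne')).pow a

lemma contDiffAt_dWt (hf : 0 < fFun p q) (he : 0 < eF p ε q) (a : ℕ) (i : Fin m ⊕ Fin n)
    {k : WithTop ℕ∞} : ContDiffAt ℝ k (dWt p ε a i) q := by
  have hE : ContDiffAt ℝ k (eF p ε) q := contDiffAt_eF (rFun_pos hf)
  exact contDiffAt_const.mul ((contDiffAt_hF_pow hf he a).mul
    ((contDiffAt_const.mul (contDiffAt_Yv (rFun_pos hf) i)).mul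
      (((contDiff_fFun p).contDiffAt.mul hE).inv (mul_pos hf he).ne')))

/-! ### Conjugation with the weight and assembly of the estimate -/

/-- The reduction of the conjugated operator to the original one. -/
lemma conjugation_identity {f e r a N ν SZ zq W bz : ℝ} (hf : 0 < f) (he : 0 < e) (hr : 0 < r)
    (hre : ε * r = 1 - e) :
    W * bz + 2 * (a * W * (f * e)⁻¹ * SZ) + zq * (a * W * (a * (e + ε ^ 2 * f) / (f * e ^ 2)
        + (N / 2 * e + (ν - 1) * (ε * (f * r⁻¹))) / (f * e)
        - (e ^ 2 - ε ^ 2 * f) / (f * e ^ 2))) =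
      W * bz + 2 * a / (f * e) * (zq * a * W * (f * e)⁻¹ * (f * (e + ε ^ 2 * f)) + W * SZ)
        - ((a ^ 2 * (f * e)⁻¹ + (a ^ 2 - a) * ε ^ 2 * (e ^ 2)⁻¹ - a * ε * (r * e)⁻¹)
          - a * ((N - 2) / 2 * e + (ν - 2) * (ε * (f * r⁻¹))) / (f * e)) * (W * zq) := by
  have hε : ε = (1 - e) / r := by rw [← hre]; field_simp
  rw [hε]
  field_simp
  ring

/-- `Q1` is 𝒳w and `Q2` the pairing of 𝒳 with Y♭. Both squares carry the factor f from |𝒳|² ≤ C f,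
which softens the singularity 1/f of the logarithmic derivative of the weight. -/
lemma source_sq_le {a f e r C Vb V w Q1 Q2 E G : ℝ} (hf : 0 < f) (he2 : 1 / 2 ≤ e) (hC0 : 0 ≤ C)
    (hE : E = -Q1 + a * (f * e)⁻¹ * Q2 * w - V * w) (hQ1 : Q1 ^ 2 ≤ C * f * G)
    (hQ2 : Q2 ^ 2 ≤ C * f * r ^ 2) (hV : |V| ≤ Vb) :
    E ^ 2 ≤ 3 * (C * f * G + 4 * a ^ 2 / f * (C * r ^ 2) * w ^ 2 + Vb ^ 2 * w ^ 2) := by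
  have he : 0 < e := by linarith
  have hQ3b : (a * (f * e)⁻¹ * Q2) ^ 2 ≤ 4 * a ^ 2 / f * (C * r ^ 2) := by
    have h1 : (a * (f * e)⁻¹ * Q2) ^ 2 ≤ (a * (f * e)⁻¹) ^ 2 * (C * f * r ^ 2) := by
      rw [mul_pow]
      exact mul_le_mul_of_nonneg_left hQ2 (sq_nonneg _)
    have h2 : (a * (f * e)⁻¹) ^ 2 * (C * f * r ^ 2) =
        (e ^ 2)⁻¹ * (a ^ 2 / f * (C * r ^ 2)) := by
      field_simp
    have h3 : (e ^ 2)⁻¹ ≤ 4 := by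
      rw [inv_le_comm₀ (by positivity) (by norm_num)]
      nlinarith
    have h5 := mul_le_mul_of_nonneg_right h3 (by positivity : 0 ≤ a ^ 2 / f * (C * r ^ 2))
    have h6 : 4 * (a ^ 2 / f * (C * r ^ 2)) = 4 * a ^ 2 / f * (C * r ^ 2) := by ring
    linarith
  have hV2 : V ^ 2 ≤ Vb ^ 2 := by
    rw [← sq_abs V]
    gcongr
  have h7 := mul_le_mul_of_nonneg_right hQ3b (sq_nonneg w)
  have h8 := mul_le_mul_of_nonneg_right hV2 (sq_nonneg w)
  have h9 : ∀ x y v : ℝ, (-x + y - v) ^ 2 ≤ 3 * (x ^ 2 + y ^ 2 + v ^ 2) := fun x y v => by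
    linarith [sq_nonneg (x + y), sq_nonneg (x - v), sq_nonneg (y + v)]
  rw [hE]
  refine (h9 _ _ _).trans ?_
  rw [mul_pow _ w, mul_pow _ w]
  linarith

-- The positive lower bound that drives the uniqueness. The conjugated equation turns the multiplier
-- identity into the source term, a perfect square, the quadratic form in ∇w and a zeroth order
-- term, which are exactly the data of `absorption`. The lower bounds on a depend only on m, n, ε,
-- R, C and Vb, so one a serves the whole region.
set_option maxHeartbeats 800000 in
theorem carleman_pointwise {z : Spacetime m n → ℝ} {a : ℕ} {R C Vb V : ℝ} {X : Spacetime m n}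
    (hz : ContDiffAt ℝ 2 z q) (hf : 0 < fFun p q) (hε : 0 < ε)
    (hr2 : ε * rFun p q ≤ 1 / 2) (hR : rFun p q ≤ R) (hC0 : 0 ≤ C)
    (hX : ∑ i, co X i ^ 2 ≤ C * fFun p q) (hV : |V| ≤ Vb)
    (heq : box z q + fderiv ℝ z q X + V * z q = 0)
    (ha : 40 ≤ (a : ℝ)) (haL : 7 * dimC m n ≤ a) (haC : 96 * C * R ^ 3 ≤ a * ε)
    (haV : 6 * R ^ 3 * Vb ^ 2 ≤ a * ε) :
    (a : ℝ) ^ 2 * (ε / rFun p q) / 16 * (hF p ε q ^ a * z q) ^ 2 ≤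
      ∑ i, fderiv ℝ (fun y => current (fun j => Yv p ε j y) (gamF p ε y)
        (fun j => dgamF p ε j y) (AF p ε a y) (hF p ε y ^ a * z y)
        (fun j => zt p ε a (z y) (fun j => fderiv ℝ z y (bv j)) j y) i) q (bv i) := by
  have hr := rFun_pos hf
  have he2 : 1 / 2 ≤ eF p ε q := by rw [eF]; linarith
  have he : 0 < eF p ε q := by linarith
  have he1 : eF p ε q ≤ 1 := by rw [eF]; linarith [mul_pos hε hr]
  have ha0 : a ≠ 0 := by rintro rfl; norm_num at ha
  have h4 : 4 * fFun p q ≤ rFun p q ^ 2 := by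
    rw [four_fFun]; linarith [sq_nonneg ‖q.1 - p.1‖]
  set w : Spacetime m n → ℝ := fun y => hF p ε y ^ a * z y with hw
  set ζ : Fin m ⊕ Fin n → Spacetime m n → ℝ :=
    fun j y => zt p ε a (z y) (fun j => fderiv ℝ z y (bv j)) j y with hζ
  -- second derivatives of `z`
  have hz1 : DifferentiableAt ℝ z q := hz.differentiableAt (by norm_num)
  have hz2 : DifferentiableAt ℝ (fderiv ℝ z) q :=
    (hz.fderiv_right (m := 1) (by norm_num)).differentiableAt (by norm_num)
  have hzsym : IsSymmSndFDerivAt ℝ z q := hz.isSymmSndFDerivAt (by simp)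
  set z2 : Fin m ⊕ Fin n → Fin m ⊕ Fin n → ℝ :=
    fun i j => fderiv ℝ (fderiv ℝ z) q (bv j) (bv i) with hz2def
  have hzi : ∀ i, HasPD (fun y => fderiv ℝ z y (bv i)) (z2 i) q := fun i => by
    have h : HasFDerivAt (fun y => fderiv ℝ z y (bv i))
        ((fderiv ℝ (fderiv ℝ z) q).flip (bv i)) q := by
      have := hz2.hasFDerivAt.clm_apply (hasFDerivAt_const (bv i) q)
      simpa using this
    exact ⟨h.differentiableAt, fun j => by rw [h.fderiv]; rfl⟩
  have hbox : box z q = ∑ i, sg i * z2 i i := by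
    refine box_eq_sum (U' := fun i y => fderiv ℝ z y (bv i)) hz2 ?_ hzi
    filter_upwards [hz.eventually (by simp)] with y hy
    exact DifferentiableAt.hasPD (hy.differentiableAt (by norm_num))
  -- second derivatives of `w`
  have hwPD : HasPD w (fun i => ζ i q) q := hasPD_weighted hz1 hf he ha0
  have hζPD := hasPD_mul_second (hasPD_hF_pow hf he ha0) (DifferentiableAt.hasPD hz1)
    (fun i => hasPD_dWt hf he ha0 i) hzi
  have hζPD' : ∀ i, HasPD (ζ i) _ q := hζPD
  set w2 : Fin m ⊕ Fin n → Fin m ⊕ Fin n → ℝ := fun i j => fderiv ℝ (ζ i) q (bv j) with hw2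
  have hζ2 : ∀ i, HasPD (ζ i) (w2 i) q := fun i => DifferentiableAt.hasPD (hζPD' i).1
  have hev : ∀ᶠ y in 𝓝 q, ContDiffAt ℝ 2 z y ∧ 0 < fFun p y ∧ 0 < eF p ε y :=
    (hz.eventually (by simp)).and (((continuous_fFun p).continuousAt.eventually
      (lt_mem_nhds hf)).and ((continuous_eF p ε).continuousAt.eventually (lt_mem_nhds he)))
  have hsym : ∀ i j, w2 i j = w2 j i := by
    have hwC : ContDiffAt ℝ 2 w q := (contDiffAt_hF_pow hf he a).mul hz
    have hws : IsSymmSndFDerivAt ℝ w q := hwC.isSymmSndFDerivAt (by simp)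
    have hwd : DifferentiableAt ℝ (fderiv ℝ w) q :=
      (hwC.fderiv_right (m := 1) (by norm_num)).differentiableAt (by norm_num)
    have h1 : ∀ i j, w2 i j = fderiv ℝ (fderiv ℝ w) q (bv j) (bv i) := by
      intro i j
      have e1 : ζ i =ᶠ[𝓝 q] fun y => fderiv ℝ w y (bv i) := by
        filter_upwards [hev] with y hy
        exact ((hasPD_weighted (hy.1.differentiableAt (by norm_num)) hy.2.1 hy.2.2 ha0).2 i).symm
      rw [hw2]
      simp only
      rw [e1.fderiv_eq, fderiv_clm_apply hwd (differentiableAt_const _)]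
      simp
    intro i j
    rw [h1, h1]
    exact hws _ _
  rw [divergence_current hwPD hζ2 hsym (hasPD_Yv hr) (hasPD_gamF hr) (hasPD_dgamF hr)
    (hasPD_AF hf he), deformation_Yv hr, divergence_Yv hr, box_gamF hr, sum_Yv_mul hr, sum_sg_sq]
  -- the equation for `w`
  set zi : Fin m ⊕ Fin n → ℝ := fun i => fderiv ℝ z q (bv i) with hzi'
  set SZ := ∑ i, Yv p ε i q * zi i with hSZ
  set S := ∑ i, Yv p ε i q * ζ i q with hS
  set W := hF p ε q ^ a with hW
  have hζq : ∀ i, ζ i q = a * (W * (sg i * Yv p ε i q * (fFun p q * eF p ε q)⁻¹)) * z q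
      + W * zi i := fun i => rfl
  have hSval : S = z q * a * W * (fFun p q * eF p ε q)⁻¹
      * (fFun p q * (eF p ε q + ε ^ 2 * fFun p q)) + W * SZ := by
    rw [← sum_sg_Yv_sq hr, hSZ, hS, Finset.mul_sum, Finset.mul_sum, ← Finset.sum_add_distrib]
    refine Finset.sum_congr rfl fun i _ => ?_
    rw [hζq]; ring
  set E := W * box z q with hEdef
  set B := ∑ i, sg i * w2 i i with hB
  -- Conjugation by h^a: □w = h^a □z + (2a/(fe)) Yw - (A - aγ/(fe)) w. The definition of `AF` is
  -- what makes the zeroth order coefficient split in this way.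
  have hBval : B = E + 2 * a / (fFun p q * eF p ε q) * S
      - (AF p ε a q - a * gamF p ε q / (fFun p q * eF p ε q)) * w q := by
    have h1 : B = W * box z q + 2 * (a * W * (fFun p q * eF p ε q)⁻¹ * SZ)
        + z q * (a * W * (a * (eF p ε q + ε ^ 2 * fFun p q) / (fFun p q * eF p ε q ^ 2)
        + (((m : ℝ) + n) / 2 * eF p ε q + ((n : ℝ) - 1) * kF p ε q) / (fFun p q * eF p ε q)
        - (eF p ε q ^ 2 - ε ^ 2 * fFun p q) / (fFun p q * eF p ε q ^ 2))) := by
      rw [← box_hF_pow hf he a, hbox, hSZ, hB, Finset.mul_sum, Finset.mul_sum, Finset.mul_sum,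
        Finset.mul_sum, ← Finset.sum_add_distrib, ← Finset.sum_add_distrib]
      refine Finset.sum_congr rfl fun i _ => ?_
      have h2 : w2 i i = _ := (hζPD' i).2 i
      have hs := sg_mul_self i
      have h4 : fderiv ℝ z q (bv i) = zi i := rfl
      rw [h2]
      beta_reduce
      rw [h4]
      have h3 : dWt p ε a i q = a * (W * (sg i * Yv p ε i q * (fFun p q * eF p ε q)⁻¹)) := rfl
      rw [h3]
      linear_combination (2 * a * W * Yv p ε i q * (fFun p q * eF p ε q)⁻¹ * zi i) * hs
    rw [h1, hSval]
    have h2 := conjugation_identity (ε := ε) (f := fFun p q) (e := eF p ε q) (r := rFun p q)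
      (a := a) (N := (m : ℝ) + n) (ν := n) (SZ := SZ) (zq := z q) (W := W) (bz := box z q)
      hf he hr (by rw [eF]; ring)
    exact h2
  set WS := ∑ i, ζ (Sum.inr i) q ^ 2 with hWS
  set WT := ∑ i, ζ (Sum.inl i) q ^ 2 with hWT
  set R1 := ∑ i, co (q - p) (Sum.inr i) * ζ (Sum.inr i) q with hR1
  set T1 := ∑ i, co (q - p) (Sum.inl i) * ζ (Sum.inl i) q with hT1
  have hWT0 : 0 ≤ WT := Finset.sum_nonneg fun i _ => sq_nonneg _
  have hWS0 : 0 ≤ WS := Finset.sum_nonneg fun i _ => sq_nonneg _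
  have hSexp : S = 1 / 2 * eF p ε q * (T1 + R1) + kF p ε q * R1 :=
    sum_Yv_gradient fun i => ζ i q
  have hTT : T1 ^ 2 ≤ (rFun p q ^ 2 - 4 * fFun p q) * WT := by
    rw [← sum_time_co_sq]
    exact Finset.sum_mul_sq_le_sq_mul_sq _ _ _
  have hRR : R1 ^ 2 ≤ rFun p q ^ 2 * WS := by
    rw [← sum_space_co_sq]
    exact Finset.sum_mul_sq_le_sq_mul_sq _ _ _
  have hρ : R1 ^ 2 / rFun p q ^ 2 ≤ WS := by
    rw [div_le_iff₀ (by positivity)]; linarith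
  have hk0 : 0 ≤ kF p ε q := by rw [kF]; positivity
  have hfu : fFun p q * (ε / rFun p q) ≤ 1 / 8 := by
    rw [← mul_div_assoc, div_le_iff₀ hr]
    have e3 := mul_le_mul_of_nonneg_left h4 hε.le
    have e4 := mul_le_mul_of_nonneg_right hr2 hr.le
    linarith
  have hkf : kF p ε q = ε / rFun p q * fFun p q := by rw [kF]; ring
  have hgain := time_gradient_gain hf hr he hk0 h4 hWT0 hTT hSexp
  have hu : 0 < ε / rFun p q := by positivity
  have hr3 : rFun p q ^ 3 ≤ R ^ 3 := by gcongr
  have hCu : 96 * C * rFun p q ^ 2 ≤ a * (ε / rFun p q) := by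
    rw [← mul_div_assoc, le_div_iff₀ hr]
    have := mul_le_mul_of_nonneg_left hr3 hC0
    linarith
  have hVu : 24 * fFun p q * Vb ^ 2 ≤ a * (ε / rFun p q) := by
    rw [← mul_div_assoc, le_div_iff₀ hr]
    have h5 := mul_le_mul_of_nonneg_right hr3 (sq_nonneg Vb)
    have h6 := mul_le_mul_of_nonneg_right h4 (by positivity : 0 ≤ rFun p q * Vb ^ 2)
    linarith
  have hEb : E ^ 2 ≤ 3 * (C * fFun p q * (WT + WS)
      + 4 * (a : ℝ) ^ 2 / fFun p q * (C * rFun p q ^ 2) * w q ^ 2 + Vb ^ 2 * w q ^ 2) := by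
    set Q1 := ∑ i, co X i * ζ i q with hQ1
    set Q2 := ∑ i, co X i * (sg i * Yv p ε i q) with hQ2
    -- By the equation h^a □z = -h^a 𝒳z - Vw; writing h^a 𝒳z through 𝒳w produces the term with the
    -- derivative of the weight.
    have hE1 : E = -Q1 + a * (fFun p q * eF p ε q)⁻¹ * Q2 * w q - V * w q := by
      have e1 : fderiv ℝ z q X = ∑ i, co X i * zi i := by
        rw [map_eq_sum_co]; rfl
      have e2 : Q1 = a * (fFun p q * eF p ε q)⁻¹ * w q * Q2 + W * ∑ i, co X i * zi i := by
        rw [hQ1, hQ2, Finset.mul_sum, Finset.mul_sum, ← Finset.sum_add_distrib]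
        refine Finset.sum_congr rfl fun i _ => ?_
        rw [hζq, hw]
        ring
      have e3 : w q = W * z q := rfl
      rw [e2, ← e1, e3, hEdef]
      linear_combination W * heq
    have hQ1b : Q1 ^ 2 ≤ C * fFun p q * (WT + WS) := by
      have h1 : Q1 ^ 2 ≤ (∑ i, co X i ^ 2) * ∑ i, ζ i q ^ 2 :=
        Finset.sum_mul_sq_le_sq_mul_sq _ _ _
      have h2 : ∑ i, ζ i q ^ 2 = WT + WS := by rw [Fintype.sum_sum_type]
      rw [h2] at h1
      exact h1.trans (mul_le_mul_of_nonneg_right hX (by positivity))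
    have hQ2b : Q2 ^ 2 ≤ C * fFun p q * rFun p q ^ 2 := by
      have h1 : Q2 ^ 2 ≤ (∑ i, co X i ^ 2) * ∑ i, (sg i * Yv p ε i q) ^ 2 :=
        Finset.sum_mul_sq_le_sq_mul_sq _ _ _
      have h2 : ∑ i, (sg i * Yv p ε i q) ^ 2 = ∑ i, Yv p ε i q ^ 2 :=
        Finset.sum_congr rfl fun i _ => by
          linear_combination (Yv p ε i q ^ 2) * sg_mul_self i
      rw [h2] at h1
      exact h1.trans (mul_le_mul hX (sum_Yv_sq_le hf hε hr2)
        (Finset.sum_nonneg fun i _ => sq_nonneg _) (by positivity))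
    exact source_sq_le hf he2 hC0 hE1 hQ1b hQ2b hV
  have hZ := zeroth_order_bound (a := a) hf hr hε hr2 h4 (rfl : eF p ε q = _) ha haL
    (abs_box_gamF_le (m := m) (n := n) hf hε)
  have habs := absorption hf hr he2 he1 hu ha (two_le_dimC m n) haL hfu h4 hC0 hCu hVu
    (abs_gamF_le hf hε hr2 (by rw [hkf]; linarith)) hWT0 hρ hgain hEb hZ
  -- Inserting `hBval`, the part aγ/(fe) completes the square 2a/(fe)(S + γw/2)², the terms A w S
  -- cancel, and γ - div Y = -(e + k) gives both the quadratic form and the zeroth order term.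
  refine habs.trans (le_of_eq ?_)
  rw [hBval, ← hkf]
  have hA : AF p ε a q = (a : ℝ) ^ 2 * (fFun p q * eF p ε q)⁻¹
    + ((a : ℝ) ^ 2 - a) * ε ^ 2 * (eF p ε q ^ 2)⁻¹ - a * ε * (rFun p q * eF p ε q)⁻¹ := rfl
  have hG : gamF p ε q = ((m : ℝ) + n - 2) / 2 * eF p ε q + ((n : ℝ) - 2) * kF p ε q := rfl
  have hK : kF p ε q = ε * (fFun p q * (rFun p q)⁻¹) := rfl
  rw [← hA, ← hK]
  generalize AF p ε a q = A
  rw [hG]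
  generalize -(((m : ℝ) + n - 2) / 2 * (ε * ((n - 1) / rFun p q)))
      + ((n : ℝ) - 2) * (ε * ((m + n - 2) / (2 * rFun p q)
        - (n - 3) * fFun p q / rFun p q ^ 3)) = G2
  generalize -((a : ℝ) ^ 2 / (2 * fFun p q ^ 2 * eF p ε q))
    * (2 * fFun p q * (1 - ε * rFun p q / 2)) + _ = YA
  generalize kF p ε q = K
  generalize R1 ^ 2 / rFun p q ^ 2 = ρ
  ring

end

section

open MeasureTheory

/-! ### A divergence inequality on domains with smooth boundary -/

section Divergence

variable {E : Type*} [NormedAddCommGroup E] [NormedSpace ℝ E] [FiniteDimensional ℝ E]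
  [MeasurableSpace E] [BorelSpace E] {μ : Measure E} [μ.IsAddHaarMeasure]
  {ι : Type*} [Fintype ι] {b : ι → E} {W : Set E} {P : ι → E → ℝ} {d : E → ℝ}

set_option linter.unusedSectionVars false

lemma continuous_mul_of_tsupport_subset {ψ g : E → ℝ} (hψ : Continuous ψ)
    (hs : tsupport ψ ⊆ W) (hW : IsOpen W) (hg : ContinuousOn g W) :
    Continuous fun x => ψ x * g x := by
  refine continuous_of_tsupport fun x hx => ?_
  have hx' : x ∈ tsupport ψ := tsupport_mul_subset_left hx
  exact hψ.continuousAt.mul (hg.continuousAt (hW.mem_nhds (hs hx')))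

lemma continuousOn_fderiv_apply {g : E → ℝ} (hW : IsOpen W) (hg : ContDiffOn ℝ 1 g W) (v : E) :
    ContinuousOn (fun x => fderiv ℝ g x v) W :=
  (hg.continuousOn_fderiv_of_isOpen hW le_rfl).clm_apply continuousOn_const

lemma tsupport_fderiv_apply {ψ : E → ℝ} (v : E) :
    tsupport (fun x => fderiv ℝ ψ x v) ⊆ tsupport ψ :=
  closure_minimal (fun x hx => by
    by_contra hx'
    refine hx ?_
    have h0 : fderiv ℝ ψ x = 0 := by
      by_contra h1
      exact hx' (support_fderiv_subset ℝ h1)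
    simp [h0]) (isClosed_tsupport ψ)

lemma fderiv_apply_eq_zero {ψ : E → ℝ} {x : E} (h : x ∉ tsupport ψ) (v : E) :
    fderiv ℝ ψ x v = 0 :=
  image_eq_zero_of_notMem_tsupport (f := fun x => fderiv ℝ ψ x v)
    fun h' => h (tsupport_fderiv_apply v h')

lemma integral_fderiv_apply_eq_zero {ψ : E → ℝ} (hψ : ContDiff ℝ 1 ψ)
    (hc : HasCompactSupport ψ) (v : E) : ∫ x, fderiv ℝ ψ x v ∂μ = 0 := by
  have h1 : Continuous fun x => fderiv ℝ ψ x v :=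
    (hψ.continuous_fderiv one_ne_zero).clm_apply continuous_const
  have h2 : HasCompactSupport fun x => fderiv ℝ ψ x v := hc.mono' ((subset_tsupport _).trans (tsupport_fderiv_apply v))
  have := integral_mul_fderiv_eq_neg_fderiv_mul_of_integrable (μ := μ) (f := fun _ : E => (1 : ℝ))
    (g := ψ) (v := v) (by simp) (by simpa using h1.integrable_of_hasCompactSupport h2)
    (by simpa using hψ.continuous.integrable_of_hasCompactSupport hc)
    (fun _ _ => differentiableAt_const _) (fun x _ => hψ.differentiable one_ne_zero x)
  simpa using this

/-- Integration by parts for a test function supported in the domain. -/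
lemma integral_mul_divergence {ψ : E → ℝ} (hW : IsOpen W) (hP : ∀ i, ContDiffOn ℝ 1 (P i) W)
    (hψ : ContDiff ℝ 1 ψ) (hc : HasCompactSupport ψ) (hs : tsupport ψ ⊆ W) :
    Integrable (fun x => ψ x * ∑ i, fderiv ℝ (P i) x (b i)) μ ∧
    Integrable (fun x => ∑ i, fderiv ℝ ψ x (b i) * P i x) μ ∧
    ∫ x, ψ x * ∑ i, fderiv ℝ (P i) x (b i) ∂μ = -∫ x, ∑ i, fderiv ℝ ψ x (b i) * P i x ∂μ := by
  have hψ' : ∀ v, Continuous fun x => fderiv ℝ ψ x v := fun v =>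
    (hψ.continuous_fderiv one_ne_zero).clm_apply continuous_const
  have i1 : ∀ i, Integrable (fun x => ψ x * fderiv ℝ (P i) x (b i)) μ := fun i =>
    (continuous_mul_of_tsupport_subset hψ.continuous hs hW
      (continuousOn_fderiv_apply hW (hP i) _)).integrable_of_hasCompactSupport hc.mul_right
  have hcv : ∀ v, HasCompactSupport fun x => fderiv ℝ ψ x v := fun v =>
    hc.mono' ((subset_tsupport _).trans (tsupport_fderiv_apply v))
  have i2 : ∀ i, Integrable (fun x => fderiv ℝ ψ x (b i) * P i x) μ := fun i =>
    (continuous_mul_of_tsupport_subset (hψ' _) ((tsupport_fderiv_apply _).trans hs) hW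
      (hP i).continuousOn).integrable_of_hasCompactSupport (hcv _).mul_right
  have i3 : ∀ i, Integrable (fun x => ψ x * P i x) μ := fun i =>
    (continuous_mul_of_tsupport_subset hψ.continuous hs hW
      (hP i).continuousOn).integrable_of_hasCompactSupport hc.mul_right
  refine ⟨?_, integrable_finsetSum _ fun i _ => i2 i, ?_⟩
  · simp only [Finset.mul_sum]
    exact integrable_finsetSum _ fun i _ => i1 i
  · simp only [Finset.mul_sum]
    rw [integral_finsetSum _ fun i _ => i1 i, integral_finsetSum _ fun i _ => i2 i,
      ← Finset.sum_neg_distrib]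
    refine Finset.sum_congr rfl fun i _ => ?_
    exact integral_mul_fderiv_eq_neg_fderiv_mul_of_integrable (i2 i) (i1 i) (i3 i)
      (fun x _ => hψ.differentiable one_ne_zero x)
      (fun x hx => ((hP i).contDiffAt (hW.mem_nhds (hs hx))).differentiableAt one_ne_zero)

/-- The weak form of `d ≤ div P` and `P · ν ≤ 0` for the test function `ξ`. -/
def WeakDiv (μ : Measure E) (b : ι → E) (W : Set E) (P : ι → E → ℝ) (d ξ : E → ℝ) : Prop :=
  IntegrableOn (fun x => ∑ i, fderiv ℝ ξ x (b i) * P i x) W μ ∧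
    ∫ x in W, ξ x * d x ∂μ ≤ -∫ x in W, ∑ i, fderiv ℝ ξ x (b i) * P i x ∂μ

/-- `WeakDiv` for all nonnegative test functions supported near `q`. -/
def LocalWeakDiv (μ : Measure E) (b : ι → E) (W : Set E) (P : ι → E → ℝ) (d : E → ℝ) (q : E) :
    Prop :=
  ∃ N : Set E, IsOpen N ∧ q ∈ N ∧ ∀ ξ : E → ℝ, ContDiff ℝ 1 ξ → HasCompactSupport ξ →
    (∀ x, 0 ≤ ξ x) → tsupport ξ ⊆ N → WeakDiv μ b W P d ξ

/-- Plain integration by parts: inside the domain there is no boundary term. -/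
lemma localWeakDiv_of_mem (hW : IsOpen W) (hP : ∀ i, ContDiffOn ℝ 1 (P i) W)
    (hd : Continuous d) (hdP : ∀ x ∈ W, d x ≤ ∑ i, fderiv ℝ (P i) x (b i)) {q : E} (hq : q ∈ W) :
    LocalWeakDiv μ b W P d q := by
  refine ⟨W, hW, hq, fun ξ hξ hc h0 hs => ?_⟩
  obtain ⟨i1, i2, h⟩ := integral_mul_divergence (μ := μ) (b := b) hW hP hξ hc hs
  refine ⟨i2.integrableOn, ?_⟩
  have e2 : ∫ x in W, ∑ i, fderiv ℝ ξ x (b i) * P i x ∂μ =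
      ∫ x, ∑ i, fderiv ℝ ξ x (b i) * P i x ∂μ := by
    refine setIntegral_eq_integral_of_forall_compl_eq_zero fun x hx => ?_
    refine Finset.sum_eq_zero fun i _ => ?_
    rw [fderiv_apply_eq_zero fun h => hx (hs h), zero_mul]
  have e1 : ∫ x in W, ξ x * ∑ i, fderiv ℝ (P i) x (b i) ∂μ =
      ∫ x, ξ x * ∑ i, fderiv ℝ (P i) x (b i) ∂μ := by
    refine setIntegral_eq_integral_of_forall_compl_eq_zero fun x hx => ?_
    rw [image_eq_zero_of_notMem_tsupport fun h => hx (hs h), zero_mul]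
  rw [e2, ← h, ← e1]
  refine setIntegral_mono_on ?_ i1.integrableOn hW.measurableSet fun x hx =>
    mul_le_mul_of_nonneg_left (hdP x hx) (h0 x)
  exact ((hξ.continuous.mul hd).integrable_of_hasCompactSupport hc.mul_right).integrableOn

lemma localWeakDiv_of_notMem_closure (hW : IsOpen W) {q : E} (hq : q ∉ closure W) :
    LocalWeakDiv μ b W P d q := by
  refine ⟨(closure W)ᶜ, isClosed_closure.isOpen_compl, hq, fun ξ hξ hc h0 hs => ?_⟩
  have h1 : ∀ x ∈ W, x ∉ tsupport ξ := fun x hx h => hs h (subset_closure hx)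
  have e1 : EqOn (fun x => ∑ i, fderiv ℝ ξ x (b i) * P i x) (fun _ => 0) W := fun x hx => by
    refine Finset.sum_eq_zero fun i _ => ?_
    rw [fderiv_apply_eq_zero (h1 x hx), zero_mul]
  have e2 : EqOn (fun x => ξ x * d x) (fun _ => 0) W := fun x hx => by
    simp [image_eq_zero_of_notMem_tsupport (h1 x hx)]
  refine ⟨?_, ?_⟩
  · exact (integrableOn_congr_fun e1 hW.measurableSet).2 integrableOn_zero
  · rw [setIntegral_congr_fun hW.measurableSet e1,
      setIntegral_congr_fun hW.measurableSet e2]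
    simp

/-- A smooth cutoff that vanishes up to `1` and equals `1` from `2` on. -/
def cutoff (s : ℝ) : ℝ := Real.smoothTransition (s - 1)

lemma contDiff_cutoff : ContDiff ℝ 1 cutoff :=
  (Real.smoothTransition.contDiff (n := 1)).comp (contDiff_id.sub contDiff_const)

lemma monotone_cutoff : Monotone cutoff := fun _ _ h =>
  Real.smoothTransition.monotone (sub_le_sub_right h 1)

lemma cutoff_of_le {s : ℝ} (h : s ≤ 1) : cutoff s = 0 :=
  Real.smoothTransition.zero_of_nonpos (by linarith)

lemma cutoff_of_ge {s : ℝ} (h : 2 ≤ s) : cutoff s = 1 :=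
  Real.smoothTransition.one_of_one_le (by linarith)

lemma cutoff_nonneg (s : ℝ) : 0 ≤ cutoff s := Real.smoothTransition.nonneg _

lemma cutoff_le_one (s : ℝ) : cutoff s ≤ 1 := Real.smoothTransition.le_one _

lemma deriv_cutoff_nonneg (s : ℝ) : 0 ≤ deriv cutoff s := monotone_cutoff.deriv_nonneg

lemma deriv_cutoff_of_notMem {s : ℝ} (h : s ∉ Icc (1 : ℝ) 2) : deriv cutoff s = 0 := by
  rw [mem_Icc, not_and_or, not_le, not_le] at h
  rcases h with h | h
  · have : cutoff =ᶠ[𝓝 s] fun _ => 0 := by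
      filter_upwards [Iio_mem_nhds h] with y hy using cutoff_of_le (le_of_lt hy)
    rw [this.deriv_eq]; simp
  · have : cutoff =ᶠ[𝓝 s] fun _ => 1 := by
      filter_upwards [Ioi_mem_nhds h] with y hy using cutoff_of_ge (le_of_lt hy)
    rw [this.deriv_eq]; simp

lemma fderiv_cutoff_comp {φ : E → ℝ} {x : E} (hφ : DifferentiableAt ℝ φ x) (c : ℝ) (v : E) :
    fderiv ℝ (fun y => cutoff (c * φ y)) x v = deriv cutoff (c * φ x) * (c * fderiv ℝ φ x v) := by
  have h1 : HasFDerivAt (fun y => c * φ y) (c • fderiv ℝ φ x) x := hφ.hasFDerivAt.const_mul c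
  have h2 : HasDerivAt cutoff (deriv cutoff (c * φ x)) (c * φ x) :=
    (contDiff_cutoff.differentiable one_ne_zero _).hasDerivAt
  have h3 := h2.comp_hasFDerivAt x h1
  rw [show (fun y => cutoff (c * φ y)) = cutoff ∘ fun y => c * φ y from rfl, h3.fderiv]
  simp

/-- Near a point of a compact set, on the boundary of which `Φ ≤ 0`, the function `Φ` is
uniformly small. -/
lemma exists_strip_lt {K : Set E} (hK : IsCompact K) {φ Φ : E → ℝ} (hφ : Continuous φ)
    (hΦ : ContinuousOn Φ (K ∩ {x | φ x ≤ 0})) (h0 : ∀ x ∈ K, φ x = 0 → Φ x ≤ 0) {ω' : ℝ}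
    (hω : 0 < ω') : ∃ δ > 0, ∀ x ∈ K, -δ ≤ φ x → φ x ≤ 0 → Φ x < ω' := by
  have hKc : IsCompact (K ∩ {x | φ x ≤ 0}) := hK.inter_right (isClosed_le hφ continuous_const)
  have hZ : IsCompact ((K ∩ {x | φ x ≤ 0}) ∩ Φ ⁻¹' Ici ω') :=
    hKc.of_isClosed_subset (hΦ.preimage_isClosed_of_isClosed hKc.isClosed isClosed_Ici)
      inter_subset_left
  rcases ((K ∩ {x | φ x ≤ 0}) ∩ Φ ⁻¹' Ici ω').eq_empty_or_nonempty with he | hne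
  · refine ⟨1, one_pos, fun x hx _ hx0 => ?_⟩
    by_contra! h
    exact (he ▸ (⟨⟨hx, hx0⟩, h⟩ : x ∈ (K ∩ {x | φ x ≤ 0}) ∩ Φ ⁻¹' Ici ω') : x ∈ (∅ : Set E))
  · obtain ⟨x0, ⟨⟨hx0K, hx0φ⟩, hx0Φ⟩, hmax⟩ := hZ.exists_isMaxOn hne hφ.continuousOn
    have hneg : φ x0 < 0 := by
      refine lt_of_le_of_ne hx0φ fun h => ?_
      have h1 := h0 x0 hx0K h
      have h2 : ω' ≤ Φ x0 := hx0Φ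
      linarith
    refine ⟨-φ x0 / 2, by linarith, fun x hx hxδ hx0 => ?_⟩
    by_contra! h
    have h3 : φ x ≤ φ x0 := hmax ⟨⟨hx, hx0⟩, h⟩
    linarith

/-- Only continuity of the current up to the boundary is available, so no surface integral is
formed. Multiplying the test function by a cutoff in -kφ brings its support inside W. The cutoff's
derivative contributes with a good sign once P is perturbed by a small constant field -ω'v with v
pointing outwards, because then the flux is strictly negative in a whole strip. Finally k → ∞, and
then ω' → 0. -/
lemma localWeakDiv_of_boundary (hW : IsOpen W) (hP : ∀ i, ContDiffOn ℝ 1 (P i) W)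
    (hd : Continuous d) (hdP : ∀ x ∈ W, d x ≤ ∑ i, fderiv ℝ (P i) x (b i))
    {q v : E} {φ : E → ℝ} {B : Set E} (hφ : ContDiff ℝ 1 φ) (hB : B ∈ 𝓝 q)
    (hBW : ∀ x ∈ B, x ∈ W ↔ φ x < 0) (hPc : ∀ i, ContinuousOn (P i) (B ∩ {x | φ x ≤ 0}))
    (hPb : ∀ x ∈ B, φ x = 0 → ∑ i, fderiv ℝ φ x (b i) * P i x ≤ 0)
    (hv : 0 < fderiv ℝ φ q v) : LocalWeakDiv μ b W P d q := by
  set c := fderiv ℝ φ q v / 2 with hcdef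
  have hc0 : 0 < c := by positivity
  have hφd : ∀ u, Continuous fun x => fderiv ℝ φ x u := fun u =>
    (hφ.continuous_fderiv one_ne_zero).clm_apply continuous_const
  refine ⟨interior B ∩ {x | c < fderiv ℝ φ x v},
    isOpen_interior.inter (isOpen_lt continuous_const (hφd v)),
    ⟨mem_interior_iff_mem_nhds.2 hB, by simp only [mem_ofPred_eq]; linarith⟩,
    fun ξ hξ hc hξ0 hs => ?_⟩
  set K := tsupport ξ with hKdef
  have hK : IsCompact K := hc
  have hKB : ∀ x ∈ K, x ∈ B := fun x hx => interior_subset (hs hx).1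
  have hKv : ∀ x ∈ K, c < fderiv ℝ φ x v := fun x hx => (hs hx).2
  have hξd : ∀ u, Continuous fun x => fderiv ℝ ξ x u := fun u =>
    (hξ.continuous_fderiv one_ne_zero).clm_apply continuous_const
  have hPK : ∀ i, ContinuousOn (P i) (K ∩ {x | φ x ≤ 0}) := fun i =>
    (hPc i).mono fun x hx => ⟨hKB x hx.1, hx.2⟩
  have hKc : IsCompact (K ∩ {x | φ x ≤ 0}) :=
    hK.inter_right (isClosed_le hφ.continuous continuous_const)
  -- functions continuous on the closed side, with support in `K`, are integrable on `W`
  have hint : ∀ F : E → ℝ, ContinuousOn F (K ∩ {x | φ x ≤ 0}) → ContinuousOn F W →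
      (∀ x, x ∉ K → F x = 0) → IntegrableOn F W μ := by
    intro F hF hFW hF0
    have h1 : IntegrableOn F (K ∩ {x | φ x ≤ 0}) μ := hF.integrableOn_compact hKc
    have h2 : IntegrableOn F (W \ (K ∩ {x | φ x ≤ 0})) μ := by
      have : EqOn F (fun _ => 0) (W \ (K ∩ {x | φ x ≤ 0})) := by
        intro x hx
        by_cases hxK : x ∈ K
        · exact absurd ⟨hxK, ((hBW x (hKB x hxK)).1 hx.1).le⟩ hx.2
        · exact hF0 x hxK
      exact (integrableOn_congr_fun this
        (hW.measurableSet.diff hKc.measurableSet)).2 integrableOn_zero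
    refine (h1.union h2).mono_set fun x hx => ?_
    by_cases hx' : x ∈ K ∩ {x | φ x ≤ 0}
    · exact Or.inl hx'
    · exact Or.inr ⟨hx, hx'⟩
  have hξ0' : ∀ u x, x ∉ K → fderiv ℝ ξ x u = 0 := fun u x hx =>
    fderiv_apply_eq_zero hx u
  have hI : IntegrableOn (fun x => ∑ i, fderiv ℝ ξ x (b i) * P i x) W μ := by
    refine hint _ ?_ ?_ fun x hx => Finset.sum_eq_zero fun i _ => by rw [hξ0' _ x hx, zero_mul]
    · exact continuousOn_finsetSum _ fun i _ => (hξd _).continuousOn.mul (hPK i)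
    · exact continuousOn_finsetSum _ fun i _ => (hξd _).continuousOn.mul (hP i).continuousOn
  have hIv : IntegrableOn (fun x => fderiv ℝ ξ x v) W μ :=
    hint _ (hξd v).continuousOn (hξd v).continuousOn (hξ0' v)
  refine ⟨hI, ?_⟩
  -- the inequality with an error `ω'`
  have key : ∀ ω' : ℝ, 0 < ω' → ∫ x in W, ξ x * d x ∂μ ≤
      ∫ x in W, (ω' * fderiv ℝ ξ x v - ∑ i, fderiv ℝ ξ x (b i) * P i x) ∂μ := by
    intro ω' hω
    set F : E → ℝ := fun x => ω' * fderiv ℝ ξ x v - ∑ i, fderiv ℝ ξ x (b i) * P i x with hF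
    have hFI : IntegrableOn F W μ := (hIv.const_mul ω').sub hI
    obtain ⟨δ, hδ, hstrip⟩ := exists_strip_lt hK (φ := φ)
      (Φ := fun x => ∑ i, fderiv ℝ φ x (b i) * P i x) hφ.continuous
      (continuousOn_finsetSum _ fun i _ => (hφd _).continuousOn.mul (hPK i))
      (fun x hx => hPb x (hKB x hx)) (mul_pos hω hc0)
    -- θ_k vanishes where φ ≥ -1/k and equals 1 where φ ≤ -2/k.
    set θ : ℕ → E → ℝ := fun k x => cutoff (-(k : ℝ) * φ x) with hθ
    have hθC : ∀ k, ContDiff ℝ 1 (θ k) := fun k =>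
      contDiff_cutoff.comp (contDiff_const.mul hφ)
    have hlim : ∀ x ∈ W, x ∈ K → ∀ᶠ k in atTop, θ k x = 1 := by
      intro x hx hxK
      have hneg : φ x < 0 := (hBW x (hKB x hxK)).1 hx
      filter_upwards [(tendsto_natCast_atTop_atTop (R := ℝ)).eventually_ge_atTop
        (2 / (-φ x))] with k hk
      rw [div_le_iff₀ (by linarith)] at hk
      exact cutoff_of_ge (by linarith)
    have hk : ∀ᶠ k : ℕ in atTop, ∫ x in W, θ k x * (ξ x * d x) ∂μ ≤
        ∫ x in W, θ k x * F x ∂μ := by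
      filter_upwards [(tendsto_natCast_atTop_atTop (R := ℝ)).eventually_ge_atTop (2 / δ),
        eventually_ge_atTop 1] with k hkδ hk1
      have hk0 : (0 : ℝ) < k := by exact_mod_cast hk1
      rw [div_le_iff₀ hδ] at hkδ
      set ψ : E → ℝ := fun x => θ k x * ξ x with hψ
      have hψC : ContDiff ℝ 1 ψ := (hθC k).mul hξ
      have hψc : HasCompactSupport ψ := hc.mul_left
      have hψs : tsupport ψ ⊆ W := by
        have h1 : tsupport ψ ⊆ K ∩ {x | (k : ℝ) * φ x ≤ -1} := by
          refine closure_minimal (fun x hx => ?_) ((isClosed_tsupport ξ).inter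
            (isClosed_le (continuous_const.mul hφ.continuous) continuous_const))
          have hx' : θ k x ≠ 0 ∧ ξ x ≠ 0 := by
            simpa [ψ, mul_eq_zero, not_or] using hx
          refine ⟨subset_tsupport _ hx'.2, ?_⟩
          by_contra h
          simp only [mem_ofPred_eq, not_le] at h
          exact hx'.1 (cutoff_of_le (by linarith))
        intro x hx
        obtain ⟨hxK, hxφ⟩ := h1 hx
        refine (hBW x (hKB x hxK)).2 ?_
        by_contra! h
        have : 0 ≤ (k : ℝ) * φ x := by positivity
        have hxφ' : (k : ℝ) * φ x ≤ -1 := hxφ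
        linarith
      obtain ⟨i1, i2, hibp⟩ := integral_mul_divergence (μ := μ) (b := b) hW hP hψC hψc hψs
      have i3 : Integrable (fun x => fderiv ℝ ψ x v) μ :=
        ((hψC.continuous_fderiv one_ne_zero).clm_apply
          continuous_const).integrable_of_hasCompactSupport
          (hψc.mono' ((subset_tsupport _).trans (tsupport_fderiv_apply v)))
      have hψ0 : ∀ u x, x ∉ W → fderiv ℝ ψ x u = 0 := fun u x hx =>
        fderiv_apply_eq_zero (fun h => hx (hψs h)) u
      have hψd : ∀ x u, fderiv ℝ ψ x u = θ k x * fderiv ℝ ξ x u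
          - k * (ξ x * deriv cutoff (-(k : ℝ) * φ x)) * fderiv ℝ φ x u := by
        intro x u
        have hd1 := (hθC k).differentiable one_ne_zero x
        rw [hψ, fderiv_fun_mul hd1 (hξ.differentiable one_ne_zero x)]
        have := fderiv_cutoff_comp (hφ.differentiable one_ne_zero x) (-(k : ℝ)) u
        simp only [add_apply, smul_apply, smul_eq_mul]
        rw [show fderiv ℝ (θ k) x u = _ from this]
        ring
      have hlow : ∫ x in W, θ k x * (ξ x * d x) ∂μ ≤
          ∫ x in W, ψ x * ∑ i, fderiv ℝ (P i) x (b i) ∂μ := by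
        refine setIntegral_mono_on ?_ i1.integrableOn hW.measurableSet fun x hx => ?_
        · have : (fun x => θ k x * (ξ x * d x)) = fun x => ψ x * d x := by
            funext x; simp only [ψ]; ring
          rw [this]
          exact ((hψC.continuous.mul hd).integrable_of_hasCompactSupport
            hψc.mul_right).integrableOn
        · have := mul_le_mul_of_nonneg_left (hdP x hx)
            (mul_nonneg (cutoff_nonneg _) (hξ0 x) : 0 ≤ ψ x)
          simp only [ψ] at this ⊢
          linarith
      have e1 : ∫ x in W, ψ x * ∑ i, fderiv ℝ (P i) x (b i) ∂μ =
          ∫ x, ψ x * ∑ i, fderiv ℝ (P i) x (b i) ∂μ :=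
        setIntegral_eq_integral_of_forall_compl_eq_zero fun x hx => by
          rw [image_eq_zero_of_notMem_tsupport fun h => hx (hψs h), zero_mul]
      -- The constant field v has no divergence and ψ has compact support, so ω' dψ(v) can be added
      -- at no cost.
      have e2 : -∫ x, ∑ i, fderiv ℝ ψ x (b i) * P i x ∂μ =
          ∫ x in W, (ω' * fderiv ℝ ψ x v - ∑ i, fderiv ℝ ψ x (b i) * P i x) ∂μ := by
        rw [setIntegral_eq_integral_of_forall_compl_eq_zero, integral_sub (i3.const_mul ω') i2,
          integral_const_mul, integral_fderiv_apply_eq_zero hψC hψc]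
        · ring
        · intro x hx
          rw [hψ0 v x hx, Finset.sum_eq_zero fun i _ => by rw [hψ0 _ x hx, zero_mul]]
          ring
      rw [e1, hibp, e2] at hlow
      refine hlow.trans (setIntegral_mono_on ?_ ?_ hW.measurableSet fun x hx => ?_)
      · exact ((i3.const_mul ω').sub i2).integrableOn
      · refine hFI.bdd_mul (c := 1) (hθC k).continuous.aestronglyMeasurable
          (Eventually.of_forall fun x => ?_)
        rw [Real.norm_eq_abs, abs_of_nonneg (cutoff_nonneg _)]
        exact cutoff_le_one _
      · by_cases hxK : x ∈ K
        · set g := (k : ℝ) * (ξ x * deriv cutoff (-(k : ℝ) * φ x)) with hg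
          have hg0 : 0 ≤ g :=
            mul_nonneg hk0.le (mul_nonneg (hξ0 x) (deriv_cutoff_nonneg _))
          -- The last term comes from the derivative of θ_k. It lives in the strip -2/k ≤ φ ≤ -1/k,
          -- where ∑ dφ(b_i) P_i < ω'c < ω' dφ(v), so dropping it only increases the right side.
          have hexp : ω' * fderiv ℝ ψ x v - ∑ i, fderiv ℝ ψ x (b i) * P i x =
              θ k x * F x - g * (ω' * fderiv ℝ φ x v - ∑ i, fderiv ℝ φ x (b i) * P i x) := by
            simp only [hψd, sub_mul, Finset.sum_sub_distrib, hF]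
            simp only [mul_assoc, ← Finset.mul_sum]
            ring
          rw [hexp]
          have : 0 ≤ g * (ω' * fderiv ℝ φ x v - ∑ i, fderiv ℝ φ x (b i) * P i x) := by
            by_cases hmem : -(k : ℝ) * φ x ∈ Icc (1 : ℝ) 2
            · refine mul_nonneg hg0 ?_
              have hneg : φ x < 0 := (hBW x (hKB x hxK)).1 hx
              have h1 : -δ ≤ φ x := by
                have h2 : (k : ℝ) * -δ ≤ k * φ x := by linarith [hmem.2]
                exact le_of_mul_le_mul_left h2 hk0
              have h2 := hstrip x hxK h1 hneg.le
              have h3 := mul_le_mul_of_nonneg_left (hKv x hxK).le hω.le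
              linarith
            · rw [hg, deriv_cutoff_of_notMem hmem]
              simp
          linarith
        · have hz : ξ x = 0 := image_eq_zero_of_notMem_tsupport hxK
          have h1 : ∀ u, fderiv ℝ ψ x u = 0 := fun u => by
            rw [hψd, hξ0' u x hxK, hz]; ring
          have h2 : F x = 0 := by simp only [hF, hξ0' _ x hxK]; simp
          rw [h1, Finset.sum_eq_zero fun i _ => by rw [h1, zero_mul], h2]
          simp
    have hξdI : IntegrableOn (fun x => ξ x * d x) W μ :=
      ((hξ.continuous.mul hd).integrable_of_hasCompactSupport hc.mul_right).integrableOn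
    have hconv : ∀ G : E → ℝ, IntegrableOn G W μ → (∀ x, x ∉ K → G x = 0) →
        Tendsto (fun k => ∫ x in W, θ k x * G x ∂μ) atTop (𝓝 (∫ x in W, G x ∂μ)) := by
      intro G hG hG0
      refine tendsto_integral_of_dominated_convergence (fun x => ‖G x‖) (fun k => ?_) hG.norm
        (fun k => Eventually.of_forall fun x => ?_) ?_
      · exact (hθC k).continuous.aestronglyMeasurable.mul hG.aestronglyMeasurable
      · rw [norm_mul, Real.norm_eq_abs, abs_of_nonneg (cutoff_nonneg _)]
        exact mul_le_of_le_one_left (norm_nonneg _) (cutoff_le_one _)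
      · filter_upwards [ae_restrict_mem hW.measurableSet] with x hx
        by_cases hxK : x ∈ K
        · refine tendsto_const_nhds.congr' ?_
          filter_upwards [hlim x hx hxK] with k hk
          rw [hk, one_mul]
        · simp [hG0 x hxK]
    refine le_of_tendsto_of_tendsto (hconv _ hξdI fun x hx => ?_) (hconv F hFI fun x hx => ?_) hk
    · rw [image_eq_zero_of_notMem_tsupport hx, zero_mul]
    · simp only [hF, hξ0' _ x hx]; simp
  have key2 : ∀ ω' : ℝ, 0 < ω' → ∫ x in W, ξ x * d x ∂μ ≤
      ω' * (∫ x in W, fderiv ℝ ξ x v ∂μ) - ∫ x in W, ∑ i, fderiv ℝ ξ x (b i) * P i x ∂μ := by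
    intro ω' hω
    have := key ω' hω
    rwa [integral_sub (hIv.const_mul ω') hI, integral_const_mul] at this
  have hlim : Tendsto (fun ω' : ℝ => ω' * (∫ x in W, fderiv ℝ ξ x v ∂μ)
      - ∫ x in W, ∑ i, fderiv ℝ ξ x (b i) * P i x ∂μ) (𝓝[>] 0)
      (𝓝 (0 * (∫ x in W, fderiv ℝ ξ x v ∂μ)
        - ∫ x in W, ∑ i, fderiv ℝ ξ x (b i) * P i x ∂μ)) :=
    ((continuous_id.mul continuous_const).sub continuous_const).continuousAt.tendsto.mono_left
      nhdsWithin_le_nhds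
  have := ge_of_tendsto hlim (by filter_upwards [self_mem_nhdsWithin] with ω' hω using key2 ω' hω)
  simpa using this

/-- Localization by a partition of unity. -/
lemma weakDiv_of_local (hd : Continuous d) {ξ : E → ℝ} (hξ : ContDiff ℝ 1 ξ)
    (hc : HasCompactSupport ξ) (h0 : ∀ x, 0 ≤ ξ x)
    (hloc : ∀ q ∈ tsupport ξ, LocalWeakDiv μ b W P d q) : WeakDiv μ b W P d ξ := by
  choose! N hNo hqN hN using hloc
  obtain ⟨t, htK, ht⟩ := hc.isCompact.elim_nhds_subcover N
    fun q hq => (hNo q hq).mem_nhds (hqN q hq)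
  obtain ⟨f, hf⟩ := SmoothPartitionOfUnity.exists_isSubordinate (modelWithCornersSelf ℝ E)
    (isClosed_tsupport ξ) (fun i : t => N i) (fun i => hNo i (htK i i.2))
    (fun x hx => by
      obtain ⟨i, hi, hx⟩ := mem_iUnion₂.1 (ht hx)
      exact mem_iUnion.2 ⟨⟨i, hi⟩, hx⟩)
  have hfC : ∀ i, ContDiff ℝ 1 (f i) := fun i => ((f i).contMDiff.contDiff).of_le (by norm_num)
  have hsum : ∀ x, ξ x = ∑ i, f i x * ξ x := by
    intro x
    by_cases hx : x ∈ tsupport ξ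
    · have := f.sum_eq_one hx
      rw [finsum_eq_sum_of_fintype] at this
      rw [← Finset.sum_mul, this, one_mul]
    · simp [image_eq_zero_of_notMem_tsupport hx]
  have hCi : ∀ i, ContDiff ℝ 1 fun x => f i x * ξ x := fun i => (hfC i).mul hξ
  have hci : ∀ i, HasCompactSupport fun x => f i x * ξ x := fun i => hc.mul_left
  have key : ∀ i, WeakDiv μ b W P d fun x => f i x * ξ x := fun i =>
    hN i (htK i i.2) _ (hCi i) (hci i)
      (fun x => mul_nonneg (f.nonneg i x) (h0 x))
      ((tsupport_mul_subset_left).trans (hf i))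
  have hfd : ∀ x v, fderiv ℝ ξ x v = ∑ i, fderiv ℝ (fun y => f i y * ξ y) x v := by
    intro x v
    have h1 : ξ = fun y => ∑ i, f i y * ξ y := funext hsum
    conv_lhs => rw [h1]
    rw [fderiv_fun_sum fun i _ => (hCi i).differentiable one_ne_zero x]
    simp
  have e1 : (fun x => ∑ j, fderiv ℝ ξ x (b j) * P j x) =
      fun x => ∑ i, ∑ j, fderiv ℝ (fun y => f i y * ξ y) x (b j) * P j x := by
    funext x
    rw [Finset.sum_comm]
    refine Finset.sum_congr rfl fun j _ => ?_
    rw [hfd, Finset.sum_mul]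
  have e2 : (fun x => ξ x * d x) = fun x => ∑ i, f i x * ξ x * d x := by
    funext x
    rw [← Finset.sum_mul, ← hsum]
  refine ⟨?_, ?_⟩
  · rw [e1]
    exact integrable_finsetSum _ fun i _ => (key i).1
  · rw [e1, e2, integral_finsetSum, integral_finsetSum _ fun i _ => (key i).1,
      ← Finset.sum_neg_distrib]
    · exact Finset.sum_le_sum fun i _ => (key i).2
    · intro i _
      exact (((hCi i).continuous.mul hd).integrable_of_hasCompactSupport
        (hci i).mul_right).integrableOn

end Divergence

end

/-! ### The integrated inequality for a current that vanishes on the null cone -/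

section

open MeasureTheory

section Divergence

variable {E : Type*} [NormedAddCommGroup E] [NormedSpace ℝ E] [FiniteDimensional ℝ E]
  [MeasurableSpace E] [BorelSpace E] {μ : Measure E} [μ.IsAddHaarMeasure]
  {ι : Type*} [Fintype ι] {b : ι → E} {W : Set E} {P : ι → E → ℝ} {d : E → ℝ}

lemma exists_bound_deriv_cutoff : ∃ M : ℝ, 0 ≤ M ∧ ∀ s, |deriv cutoff s| ≤ M := by
  have hc : Continuous (deriv cutoff) := contDiff_cutoff.continuous_deriv le_rfl
  obtain ⟨M, hM⟩ := (isCompact_Icc (a := (1 : ℝ)) (b := 2)).exists_bound_of_continuousOn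
    hc.continuousOn
  have hM0 : 0 ≤ M := (norm_nonneg _).trans (hM 1 (by norm_num))
  refine ⟨M, hM0, fun s => ?_⟩
  by_cases hs : s ∈ Icc (1 : ℝ) 2
  · exact hM s hs
  · rw [deriv_cutoff_of_notMem hs]; simpa using hM0

/-- If a nonnegative `d` is a weak lower bound of a divergence away from `{f ≤ 0}`, and the current
vanishes to second order on `{f = 0}`, then the integral of `d` is not positive. -/
lemma integral_nonpos_of_localWeakDiv (hW : IsOpen W) (hWb : Bornology.IsBounded W)
    {f : E → ℝ} (hf : ContDiff ℝ 1 f) (hfW : ∀ x ∈ W, 0 < f x) {C : ℝ} (hC : 0 ≤ C)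
    (hP : ∀ i, ∀ x ∈ W, |P i x| ≤ C * f x ^ 2) (hd : Continuous d) (hdc : HasCompactSupport d)
    (hdW : tsupport d ⊆ W)
    (hloc : ∀ q ∈ closure W, 0 < f q → LocalWeakDiv μ b W P d q) : ∫ x, d x ∂μ ≤ 0 := by
  obtain ⟨M, hM0, hM⟩ := exists_bound_deriv_cutoff
  obtain ⟨R, hR⟩ := hWb.subset_ball (0 : E)
  have hfd : ∀ u, Continuous fun x => fderiv ℝ f x u := fun u =>
    (hf.continuous_fderiv one_ne_zero).clm_apply continuous_const
  obtain ⟨D, hD⟩ := (isCompact_closedBall (0 : E) R).exists_bound_of_continuousOn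
    (f := fun x => ∑ i, |fderiv ℝ f x (b i)|)
    (continuous_finsetSum _ fun i _ => (hfd (b i)).abs).continuousOn
  have hD' : ∀ x ∈ W, ∑ i, |fderiv ℝ f x (b i)| ≤ D := fun x hx =>
    (le_abs_self _).trans (hD x (Metric.ball_subset_closedBall (hR hx)))
  obtain ⟨δ, hδ, hδd⟩ : ∃ δ > 0, ∀ x ∈ tsupport d, δ ≤ f x := by
    rcases (tsupport d).eq_empty_or_nonempty with he | hne
    · exact ⟨1, one_pos, fun x hx => absurd hx (by simp [he])⟩
    · obtain ⟨x0, hx0, hmin⟩ := hdc.isCompact.exists_isMinOn hne hf.continuous.continuousOn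
      exact ⟨f x0, hfW x0 (hdW hx0), fun x hx => hmin hx⟩
  -- A function of f alone need not have compact support; κ is 1 near every point of the bounded set
  -- W, so it does not affect the integrals.
  let κ : ContDiffBump (0 : E) := ⟨max R 1, max R 1 + 1, by positivity, by linarith⟩
  have hκ1 : ∀ x ∈ W, κ =ᶠ[𝓝 x] fun _ => 1 := fun x hx => by
    filter_upwards [hW.mem_nhds hx] with y hy
    exact κ.one_of_mem_closedBall (Metric.closedBall_subset_closedBall (le_max_left R 1)
      (Metric.ball_subset_closedBall (hR hy)))
  have hdint : ∫ x in W, d x ∂μ = ∫ x, d x ∂μ :=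
    setIntegral_eq_integral_of_forall_compl_eq_zero fun x hx =>
      image_eq_zero_of_notMem_tsupport fun h => hx (hdW h)
  have hWfin : μ W < ⊤ := hWb.measure_lt_top
  -- For x in W the derivative of the test function is O(k) and supported in 1/k ≤ f ≤ 2/k, where
  -- the current is O(k⁻²): the error is O(1/k).
  have key : ∀ᶠ k : ℕ in atTop, ∫ x, d x ∂μ ≤ 4 * M * C * D / k * μ.real W := by
    filter_upwards [(tendsto_natCast_atTop_atTop (R := ℝ)).eventually_ge_atTop (2 / δ),
        eventually_ge_atTop 1] with k hkδ hk1
    have hk0 : (0 : ℝ) < k := by exact_mod_cast hk1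
    rw [div_le_iff₀ hδ] at hkδ
    set ξ : E → ℝ := fun x => κ x * cutoff (k * f x) with hξ
    have hcC : ContDiff ℝ 1 fun x => cutoff (k * f x) :=
      contDiff_cutoff.comp (contDiff_const.mul hf)
    have hξC : ContDiff ℝ 1 ξ := κ.contDiff.mul hcC
    have hξc : HasCompactSupport ξ := κ.hasCompactSupport.mul_right
    have hξ0 : ∀ x, 0 ≤ ξ x := fun x => mul_nonneg κ.nonneg (cutoff_nonneg _)
    have hξs : ∀ q ∈ tsupport ξ, LocalWeakDiv μ b W P d q := by
      intro q hq
      by_cases hqW : q ∈ closure W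
      · refine hloc q hqW ?_
        have h1 : tsupport ξ ⊆ {x | 1 ≤ (k : ℝ) * f x} := by
          refine closure_minimal (fun x hx => ?_)
            (isClosed_le continuous_const (continuous_const.mul hf.continuous))
          have hx' : κ x ≠ 0 ∧ cutoff (k * f x) ≠ 0 := by
            simpa only [Function.mem_support, ξ, mul_ne_zero_iff] using hx
          by_contra h
          simp only [mem_ofPred_eq, not_le] at h
          exact hx'.2 (cutoff_of_le h.le)
        have h2 : 1 ≤ (k : ℝ) * f q := h1 hq
        by_contra! h3
        have : (k : ℝ) * f q ≤ 0 := mul_nonpos_of_nonneg_of_nonpos hk0.le h3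
        linarith
      · exact localWeakDiv_of_notMem_closure hW hqW
    obtain ⟨-, hmain⟩ := weakDiv_of_local hd hξC hξc hξ0 hξs
    have e1 : ∫ x in W, ξ x * d x ∂μ = ∫ x in W, d x ∂μ := by
      refine setIntegral_congr_fun hW.measurableSet fun x hx => ?_
      by_cases hxd : x ∈ tsupport d
      · have h1 : cutoff (k * f x) = 1 := cutoff_of_ge (by
          have := mul_le_mul_of_nonneg_left (hδd x hxd) hk0.le
          linarith)
        simp only [ξ, h1, (hκ1 x hx).self_of_nhds, one_mul]
      · simp only [image_eq_zero_of_notMem_tsupport hxd, mul_zero]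
    rw [e1, hdint] at hmain
    refine hmain.trans ((neg_le_abs _).trans ?_)
    rw [← Real.norm_eq_abs]
    refine norm_setIntegral_le_of_norm_le_const hWfin fun x hx => ?_
    have hder : ∀ u, fderiv ℝ ξ x u = deriv cutoff (k * f x) * (k * fderiv ℝ f x u) := by
      intro u
      have h1 : ξ =ᶠ[𝓝 x] fun y => cutoff (k * f y) := by
        filter_upwards [hκ1 x hx] with y hy
        simp only [ξ, hy, one_mul]
      rw [h1.fderiv_eq, fderiv_cutoff_comp (hf.differentiable one_ne_zero x)]
    simp only [hder]
    by_cases hmem : (k : ℝ) * f x ∈ Icc (1 : ℝ) 2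
    · have hf2 : f x ≤ 2 / k := by
        rw [le_div_iff₀ hk0]; linarith [hmem.2]
      have hfx := hfW x hx
      have hPx : ∀ i, |P i x| ≤ C * (2 / k) ^ 2 := fun i =>
        (hP i x hx).trans (mul_le_mul_of_nonneg_left (by gcongr) hC)
      calc ‖∑ i, deriv cutoff (k * f x) * (k * fderiv ℝ f x (b i)) * P i x‖
          ≤ ∑ i, M * k * (C * (2 / k) ^ 2) * |fderiv ℝ f x (b i)| := by
            refine norm_sum_le_of_le _ fun i _ => ?_
            rw [norm_mul, norm_mul, norm_mul, Real.norm_eq_abs, Real.norm_eq_abs,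
              Real.norm_eq_abs, Real.norm_eq_abs, abs_of_pos hk0]
            have h1 := mul_le_mul (hM (k * f x)) (hPx i) (abs_nonneg _) hM0
            have h2 := mul_le_mul_of_nonneg_left h1
              (by positivity : 0 ≤ (k : ℝ) * |fderiv ℝ f x (b i)|)
            linarith
        _ = M * k * (C * (2 / k) ^ 2) * ∑ i, |fderiv ℝ f x (b i)| := by
            rw [Finset.mul_sum]
        _ ≤ M * k * (C * (2 / k) ^ 2) * D :=
            mul_le_mul_of_nonneg_left (hD' x hx) (by positivity)
        _ = 4 * M * C * D / k := by
            field_simp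
            ring
    · rw [deriv_cutoff_of_notMem hmem]
      have hD0 : 0 ≤ D := (Finset.sum_nonneg fun i _ => abs_nonneg _).trans (hD' x hx)
      simp only [zero_mul, Finset.sum_const_zero, norm_zero]
      positivity
  have hlim : Tendsto (fun k : ℕ => 4 * M * C * D / k * μ.real W) atTop (𝓝 (0 * μ.real W)) :=
    (tendsto_const_div_atTop_nhds_zero_nat _).mul_const _
  rw [zero_mul] at hlim
  exact ge_of_tendsto hlim key

end Divergence

end

/-! ### Domains with timelike boundary -/

section

variable {m n : ℕ}

/-- The differential of a function has a `g`-gradient. -/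
lemma exists_gradient (L : Spacetime m n →L[ℝ] ℝ) : ∃ N, ∀ w, L w = metric N w := by
  refine ⟨(-(InnerProductSpace.toDual ℝ _).symm (L.comp (ContinuousLinearMap.inl ℝ _ _)),
    (InnerProductSpace.toDual ℝ _).symm (L.comp (ContinuousLinearMap.inr ℝ _ _))), fun w => ?_⟩
  have h : w = (w.1, 0) + (0, w.2) := by simp
  simp only [metric, InnerProductSpace.toDual_symm_apply, inner_neg_left]
  conv_lhs => rw [h, map_add]
  simp [add_comm]

lemma isOpen_timeCube (T : ℝ) : IsOpen (timeCube m T) := by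
  simp only [timeCube, ofPred_forall]
  refine isOpen_iInter_of_finite fun i => ?_
  exact (isOpen_lt continuous_const (EuclideanSpace.proj (𝕜 := ℝ) i).continuous).inter
    (isOpen_lt (EuclideanSpace.proj (𝕜 := ℝ) i).continuous continuous_const)

/-- Open domains over the time cube whose spatial boundary is smooth with spacelike normals. -/
structure IsTimelikeDomain (T : ℝ) (U : Set (Spacetime m n)) : Prop where
  isOpen : IsOpen U
  normal : ∀ q ∈ lateralBoundary T U, ∃ (φ : Spacetime m n → ℝ) (N : Spacetime m n),
    IsDefiningFunctionAt U q φ ∧ (∀ w, fderiv ℝ φ q w = metric N w) ∧ 0 < metric N N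

lemma IsMovingDomain.isTimelikeDomain {T : ℝ} {U : Set (Spacetime m n)}
    (h : IsMovingDomain T U) : IsTimelikeDomain T U := by
  obtain ⟨j, Ω, -, -, hopen, hsm, hn, -⟩ := h
  refine ⟨hopen, fun q hq => ?_⟩
  obtain ⟨φ, hφ⟩ := hsm q hq
  obtain ⟨N, hN⟩ := exists_gradient (fderiv ℝ φ q)
  exact ⟨φ, N, hφ, hN, hn q hq N ⟨φ, hφ, hN⟩⟩

lemma IsStaticDomain.isTimelikeDomain {T : ℝ} {U : Set (Spacetime m n)}
    (h : IsStaticDomain T U) : IsTimelikeDomain T U := by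
  obtain ⟨Ω, -, hΩ, -, hsm, rfl⟩ := h
  refine ⟨(isOpen_timeCube T).prod hΩ, fun q hq => ?_⟩
  have hop := (isOpen_timeCube (m := m) T).prod hΩ
  obtain ⟨hqf, hqt⟩ := hq
  have hqc : q.2 ∈ closure Ω := by
    have := frontier_subset_closure hqf
    rw [closure_prod_eq] at this
    exact this.2
  have hqn : q.2 ∉ Ω := fun hh => by
    rw [hop.frontier_eq] at hqf
    exact hqf.2 ⟨hqt, hh⟩
  obtain ⟨φ, hφ, hφ0, hφd, hφΩ⟩ := hsm q.2 (by rw [hΩ.frontier_eq]; exact ⟨hqc, hqn⟩)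
  have hd : ∀ w : Spacetime m n, fderiv ℝ (fun y : Spacetime m n => φ y.2) q w
      = fderiv ℝ φ q.2 w.2 := fun w => by
    have h1 : HasFDerivAt φ (fderiv ℝ φ q.2) q.2 :=
      (hφ.differentiable (by simp)).differentiableAt.hasFDerivAt
    have h2 : HasFDerivAt (fun y : Spacetime m n => φ y.2) _ q := h1.comp q hasFDerivAt_snd
    rw [h2.fderiv]
    rfl
  obtain ⟨N, hN⟩ := exists_gradient (fderiv ℝ (fun y : Spacetime m n => φ y.2) q)
  refine ⟨fun y => φ y.2, N, ⟨hφ.comp contDiff_snd, hφ0, fun h0 => hφd ?_, ?_⟩, hN, ?_⟩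
  · ext w
    have := hd (0, w)
    rw [h0] at this
    simpa using this.symm
  · have h1 : ∀ᶠ y : Spacetime m n in 𝓝 q, y.1 ∈ timeCube m T :=
      continuousAt_fst.eventually ((isOpen_timeCube T).mem_nhds hqt)
    have h2 : ∀ᶠ y : Spacetime m n in 𝓝 q, (y.2 ∈ Ω ↔ φ y.2 < 0) :=
      (continuousAt_snd (p := q)).eventually hφΩ
    filter_upwards [h1, h2] with y hy1 hy2
    rw [← hy2]
    exact ⟨fun h => h.2, fun h => ⟨hy1, h⟩⟩
  -- The defining function depends on x only, so its gradient is purely spatial and therefore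
  -- spacelike.
  · have hN1 : N.1 = 0 := by
      have := hN (N.1, 0)
      rw [hd] at this
      simpa [metric] using this
    have hN2 : N.2 ≠ 0 := fun h => hφd (by
      ext w
      have := hN (0, w)
      rw [hd] at this
      simpa [metric, hN1, h] using this)
    simp only [metric, hN1, inner_zero_left, sub_zero, real_inner_self_eq_norm_sq]
    positivity

/-- A function decreases in the directions in which its strict derivative is negative. -/
lemma exists_ball_lt_of_strictFDeriv {E : Type*} [NormedAddCommGroup E] [NormedSpace ℝ E]
    {φ : E → ℝ} {L : E →L[ℝ] ℝ} {q : E} (h : HasStrictFDerivAt φ L q) {η : ℝ} (hη : 0 < η) :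
    ∃ δ > 0, ∀ y ∈ Metric.ball q δ, ∀ y' ∈ Metric.ball q δ, y' ≠ y →
      L (y' - y) ≤ -η * ‖y' - y‖ → φ y' < φ y := by
  have h1 := h.isLittleO.def (half_pos hη)
  rw [nhds_prod_eq, ← nhds_prod_eq, Metric.eventually_nhds_iff_ball] at h1
  obtain ⟨δ, hδ, h2⟩ := h1
  refine ⟨δ, hδ, fun y hy y' hy' hne hL => ?_⟩
  have h3 := h2 (y', y) (by rw [← ball_prod_same]; exact ⟨hy', hy⟩)
  have h4 : 0 < ‖y' - y‖ := norm_pos_iff.2 (sub_ne_zero.2 hne)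
  have h5 := (abs_le.1 h3).2
  simp only at h5
  nlinarith

lemma exists_fderiv_neg {E : Type*} [NormedAddCommGroup E] [NormedSpace ℝ E] {L : E →L[ℝ] ℝ}
    (h : L ≠ 0) : ∃ v, L v < 0 := by
  obtain ⟨v, hv⟩ := DFunLike.ne_iff.1 h
  rcases lt_or_gt_of_ne hv with hv | hv
  · exact ⟨v, hv⟩
  · exact ⟨-v, by rw [map_neg]; simpa using hv⟩

namespace IsTimelikeDomain

variable {T : ℝ} {U : Set (Spacetime m n)}

lemma mem_of_closure (hU : IsTimelikeDomain T U) {q : Spacetime m n} (hq : q ∈ closure U)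
    (ht : q.1 ∈ timeCube m T) : q ∈ U ∪ lateralBoundary T U := by
  by_cases h : q ∈ U
  · exact Or.inl h
  · refine Or.inr ⟨?_, ht⟩
    rw [hU.isOpen.frontier_eq]
    exact ⟨hq, h⟩

lemma subset_closure_union (U : Set (Spacetime m n)) :
    U ∪ lateralBoundary T U ⊆ closure U :=
  union_subset subset_closure fun _ h => frontier_subset_closure h.1

/-- Near a spatial boundary point the zero set of a defining function is the boundary. -/
lemma eventually_lateral (hU : IsTimelikeDomain T U) {q : Spacetime m n}
    (hq : q ∈ lateralBoundary T U) {φ : Spacetime m n → ℝ} (hφ : IsDefiningFunctionAt U q φ) :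
    ∀ᶠ y in 𝓝 q, φ y = 0 → y ∈ lateralBoundary T U := by
  obtain ⟨hs, hz, hd, he⟩ := hφ
  obtain ⟨v, hv⟩ := exists_fderiv_neg hd
  have hv0 : 0 < ‖v‖ := norm_pos_iff.2 (by rintro rfl; simp at hv)
  have hst : HasStrictFDerivAt φ (fderiv ℝ φ q) q :=
    hs.contDiffAt.hasStrictFDerivAt (by simp)
  obtain ⟨δ, hδ, hball⟩ := exists_ball_lt_of_strictFDeriv hst
    (η := -fderiv ℝ φ q v / ‖v‖) (div_pos (by linarith) hv0)
  have h1 : ∀ᶠ y : Spacetime m n in 𝓝 q, y.1 ∈ timeCube m T :=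
    continuousAt_fst.eventually ((isOpen_timeCube T).mem_nhds hq.2)
  filter_upwards [h1, he, he.eventually_nhds, Metric.ball_mem_nhds q hδ] with y hy1 hy2 hy3 hy4 hy0
  refine ⟨?_, hy1⟩
  rw [hU.isOpen.frontier_eq]
  refine ⟨?_, fun h => by have := hy2.1 h; linarith⟩
  -- A zero y of φ is a limit of the points y + sv with s > 0, where φ is negative, hence of points
  -- of U.
  have hc : Tendsto (fun s : ℝ => y + s • v) (𝓝[>] 0) (𝓝 y) := by
    have : Continuous (fun s : ℝ => y + s • v) := by fun_prop
    have h := this.tendsto 0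
    simp only [zero_smul, add_zero] at h
    exact h.mono_left nhdsWithin_le_nhds
  refine mem_closure_of_tendsto hc ?_
  filter_upwards [hc.eventually hy3, hc.eventually (Metric.isOpen_ball.mem_nhds hy4),
    self_mem_nhdsWithin] with s hs1 hs2 hs3
  have hs3 : (0:ℝ) < s := hs3
  rw [hs1, ← hy0]
  refine hball _ hy4 _ hs2 ?_ ?_
  · simp only [ne_eq, add_eq_left, smul_eq_zero, not_or]
    exact ⟨hs3.ne', norm_pos_iff.1 hv0⟩
  · simp only [add_sub_cancel_left, map_smul, smul_eq_mul, norm_smul, Real.norm_eq_abs,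
      abs_of_pos hs3]
    field_simp
    linarith

/-- Every direction in which a defining function decreases enters U, and these directions fill an
open half-space, which spans. This makes the one-sided derivative at the boundary well defined, so
it is additive in z and continuous up to the boundary. -/
lemma uniqueDiffOn (hU : IsTimelikeDomain T U) :
    UniqueDiffOn ℝ (U ∪ lateralBoundary T U) := by
  rintro q (hq | hq)
  · refine UniqueDiffWithinAt.mono (hU.isOpen.uniqueDiffWithinAt hq) subset_union_left
  obtain ⟨φ, N, ⟨hs, hz, hd, he⟩, -, -⟩ := hU.normal q hq
  have key : ∀ v, fderiv ℝ φ q v < 0 →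
      v ∈ tangentConeAt ℝ (U ∪ lateralBoundary T U) q := by
    intro v hv
    have hder : HasDerivAt (fun s : ℝ => φ (q + s • v)) (fderiv ℝ φ q v) 0 := by
      have h1 : HasFDerivAt φ (fderiv ℝ φ q) (q + (0:ℝ) • v) := by
        simpa using (hs.differentiable (by simp)).differentiableAt.hasFDerivAt (x := q)
      have h2 : HasDerivAt (fun s : ℝ => q + s • v) v 0 := by
        simpa using ((hasDerivAt_id (0:ℝ)).smul_const v).const_add q
      exact h1.comp_hasDerivAt (0:ℝ) h2
    have hcont : Tendsto (fun s : ℝ => q + s • v) (𝓝 0) (𝓝 q) := by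
      have : Continuous (fun s : ℝ => q + s • v) := by fun_prop
      simpa using this.tendsto 0
    have hsl := hder.tendsto_slope_zero_right.eventually_lt_const hv
    have h3 : ∀ᶠ s : ℝ in 𝓝[>] 0, q + s • v ∈ U := by
      filter_upwards [hsl, (hcont.eventually he).filter_mono nhdsWithin_le_nhds,
        self_mem_nhdsWithin] with s h4 h5 h6
      have h6 : (0:ℝ) < s := h6
      rw [h5]
      simp only [zero_add, zero_smul, add_zero, hz, sub_zero, smul_eq_mul] at h4
      have := mul_neg_of_pos_of_neg h6 h4
      rwa [mul_inv_cancel_left₀ h6.ne'] at this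
    refine mem_tangentConeAt_of_add_smul_mem (l := 𝓝[>] (0:ℝ))
      (tendsto_id'.2 <| nhdsGT_le_nhdsNE 0) ?_
    filter_upwards [h3] with s hs
    exact Or.inl hs
  refine ⟨?_, subset_closure (Or.inr hq)⟩
  convert dense_univ
  rw [← Submodule.top_coe (R := ℝ)]
  congr 1
  rw [eq_top_iff]
  rintro v -
  obtain ⟨v₀, hv₀⟩ := exists_fderiv_neg hd
  -- For large k both v + k v₀ and v₀ lie in the half-space, and v is a combination of them.
  obtain ⟨k, hk⟩ := exists_nat_gt (fderiv ℝ φ q v / -fderiv ℝ φ q v₀)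
  rw [div_lt_iff₀ (by linarith)] at hk
  have h1 := Submodule.subset_span (R := ℝ) (key (v + (k : ℝ) • v₀) (by
    rw [map_add, map_smul, smul_eq_mul]
    linarith))
  have h2 := Submodule.smul_mem _ (k : ℝ) (Submodule.subset_span (R := ℝ) (key v₀ hv₀))
  simpa using Submodule.sub_mem _ h1 h2

end IsTimelikeDomain

end

/-! ### The bound of 𝒳 by the square root of f_p, and differentials at the boundary -/

section

variable {m n : ℕ}

/-- A `C¹` function on an open set, up to the boundary, has bounded differential near the
points of the closure. -/
lemma exists_norm_fderiv_le {E F : Type*} [NormedAddCommGroup E] [NormedSpace ℝ E]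
    [NormedAddCommGroup F] [NormedSpace ℝ F] {X : E → F} {U : Set E} (hU : IsOpen U) {q : E}
    (hq : q ∈ closure U) (hX : ContDiffWithinAt ℝ 1 X (closure U) q) :
    ∃ M, 0 ≤ M ∧ ∃ δ > 0, ∀ y ∈ U ∩ Metric.ball q δ,
      DifferentiableAt ℝ X y ∧ ‖fderiv ℝ X y‖ ≤ M := by
  rw [show (1 : WithTop ℕ∞) = 0 + 1 by simp,
    contDiffWithinAt_succ_iff_hasFDerivWithinAt (by simp)] at hX
  obtain ⟨u, hu, -, X', hX', hc⟩ := hX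
  rw [insert_eq_of_mem hq] at hu
  have h1 : ∀ᶠ y in 𝓝[u] q, ‖X' y‖ < ‖X' q‖ + 1 :=
    (hc.continuousWithinAt.norm).eventually_lt_const (by linarith)
  have hu' : ∀ᶠ y in 𝓝 q, y ∈ closure U → y ∈ u := mem_nhdsWithin_iff_eventually.1 hu
  have h2 := eventually_nhdsWithin_iff.1 h1
  obtain ⟨δ, hδ, h3⟩ := Metric.eventually_nhds_iff_ball.1 (hu'.and h2)
  refine ⟨‖X' q‖ + 1, by positivity, δ, hδ, fun y hy => ?_⟩
  have hyu : u ∈ 𝓝 y := by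
    filter_upwards [hU.mem_nhds hy.1, Metric.isOpen_ball.mem_nhds hy.2] with z hz1 hz2
    exact (h3 z hz2).1 (subset_closure hz1)
  have h4 := (hX' y (mem_of_mem_nhds hyu)).hasFDerivAt hyu
  exact ⟨h4.differentiableAt, by
    rw [h4.fderiv]; exact ((h3 y hy.2).2 (mem_of_mem_nhds hyu)).le⟩

/-- The direction is t/‖t‖, or any unit vector if t = 0; a time direction exists because m > 0. -/
lemma exists_unit_norm_add (hm : 0 < m) (t : EuclideanSpace ℝ (Fin m)) :
    ∃ τ : EuclideanSpace ℝ (Fin m), ‖τ‖ = 1 ∧ ∀ s : ℝ, 0 ≤ s → ‖t + s • τ‖ = ‖t‖ + s := by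
  by_cases ht : t = 0
  · refine ⟨EuclideanSpace.single ⟨0, hm⟩ 1, by simp, fun s hs => ?_⟩
    simp [ht, norm_smul, abs_of_nonneg hs]
  · have h0 : 0 < ‖t‖ := norm_pos_iff.2 ht
    refine ⟨‖t‖⁻¹ • t, by rw [norm_smul, norm_inv, norm_norm, inv_mul_cancel₀ h0.ne'],
      fun s hs => ?_⟩
    have : t + s • ‖t‖⁻¹ • t = (1 + s * ‖t‖⁻¹) • t := by rw [add_smul, one_smul, mul_smul]
    rw [this, norm_smul, Real.norm_eq_abs, abs_of_nonneg (by positivity)]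
    field_simp

lemma norm_eq_one_of_le {a : EuclideanSpace ℝ (Fin m)} {b : EuclideanSpace ℝ (Fin n)}
    (ha : ‖a‖ = 1) (hb : ‖b‖ ≤ 1) : ‖((a, b) : Spacetime m n)‖ = 1 := by
  rw [Prod.norm_mk, ha, max_eq_left hb]

namespace IsTimelikeDomain

variable {T : ℝ} {U : Set (Spacetime m n)}

/-- Near each point up to the spatial boundary there is a velocity `ν` of norm less than one
such that one stays in the domain when moving in the timelike directions `(τ, ν)`. -/
lemma exists_velocity (hU : IsTimelikeDomain T U) {q : Spacetime m n}
    (hq : q ∈ U ∪ lateralBoundary T U) :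
    ∃ ν : EuclideanSpace ℝ (Fin n), ‖ν‖ < 1 ∧ ∃ δ > 0, ∀ a ∈ U ∩ Metric.ball q δ,
      ∀ τ : EuclideanSpace ℝ (Fin m), ‖τ‖ = 1 → ∀ s : ℝ, 0 ≤ s → s < δ →
        a + s • (τ, ν) ∈ U := by
  have hball : ∀ {δ : ℝ} {a : Spacetime m n} {τ : EuclideanSpace ℝ (Fin m)}
      {ν : EuclideanSpace ℝ (Fin n)} {s : ℝ}, a ∈ Metric.ball q (δ / 2) → ‖τ‖ = 1 → ‖ν‖ < 1 →
      0 ≤ s → s < δ / 2 → a + s • (τ, ν) ∈ Metric.ball q δ := by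
    intro δ a τ ν s ha hτ hν hs hsδ
    have h1 : ‖s • ((τ, ν) : Spacetime m n)‖ = s := by
      rw [norm_smul, norm_eq_one_of_le hτ hν.le, mul_one, Real.norm_eq_abs, abs_of_nonneg hs]
    rw [Metric.mem_ball, dist_eq_norm] at ha ⊢
    have h2 := norm_add_le (a - q) (s • ((τ, ν) : Spacetime m n))
    rw [sub_add_eq_add_sub, h1] at h2
    linarith
  rcases hq with hq | hq
  · obtain ⟨δ, hδ, h1⟩ := Metric.isOpen_iff.1 hU.isOpen q hq
    refine ⟨0, by simp, δ / 2, half_pos hδ, fun a ha τ hτ s hs hsδ => h1 ?_⟩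
    exact hball ha.2 hτ (by simp) hs hsδ
  · obtain ⟨φ, N, ⟨hs, hz, hd, he⟩, hN, hNN⟩ := hU.normal q hq
    have hlt : ‖N.1‖ < ‖N.2‖ := by
      simp only [metric, real_inner_self_eq_norm_sq, sub_pos] at hNN
      exact lt_of_pow_lt_pow_left₀ 2 (norm_nonneg _) hNN
    have h2 : 0 < ‖N.2‖ := lt_of_le_of_lt (norm_nonneg _) hlt
    -- Midpoint between ‖N.1‖/‖N.2‖ and 1. The velocity ν = -l N.2/‖N.2‖ is slower than 1 and yet
    -- g(N, (τ, ν)) ≤ -(‖N.2‖ - ‖N.1‖)/2 for every unit τ, so the direction enters U uniformly in τ.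
    set l : ℝ := (‖N.1‖ / ‖N.2‖ + 1) / 2 with hl
    have hl0 : 0 ≤ l := by positivity
    have hl1 : l < 1 := by
      have := (div_lt_one h2).2 hlt
      linarith
    have hlN : l * ‖N.2‖ = (‖N.1‖ + ‖N.2‖) / 2 := by rw [hl]; field_simp
    have hν : ‖-(l / ‖N.2‖) • N.2‖ < 1 := by
      rw [norm_smul, norm_neg, Real.norm_eq_abs, abs_of_nonneg (by positivity)]
      rwa [div_mul_cancel₀ _ h2.ne']
    have hst : HasStrictFDerivAt φ (fderiv ℝ φ q) q :=
      hs.contDiffAt.hasStrictFDerivAt (by simp)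
    obtain ⟨δ₁, hδ₁, hb₁⟩ := exists_ball_lt_of_strictFDeriv hst
      (η := (‖N.2‖ - ‖N.1‖) / 2) (by linarith)
    obtain ⟨δ₂, hδ₂, hb₂⟩ := Metric.eventually_nhds_iff_ball.1 he
    refine ⟨-(l / ‖N.2‖) • N.2, hν, min δ₁ δ₂ / 2, by positivity, fun a ha τ hτ s hs0 hsδ => ?_⟩
    have hab := hball ha.2 hτ hν hs0 hsδ
    have haa : a ∈ Metric.ball q (min δ₁ δ₂) :=
      Metric.ball_subset_ball (half_le_self (by positivity)) ha.2
    rcases hs0.eq_or_lt with rfl | hs0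
    · simpa using ha.1
    have hn1 := norm_eq_one_of_le hτ hν.le
    rw [hb₂ _ (Metric.ball_subset_ball (min_le_right _ _) hab)]
    refine lt_trans (hb₁ a (Metric.ball_subset_ball (min_le_left _ _) haa) _
      (Metric.ball_subset_ball (min_le_left _ _) hab) ?_ ?_)
      ((hb₂ _ (Metric.ball_subset_ball (min_le_right _ _) haa)).1 ha.1)
    · simp only [ne_eq, add_eq_left, smul_eq_zero, not_or]
      refine ⟨hs0.ne', fun h => ?_⟩
      rw [h] at hn1
      simp at hn1
    · rw [add_sub_cancel_left, map_smul, norm_smul, hn1, hN, smul_eq_mul, mul_one,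
        Real.norm_eq_abs, abs_of_pos hs0]
      have h3 : metric N (τ, -(l / ‖N.2‖) • N.2) ≤ -((‖N.2‖ - ‖N.1‖) / 2) := by
        simp only [metric, inner_smul_right, real_inner_self_eq_norm_sq]
        have h4 := neg_le_of_abs_le (abs_real_inner_le_norm N.1 τ)
        rw [hτ, mul_one] at h4
        have h5 : l / ‖N.2‖ * ‖N.2‖ ^ 2 = l * ‖N.2‖ := by field_simp
        linarith
      nlinarith

/-- A `C¹` vector field which vanishes on the null cone is, near the null cone, bounded by the
square root of `f_p`. -/
lemma exists_local_bound (hm : 0 < m) (hU : IsTimelikeDomain T U) {p q : Spacetime m n}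
    (hq : q ∈ U ∪ lateralBoundary T U) (hf : 0 ≤ fFun p q) {X : Spacetime m n → Spacetime m n}
    (hX : ContDiffOn ℝ 1 X (closure U)) (hX0 : ∀ q ∈ U, fFun p q = 0 → X q = 0) :
    ∃ C, 0 ≤ C ∧ ∀ᶠ a in 𝓝 q, a ∈ U → 0 < fFun p a → ‖X a‖ ^ 2 ≤ C * fFun p a := by
  have hqc := subset_closure_union U hq
  rcases hf.eq_or_lt with hf | hf
  · obtain ⟨M, hM, δ₁, hδ₁, hder⟩ := exists_norm_fderiv_le hU.isOpen hqc (hX q hqc)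
    obtain ⟨ν, hν, δ₂, hδ₂, hvel⟩ := hU.exists_velocity hq
    have hl : 0 < 1 - ‖ν‖ := by linarith
    set δ := min (δ₁ / 2) δ₂ with hδ
    have hδ0 : 0 < δ := by positivity
    have h1 : ∀ᶠ a : Spacetime m n in 𝓝 q, (rFun p a - ‖a.1 - p.1‖) / (1 - ‖ν‖) < δ := by
      have hc : Continuous fun a : Spacetime m n => (rFun p a - ‖a.1 - p.1‖) / (1 - ‖ν‖) := by
        have := continuous_rFun p
        fun_prop
      refine (hc.tendsto q).eventually_lt_const ?_
      have h2 := four_fFun p q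
      rw [← hf, mul_zero, eq_comm, sub_eq_zero,
        sq_eq_sq₀ (rFun_nonneg p q) (norm_nonneg _)] at h2
      simpa [h2] using hδ0
    refine ⟨M ^ 2 * (4 / (1 - ‖ν‖) ^ 2), by positivity, ?_⟩
    filter_upwards [h1, Metric.ball_mem_nhds q hδ0] with a ha hab haU hfa
    -- Along (τ, ν) the distance |t - t(p)| grows with speed 1 and r with speed at most ‖ν‖ < 1, so
    -- the null cone is met no later than s₀. The mean value inequality on that segment bounds X at
    -- a.
    obtain ⟨τ, hτ, hτs⟩ := exists_unit_norm_add hm (a.1 - p.1)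
    set s₀ := (rFun p a - ‖a.1 - p.1‖) / (1 - ‖ν‖) with hs₀
    have hs₀l : s₀ * (1 - ‖ν‖) = rFun p a - ‖a.1 - p.1‖ := div_mul_cancel₀ _ hl.ne'
    have h4f := four_fFun p a
    have hdiff : 0 < rFun p a - ‖a.1 - p.1‖ := by
      have h3 : ‖a.1 - p.1‖ ^ 2 < rFun p a ^ 2 := by linarith
      linarith [lt_of_pow_lt_pow_left₀ 2 (rFun_nonneg p a) h3]
    have hs₀0 : 0 < s₀ := div_pos hdiff hl
    have hend : fFun p (a + s₀ • (τ, ν)) ≤ 0 := by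
      have h3 : ‖(a + s₀ • ((τ, ν) : Spacetime m n)).2 - p.2‖ ≤ rFun p a + s₀ * ‖ν‖ := by
        have := norm_add_le (a.2 - p.2) (s₀ • ν)
        rw [norm_smul, Real.norm_eq_abs, abs_of_pos hs₀0] at this
        simpa [sub_add_eq_add_sub, rFun] using this
      have h4 : ‖(a + s₀ • ((τ, ν) : Spacetime m n)).1 - p.1‖ = ‖a.1 - p.1‖ + s₀ := by
        rw [← hτs s₀ hs₀0.le]
        simp [sub_add_eq_add_sub]
      have h5 : ‖(a + s₀ • ((τ, ν) : Spacetime m n)).2 - p.2‖ ≤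
          ‖(a + s₀ • ((τ, ν) : Spacetime m n)).1 - p.1‖ := by
        rw [h4]; linarith
      have := pow_le_pow_left₀ (norm_nonneg _) h5 2
      rw [fFun]
      linarith
    have hc : ContinuousOn (fun s : ℝ => fFun p (a + s • (τ, ν))) (Icc 0 s₀) := by
      have := continuous_fFun p
      fun_prop
    obtain ⟨s₁, hs₁, hfs⟩ := intermediate_value_Icc' hs₀0.le hc
      (show (0 : ℝ) ∈ _ from ⟨hend, by simpa using hfa.le⟩)
    have hn1 : ‖((τ, ν) : Spacetime m n)‖ = 1 := norm_eq_one_of_le hτ hν.le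
    have hmem : ∀ s ∈ Icc 0 s₁, a + s • (τ, ν) ∈ U ∩ Metric.ball q δ₁ := by
      intro s hs
      have hsδ : s < δ := lt_of_le_of_lt (hs.2.trans hs₁.2) ha
      refine ⟨hvel a ⟨haU, Metric.ball_subset_ball (min_le_right _ _) hab⟩ τ hτ s hs.1
        (hsδ.trans_le (min_le_right _ _)), ?_⟩
      rw [Metric.mem_ball, dist_eq_norm] at hab ⊢
      have h2 := norm_add_le (a - q) (s • ((τ, ν) : Spacetime m n))
      rw [sub_add_eq_add_sub, norm_smul, hn1, mul_one, Real.norm_eq_abs, abs_of_nonneg hs.1] at h2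
      have := min_le_left (δ₁ / 2) δ₂
      linarith
    have hseg : ∀ y ∈ segment ℝ a (a + s₁ • (τ, ν)), y ∈ U ∩ Metric.ball q δ₁ := by
      intro y hy
      rw [segment_eq_image'] at hy
      obtain ⟨θ, hθ, rfl⟩ := hy
      simp only [add_sub_cancel_left, smul_smul]
      exact hmem _ ⟨mul_nonneg hθ.1 hs₁.1, mul_le_of_le_one_left hs₁.1 hθ.2⟩
    have h6 := (convex_segment a (a + s₁ • (τ, ν))).norm_image_sub_le_of_norm_fderiv_le
      (fun y hy => (hder y (hseg y hy)).1) (fun y hy => (hder y (hseg y hy)).2)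
      (left_mem_segment ℝ _ _) (right_mem_segment ℝ _ _)
    rw [hX0 _ (hmem s₁ (right_mem_Icc.2 hs₁.1)).1 hfs, zero_sub, norm_neg, add_sub_cancel_left,
      norm_smul, hn1, mul_one, Real.norm_eq_abs, abs_of_nonneg hs₁.1] at h6
    have h7 : ‖X a‖ ≤ M * s₀ := h6.trans (mul_le_mul_of_nonneg_left hs₁.2 hM)
    have h8 := pow_le_pow_left₀ (norm_nonneg _) h7 2
    refine h8.trans ?_
    rw [mul_pow, mul_assoc]
    refine mul_le_mul_of_nonneg_left ?_ (sq_nonneg M)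
    rw [hs₀, div_pow, div_mul_eq_mul_div]
    refine div_le_div_of_nonneg_right ?_ (by positivity)
    -- With |t| short for |t - t(p)|: (r - |t|)² ≤ (r - |t|)(r + |t|) = 4f.
    nlinarith [norm_nonneg (a.1 - p.1)]
  · have h1 : ∀ᶠ a in 𝓝[closure U] q, ‖X a‖ < ‖X q‖ + 1 :=
      ((hX q hqc).continuousWithinAt.norm).eventually_lt_const (by linarith)
    have h2 : ∀ᶠ a in 𝓝 q, fFun p q / 2 < fFun p a :=
      ((continuous_fFun p).tendsto q).eventually_const_lt (by linarith)
    refine ⟨2 * (‖X q‖ + 1) ^ 2 / fFun p q, by positivity, ?_⟩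
    filter_upwards [eventually_nhdsWithin_iff.1 h1, h2] with a ha1 ha2 haU _
    have h3 := pow_le_pow_left₀ (norm_nonneg _) (ha1 (subset_closure haU)).le 2
    refine h3.trans ?_
    rw [div_mul_eq_mul_div, le_div_iff₀ hf]
    nlinarith [sq_nonneg (‖X q‖ + 1)]

lemma exists_bound (hm : 0 < m) (hU : IsTimelikeDomain T U) {p : Spacetime m n}
    {K : Set (Spacetime m n)} (hK : IsCompact K) (hKU : K ⊆ U ∪ lateralBoundary T U)
    (hKf : ∀ q ∈ K, 0 ≤ fFun p q) {X : Spacetime m n → Spacetime m n}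
    (hX : ContDiffOn ℝ 1 X (closure U)) (hX0 : ∀ q ∈ U, fFun p q = 0 → X q = 0) :
    ∃ C, 0 ≤ C ∧ ∀ a ∈ K, a ∈ U → 0 < fFun p a → ∑ i, co (X a) i ^ 2 ≤ C * fFun p a := by
  obtain ⟨C, hC, h⟩ : ∃ C, 0 ≤ C ∧ ∀ a ∈ K, a ∈ U → 0 < fFun p a →
      ‖X a‖ ^ 2 ≤ C * fFun p a := by
    refine hK.induction_on (p := fun S => ∃ C, 0 ≤ C ∧ ∀ a ∈ S, a ∈ U → 0 < fFun p a →
      ‖X a‖ ^ 2 ≤ C * fFun p a) ⟨0, le_rfl, by simp⟩ ?_ ?_ ?_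
    · rintro S S' hSS ⟨C, hC, h⟩
      exact ⟨C, hC, fun a ha => h a (hSS ha)⟩
    · rintro S S' ⟨C, hC, h⟩ ⟨C', hC', h'⟩
      refine ⟨max C C', le_max_of_le_left hC, fun a ha haU haf => ?_⟩
      rcases ha with ha | ha
      · exact (h a ha haU haf).trans (mul_le_mul_of_nonneg_right (le_max_left _ _) haf.le)
      · exact (h' a ha haU haf).trans (mul_le_mul_of_nonneg_right (le_max_right _ _) haf.le)
    · intro q hq
      obtain ⟨C, hC, h⟩ := hU.exists_local_bound hm (hKU hq) (hKf q hq) hX hX0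
      exact ⟨_, mem_nhdsWithin_of_mem_nhds h, C, hC, fun a ha => ha⟩
  -- The norm of the product is the maximum of the two factors' norms, hence the factor 2 for the
  -- sum of squares.
  refine ⟨2 * C, by positivity, fun a ha haU haf => ?_⟩
  have h1 := h a ha haU haf
  have h2 : ∑ i, co (X a) i ^ 2 = ‖(X a).1‖ ^ 2 + ‖(X a).2‖ ^ 2 := by
    rw [norm_sq_fst, norm_sq_snd, Fintype.sum_sum_type]
    rfl
  rw [h2]
  have h3 := pow_le_pow_left₀ (norm_nonneg _) (norm_fst_le (X a)) 2
  have h4 := pow_le_pow_left₀ (norm_nonneg _) (norm_snd_le (X a)) 2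
  linarith

end IsTimelikeDomain

/-- The differential of a function that vanishes on the zero set of a defining function is a
multiple of the differential of the latter. -/
lemma exists_smul_fderiv {E : Type*} [NormedAddCommGroup E] [NormedSpace ℝ E] [FiniteDimensional ℝ E]
    {φ z : E → ℝ} {q : E} {S : Set E} {φ' L : E →L[ℝ] ℝ} (hφ : HasStrictFDerivAt φ φ' q)
    (hφ0 : φ q = 0) (hφ' : φ' ≠ 0) (hz : HasFDerivWithinAt z L S q)
    (hS : ∀ᶠ y in 𝓝 q, φ y = 0 → y ∈ S ∧ z y = 0) : ∃ k : ℝ, ∀ w, L w = k * φ' w := by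
  obtain ⟨v, hv⟩ := exists_fderiv_neg hφ'
  have hr : φ'.range = ⊤ := by
    rw [LinearMap.range_eq_top]
    intro c
    refine ⟨(c / φ' v) • v, ?_⟩
    simp [hv.ne]
  -- A parametrization of the zero set of φ by ker φ'. As z ∘ g = 0 near 0, the differential L
  -- vanishes on ker φ'.
  set g := hφ.implicitFunction φ φ' hr (φ q) with hg
  have hgd : HasStrictFDerivAt g φ'.ker.subtypeL 0 := hφ.to_implicitFunction hr
  have hg0 : g 0 = q := hφ.implicitFunction_apply_image hr
  have hgφ : ∀ᶠ y in 𝓝 (0 : φ'.ker), φ (g y) = 0 := by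
    have h1 := hφ.map_implicitFunction_eq hr
    have h2 : Tendsto (fun y : φ'.ker => (φ q, y)) (𝓝 0) (𝓝 (φ q, 0)) :=
      (Continuous.prodMk_right (φ q)).tendsto 0
    filter_upwards [h2.eventually h1] with y hy
    exact hy.trans hφ0
  have hgS : ∀ᶠ y in 𝓝 (0 : φ'.ker), g y ∈ S ∧ z (g y) = 0 := by
    have h1 : Tendsto g (𝓝 0) (𝓝 q) := by
      have := hgd.hasFDerivAt.continuousAt.tendsto
      rwa [hg0] at this
    filter_upwards [hgφ, h1.eventually hS] with y h2 h3
    exact h3 h2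
  have h3 : HasFDerivAt (z ∘ g) (L.comp φ'.ker.subtypeL) 0 :=
    hz.comp_hasFDerivAt_of_eq 0 hgd.hasFDerivAt (hgS.mono fun _ h => h.1) hg0.symm
  have h4 : HasFDerivAt (z ∘ g) (0 : φ'.ker →L[ℝ] ℝ) 0 :=
    (hasFDerivAt_const 0 0).congr_of_eventuallyEq (hgS.mono fun _ h => h.2)
  have h5 := h3.unique h4
  refine ⟨L v / φ' v, fun w => ?_⟩
  have h6 := DFunLike.congr_fun h5 ⟨w - (φ' w / φ' v) • v, by
    simp [hv.ne]⟩
  simp only [ContinuousLinearMap.comp_apply, Submodule.subtypeL_apply, map_sub, map_smul,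
    smul_eq_mul, _root_.zero_apply] at h6
  rw [sub_eq_zero.1 h6]
  ring

end

/-! ### The weighted current: regularity, decay at the null cone, boundary flux -/

section

variable {m n : ℕ}

open Asymptotics

/-- The weighted current of a function `z` with partial derivatives `z'`. -/
def flux (p : Spacetime m n) (ε : ℝ) (a : ℕ) (z : Spacetime m n → ℝ)
    (z' : Fin m ⊕ Fin n → Spacetime m n → ℝ) (i : Fin m ⊕ Fin n) (q : Spacetime m n) : ℝ :=
  current (fun j => Yv p ε j q) (gamF p ε q) (fun j => dgamF p ε j q) (AF p ε a q)
    (hF p ε q ^ a * z q) (fun j => zt p ε a (z q) (fun j => z' j q) j q) i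

variable {p q : Spacetime m n} {ε : ℝ} {a : ℕ}

/-- Needed for two regularities: k = 1 inside U, where z is C², and k = 0 up to the spatial
boundary, where only z and its first derivatives are continuous. -/
lemma contDiffWithinAt_flux {z : Spacetime m n → ℝ} {z' : Fin m ⊕ Fin n → Spacetime m n → ℝ}
    {k : WithTop ℕ∞} {s : Set (Spacetime m n)} (hf : 0 < fFun p q) (he : 0 < eF p ε q)
    (hz : ContDiffWithinAt ℝ k z s q) (hz' : ∀ j, ContDiffWithinAt ℝ k (z' j) s q)
    (i : Fin m ⊕ Fin n) : ContDiffWithinAt ℝ k (flux p ε a z z' i) s q := by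
  have hr := rFun_pos hf
  have hY : ∀ j, ContDiffWithinAt ℝ k (Yv p ε j) s q := fun j =>
    (contDiffAt_Yv hr j).contDiffWithinAt
  have hg : ContDiffWithinAt ℝ k (gamF p ε) s q := (contDiffAt_gamF hr).contDiffWithinAt
  have hg' : ContDiffWithinAt ℝ k (dgamF p ε i) s q := (contDiffAt_dgamF hr i).contDiffWithinAt
  have hA : ContDiffWithinAt ℝ k (AF p ε a) s q := (contDiffAt_AF hf he).contDiffWithinAt
  have hh : ContDiffWithinAt ℝ k (fun y => hF p ε y ^ a) s q :=
    (contDiffAt_hF_pow hf he a).contDiffWithinAt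
  have hw := hh.mul hz
  have hζ : ∀ j, ContDiffWithinAt ℝ k
      (fun y => zt p ε a (z y) (fun j => z' j y) j y) s q := fun j =>
    (((contDiffAt_dWt hf he a j).contDiffWithinAt).mul hz).add (hh.mul (hz' j))
  unfold flux current
  refine (((contDiffWithinAt_const.mul ((ContDiffWithinAt.sum fun j _ => (hY j).mul (hζ j)).mul
    (hζ i))).sub (contDiffWithinAt_const.mul ((ContDiffWithinAt.sum fun j _ =>
      contDiffWithinAt_const.mul ((hζ j).mul (hζ j))).mul (hY i)))).add
    (contDiffWithinAt_const.mul ((contDiffWithinAt_const.mul (hg.mul (hw.mul (hζ i)))).sub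
      (contDiffWithinAt_const.mul ((hw.mul hw).mul hg'))))).add
    (contDiffWithinAt_const.mul ((hA.mul (hw.mul hw)).mul (hY i)))

lemma abs_co_le_rFun (hf : 0 < fFun p q) (i : Fin m ⊕ Fin n) : |co (q - p) i| ≤ rFun p q := by
  refine abs_le_of_sq_le_sq ?_ (rFun_nonneg p q)
  rcases i with i | i
  · have h1 := Finset.single_le_sum (f := fun i : Fin m => co (q - p) (Sum.inl i) ^ 2)
      (fun j _ => sq_nonneg _) (Finset.mem_univ i)
    rw [sum_time_co_sq] at h1
    linarith
  · have h1 := Finset.single_le_sum (f := fun i : Fin n => co (q - p) (Sum.inr i) ^ 2)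
      (fun j _ => sq_nonneg _) (Finset.mem_univ i)
    rwa [sum_space_co_sq] at h1

lemma four_fFun_le (p q : Spacetime m n) : 4 * fFun p q ≤ rFun p q ^ 2 := by
  rw [four_fFun]; linarith [sq_nonneg ‖q.1 - p.1‖]

lemma isBigO_one_of_bound {E : Type*} {W : Set E} {u : E → ℝ} {C : ℝ}
    (h : ∀ q ∈ W, |u q| ≤ C) : u =O[𝓟 W] fun _ => (1 : ℝ) :=
  isBigO_principal.2 ⟨C, fun q hq => by simpa using h q hq⟩

/-- The weighted current vanishes to second order on the null cone. -/
lemma exists_flux_bound {W : Set (Spacetime m n)} {R : ℝ} (hε : 0 < ε)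
    (hf : ∀ q ∈ W, 0 < fFun p q) (hr : ∀ q ∈ W, rFun p q ≤ R) (hR : ε * R ≤ 1 / 2) (ha : 3 ≤ a)
    {z : Spacetime m n → ℝ} {z' : Fin m ⊕ Fin n → Spacetime m n → ℝ}
    (hz : z =O[𝓟 W] fun _ => (1 : ℝ)) (hz' : ∀ j, z' j =O[𝓟 W] fun _ => (1 : ℝ)) :
    ∃ C, 0 ≤ C ∧ ∀ i, ∀ q ∈ W, |flux p ε a z z' i q| ≤ C * fFun p q ^ 2 := by
  have hr0 : ∀ q ∈ W, 0 < rFun p q := fun q hq => rFun_pos (hf q hq)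
  have hεr : ∀ q ∈ W, ε * rFun p q ≤ 1 / 2 := fun q hq =>
    (mul_le_mul_of_nonneg_left (hr q hq) hε.le).trans hR
  have he : ∀ q ∈ W, 1 / 2 ≤ eF p ε q := fun q hq => by rw [eF]; linarith [hεr q hq]
  have he1 : ∀ q ∈ W, eF p ε q ≤ 1 := fun q hq => by
    rw [eF]; linarith [mul_pos hε (hr0 q hq)]
  have Oc : ∀ c : ℝ, (fun _ : Spacetime m n => c) =O[𝓟 W] fun _ => (1 : ℝ) := fun c =>
    isBigO_const_const _ one_ne_zero _
  have Or : rFun p =O[𝓟 W] fun _ => (1 : ℝ) := isBigO_one_of_bound (C := R) fun q hq => by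
    rw [abs_of_pos (hr0 q hq)]; exact hr q hq
  have Oe : eF p ε =O[𝓟 W] fun _ => (1 : ℝ) := isBigO_one_of_bound (C := 1) fun q hq => by
    rw [abs_of_pos (by linarith [he q hq])]; exact he1 q hq
  have Oei : (fun q => (eF p ε q)⁻¹) =O[𝓟 W] fun _ => (1 : ℝ) :=
    isBigO_one_of_bound (C := 2) fun q hq => by
      have := he q hq
      rw [abs_of_pos (by positivity), inv_le_comm₀ (by linarith) (by norm_num)]
      linarith
  have Of : fFun p =O[𝓟 W] fun _ => (1 : ℝ) := by
    refine IsBigO.trans (isBigO_principal.2 ⟨1, fun q hq => ?_⟩) ((Or.mul Or).trans (by simpa using Oc 1))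
    have := four_fFun_le p q
    have := hf q hq
    rw [Real.norm_eq_abs, Real.norm_eq_abs, abs_of_pos this, abs_of_nonneg (mul_self_nonneg _)]
    nlinarith
  have Oco : ∀ i, (fun q => co (q - p) i) =O[𝓟 W] fun _ => (1 : ℝ) := fun i =>
    isBigO_one_of_bound (C := R) fun q hq => (abs_co_le_rFun (hf q hq) i).trans (hr q hq)
  have Ocr : ∀ i, (fun q => co (q - p) i * (rFun p q)⁻¹) =O[𝓟 W] fun _ => (1 : ℝ) := fun i =>
    isBigO_one_of_bound (C := 1) fun q hq => by
      rw [abs_mul, abs_inv, abs_of_pos (hr0 q hq), ← div_eq_mul_inv, div_le_one (hr0 q hq)]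
      exact abs_co_le_rFun (hf q hq) i
  -- If p is in the closure of W, then r may tend to 0; f ≤ r²/4 compensates the negative powers of
  -- r in the coefficients.
  have Ofr2 : (fun q => fFun p q * (rFun p q)⁻¹ ^ 2) =O[𝓟 W] fun _ => (1 : ℝ) :=
    isBigO_one_of_bound (C := 1) fun q hq => by
      have h1 := hr0 q hq
      have h2 := hf q hq
      have h3 := four_fFun_le p q
      rw [abs_of_pos (by positivity), inv_pow, ← div_eq_mul_inv, div_le_one (by positivity)]
      linarith
  have Ofr : (fun q => fFun p q * (rFun p q)⁻¹) =O[𝓟 W] fun _ => (1 : ℝ) := by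
    have := Ofr2.mul Or
    rw [mul_one] at this
    refine this.congr' (eventually_principal.2 fun q hq => ?_) EventuallyEq.rfl
    have h1 := hr0 q hq
    field_simp
  have m11 : ∀ {u v : Spacetime m n → ℝ}, u =O[𝓟 W] (fun _ => (1 : ℝ)) →
      v =O[𝓟 W] (fun _ => (1 : ℝ)) → (fun q => u q * v q) =O[𝓟 W] fun _ => (1 : ℝ) :=
    fun hu hv => by simpa using hu.mul hv
  have Ok : kF p ε =O[𝓟 W] fun _ => (1 : ℝ) := m11 (Oc ε) Ofr
  have Odk : ∀ i, dkF p ε i =O[𝓟 W] fun _ => (1 : ℝ) := fun i => by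
    have h1 := m11 Ofr2 (Ocr i)
    refine m11 (Oc ε) ((m11 (Oc (sg i / 2)) (Ocr i)).sub (m11 (Oc (sp i)) ?_))
    refine h1.congr (fun q => ?_) fun _ => rfl
    ring
  have OY : ∀ i, Yv p ε i =O[𝓟 W] fun _ => (1 : ℝ) := fun i =>
    m11 ((m11 (Oc (1 / 2)) Oe).add (m11 (Oc (sp i)) Ok)) (Oco i)
  have Og : gamF p ε =O[𝓟 W] fun _ => (1 : ℝ) := (m11 (Oc _) Oe).add (m11 (Oc _) Ok)
  have Og' : ∀ i, dgamF p ε i =O[𝓟 W] fun _ => (1 : ℝ) := fun i =>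
    ((m11 (Oc _) (m11 (Oc ε) (m11 (Oc (sp i)) (Ocr i)))).neg_left).add (m11 (Oc _) (Odk i))
  -- The potential has a pole of order one on the cone.
  have OA : (fun q => fFun p q * AF p ε a q) =O[𝓟 W] fun _ => (1 : ℝ) := by
    have h1 := ((m11 (Oc ((a : ℝ) ^ 2)) Oei).add (m11 (m11 (Oc (((a : ℝ) ^ 2 - a) * ε ^ 2))
      (m11 Oei Oei)) Of)).sub (m11 (m11 (Oc (a * ε)) Ofr) Oei)
    refine h1.congr' (eventually_principal.2 fun q hq => ?_) EventuallyEq.rfl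
    have h1 := hr0 q hq
    have h2 := hf q hq
    have h3 := he q hq
    simp only [AF]
    have h4 : (0 : ℝ) < eF p ε q := by linarith
    field_simp
  -- powers of `f_p`
  have Oh : (fun q => hF p ε q ^ a) =O[𝓟 W] fun q => fFun p q ^ 3 := by
    have h1 : hF p ε =O[𝓟 W] fFun p := by
      have h := (isBigO_refl (fFun p) (𝓟 W)).mul Oei
      simp only [mul_one] at h
      exact h
    have h2 := (isBigO_refl (fun q => fFun p q ^ 3) (𝓟 W)).mul ((Of.pow (a - 3)))
    refine (h1.pow a).trans (IsBigO.trans (EventuallyEq.isBigO ?_) (by simpa using h2))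
    refine Eventually.of_forall fun q => ?_
    beta_reduce
    rw [← pow_add, Nat.add_sub_cancel' ha]
  have up : ∀ {u : Spacetime m n → ℝ} {k : ℕ}, u =O[𝓟 W] (fun q => fFun p q ^ (k + 1)) →
      u =O[𝓟 W] fun q => fFun p q ^ k := fun hu => hu.trans (by
    simpa [pow_succ] using (isBigO_refl (fun q => fFun p q ^ _) (𝓟 W)).mul Of)
  have m1 : ∀ {u v g : Spacetime m n → ℝ}, u =O[𝓟 W] g →
      v =O[𝓟 W] (fun _ => (1 : ℝ)) → (fun q => u q * v q) =O[𝓟 W] g :=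
    fun hu hv => by simpa using hu.mul hv
  have m1' : ∀ {u v g : Spacetime m n → ℝ}, u =O[𝓟 W] (fun _ => (1 : ℝ)) →
      v =O[𝓟 W] g → (fun q => u q * v q) =O[𝓟 W] g :=
    fun hu hv => by simpa using hu.mul hv
  have Ow : (fun q => hF p ε q ^ a * z q) =O[𝓟 W] fun q => fFun p q ^ 3 := m1 Oh hz
  -- Differentiating the weight costs one power of f; starting from f³, two powers remain, which is
  -- why a ≥ 3 suffices.
  have OdW : ∀ i, dWt p ε a i =O[𝓟 W] fun q => fFun p q ^ 2 := fun i => by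
    have h1 : (fun q => hF p ε q ^ a * (fFun p q)⁻¹) =O[𝓟 W] fun q => fFun p q ^ 2 := by
      refine (Oh.mul (isBigO_refl (fun q => (fFun p q)⁻¹) _)).congr' EventuallyEq.rfl
        (eventually_principal.2 fun q hq => ?_)
      have := (hf q hq).ne'
      field_simp
    refine (m1' (Oc a) (m1 (m1 h1 Oei) (m11 (Oc (sg i)) (OY i)))).congr (fun q => ?_)
      fun _ => rfl
    rw [dWt, mul_inv]
    ring
  have Oζ : ∀ i, (fun q => zt p ε a (z q) (fun j => z' j q) i q) =O[𝓟 W] fun q => fFun p q ^ 2 :=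
    fun i => (m1 (OdW i) hz).add (up (m1 Oh (hz' i)))
  have Oζ1 : ∀ i, (fun q => zt p ε a (z q) (fun j => z' j q) i q) =O[𝓟 W] fun _ => (1 : ℝ) :=
    fun i => by simpa using up (k := 0) (up (Oζ i))
  have Ow1 : (fun q => hF p ε q ^ a * z q) =O[𝓟 W] fun _ => (1 : ℝ) := by
    simpa using up (k := 0) (up (up Ow))
  have OAw : (fun q => AF p ε a q * ((hF p ε q ^ a * z q) * (hF p ε q ^ a * z q))) =O[𝓟 W]
      fun q => fFun p q ^ 2 := by
    refine (m1 (OA.mul (Ow.mul (isBigO_refl (fun q => (fFun p q)⁻¹) _))) Ow1).congr'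
      (eventually_principal.2 fun q hq => ?_) (eventually_principal.2 fun q hq => ?_)
    · have := (hf q hq).ne'
      field_simp
    · have := (hf q hq).ne'
      field_simp
  have Ofl : ∀ i, flux p ε a z z' i =O[𝓟 W] fun q => fFun p q ^ 2 := fun i => by
    have hw2 := up Ow
    exact (((m1' (Oc (sg i)) (m1'
        (IsBigO.fun_sum (s := Finset.univ) fun j _ => m11 (OY j) (Oζ1 j)) (Oζ i))).sub
      (m1' (Oc (1 / 2)) (m1 (IsBigO.fun_sum (s := Finset.univ) fun j _ => m1' (Oc (sg j)) (m1 (Oζ j) (Oζ1 j)))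
        (OY i)))).add
      (m1' (Oc (sg i)) ((m1' (Oc (1 / 2)) (m1' Og (m1 hw2 (Oζ1 i)))).sub
        (m1' (Oc (1 / 4)) (m1 (m1 hw2 Ow1) (Og' i)))))).add
      (m1' (Oc (1 / 2)) (m1 OAw (OY i)))
  choose C hC using fun i => isBigO_principal.1 (Ofl i)
  refine ⟨∑ i, |C i|, Finset.sum_nonneg fun _ _ => abs_nonneg _, fun i q hq => ?_⟩
  have h1 := hC i q hq
  rw [Real.norm_eq_abs, Real.norm_eq_abs, abs_of_nonneg (sq_nonneg (fFun p q))] at h1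
  refine h1.trans (mul_le_mul_of_nonneg_right ((le_abs_self _).trans ?_) (sq_nonneg _))
  exact Finset.single_le_sum (f := fun i => |C i|) (fun _ _ => abs_nonneg _) (Finset.mem_univ i)

/-- The boundary flux for a function that vanishes, together with its tangential derivatives. -/
lemma sum_mul_flux {z : Spacetime m n → ℝ} {z' : Fin m ⊕ Fin n → Spacetime m n → ℝ}
    {ν : Fin m ⊕ Fin n → ℝ} {k : ℝ} (hz : z q = 0) (hz' : ∀ j, z' j q = k * ν j) :
    ∑ i, ν i * flux p ε a z z' i q =
      1 / 2 * (hF p ε q ^ a * k) ^ 2 * (∑ i, sg i * (ν i * ν i)) * ∑ i, Yv p ε i q * ν i := by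
  simp only [flux, current, zt, hz, hz', mul_zero, zero_add, zero_mul, sub_zero, add_zero]
  set K := hF p ε q ^ a
  have h1 : ∑ j, Yv p ε j q * (K * (k * ν j)) = K * k * ∑ i, Yv p ε i q * ν i := by
    rw [Finset.mul_sum]; exact Finset.sum_congr rfl fun i _ => by ring
  have h2 : ∑ j, sg j * (K * (k * ν j) * (K * (k * ν j))) =
      (K * k) ^ 2 * ∑ i, sg i * (ν i * ν i) := by
    rw [Finset.mul_sum]; exact Finset.sum_congr rfl fun i _ => by ring
  rw [h1, h2]
  set A := ∑ i, Yv p ε i q * ν i with hA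
  set G := ∑ i, sg i * (ν i * ν i) with hG
  have h3 : ∀ i, ν i * (sg i * (K * k * A * (K * (k * ν i)))
      - 1 / 2 * ((K * k) ^ 2 * G * Yv p ε i q)) =
      (K * k) ^ 2 * A * (sg i * (ν i * ν i)) - 1 / 2 * (K * k) ^ 2 * G * (Yv p ε i q * ν i) :=
    fun i => by ring
  simp only [h3]
  rw [Finset.sum_sub_distrib, ← Finset.mul_sum, ← Finset.mul_sum, ← hA, ← hG]
  ring

end

/-! ### Uniqueness for the homogeneous equation, and the theorem -/

section

variable {m n : ℕ}

lemma metric_bv (N : Spacetime m n) (i : Fin m ⊕ Fin n) : metric N (bv i) = sg i * co N i := by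
  rcases i with i | i <;> simp [metric, dt, dx, EuclideanSpace.inner_single_right]

lemma metric_smul_left (b : ℝ) (v w : Spacetime m n) : metric (b • v) w = b * metric v w := by
  change inner ℝ (b • v.2) w.2 - inner ℝ (b • v.1) w.1 = _
  rw [real_inner_smul_left, real_inner_smul_left, metric, mul_sub]

lemma metric_smul_right (b : ℝ) (v w : Spacetime m n) : metric v (b • w) = b * metric v w := by
  change inner ℝ v.2 (b • w.2) - inner ℝ v.1 (b • w.1) = _
  rw [real_inner_smul_right, real_inner_smul_right, metric, mul_sub]

namespace IsTimelikeDomain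

variable {T : ℝ} {U : Set (Spacetime m n)}

/-- The flux of the weighted current through the boundary is nonpositive if the Neumann data
vanish on `Γ_p^ε`. -/
lemma sum_fderiv_mul_flux_nonpos (hU : IsTimelikeDomain T U) {p x : Spacetime m n} {ε : ℝ} {a : ℕ}
    (hx : x ∈ lateralBoundary T U) {φ : Spacetime m n → ℝ} (hφ : IsDefiningFunctionAt U x φ)
    (hG : 0 < ∑ i, sg i * (fderiv ℝ φ x (bv i) * fderiv ℝ φ x (bv i)))
    {z : Spacetime m n → ℝ} (hz : DifferentiableWithinAt ℝ z (U ∪ lateralBoundary T U) x)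
    (hz0 : ∀ y ∈ lateralBoundary T U, z y = 0) (hf : 0 < fFun p x)
    (hΓ : x ∈ Gam T U p ε → ∀ N, IsOuterUnitNormal U x N → boundaryDeriv T U z x N = 0) :
    ∑ i, fderiv ℝ φ x (bv i) * flux p ε a z
      (fun j y => fderivWithin ℝ z (U ∪ lateralBoundary T U) y (bv j)) i x ≤ 0 := by
  have hst : HasStrictFDerivAt φ (fderiv ℝ φ x) x :=
    hφ.1.contDiffAt.hasStrictFDerivAt (by simp)
  obtain ⟨k, hk⟩ := exists_smul_fderiv hst hφ.2.1 hφ.2.2.1 hz.hasFDerivWithinAt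
    ((hU.eventually_lateral hx hφ).mono fun y hy h0 => ⟨Or.inr (hy h0), hz0 y (hy h0)⟩)
  rw [sum_mul_flux (hz0 x hx) fun j => hk (bv j)]
  set G := ∑ i, sg i * (fderiv ℝ φ x (bv i) * fderiv ℝ φ x (bv i)) with hGdef
  rcases le_or_gt (∑ i, Yv p ε i x * fderiv ℝ φ x (bv i)) 0 with hY | hY
  · exact mul_nonpos_of_nonneg_of_nonpos (by positivity) hY
  -- If dφ(Y) > 0, then x lies in Γ_p^ε, as Y is the field in its definition. There the normal
  -- derivative of z is k times the nonzero normal derivative of φ, and it vanishes.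
  suffices hk0 : k = 0 by simp [hk0]
  obtain ⟨N, hN⟩ := exists_gradient (fderiv ℝ φ x)
  have hNi : ∀ i, fderiv ℝ φ x (bv i) = sg i * co N i := fun i => by rw [hN, metric_bv]
  have hcoN : ∀ i, co N i = sg i * fderiv ℝ φ x (bv i) := fun i => by
    rw [hNi, ← mul_assoc, sg_mul_self, one_mul]
  have hNN : metric N N = G := by
    rw [metric_eq_sum, hGdef]
    refine Finset.sum_congr rfl fun i _ => ?_
    rw [hcoN]
    linear_combination (sg i * (fderiv ℝ φ x (bv i) * fderiv ℝ φ x (bv i))) * sg_mul_self i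
  set c := (√G)⁻¹ with hc
  have hc0 : 0 < c := inv_pos.2 (Real.sqrt_pos.2 hG)
  have hcG : c * c * G = 1 := by
    have := Real.mul_self_sqrt hG.le
    rw [hc, ← mul_inv, this, inv_mul_cancel₀ hG.ne']
  have hdc : fderiv ℝ (fun y => c * φ y) x = c • fderiv ℝ φ x :=
    fderiv_const_mul ((hφ.1.differentiable (by simp)) x) c
  have hnormal : IsOuterUnitNormal U x (c • N) := by
    refine ⟨⟨fun y => c * φ y, ⟨contDiff_const.mul hφ.1, by simp [hφ.2.1], ?_, ?_⟩, ?_⟩, ?_⟩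
    · rw [hdc]
      refine fun h => hφ.2.2.1 (ContinuousLinearMap.ext fun w => ?_)
      simpa [hc0.ne'] using DFunLike.congr_fun h w
    · filter_upwards [hφ.2.2.2] with y hy
      rw [hy]
      exact ⟨fun h => mul_neg_of_pos_of_neg hc0 h, fun h => by
        by_contra! h'
        exact absurd (mul_nonneg hc0.le h') (not_le.2 h)⟩
    · intro w
      rw [hdc, metric_smul_left, ← hN]
      rfl
    · rw [metric_smul_left, metric_smul_right, hNN, ← mul_assoc, hcG]
  have hr := rFun_pos hf
  have hGam : x ∈ Gam T U p ε := by
    refine ⟨hx, hf, c • N, hnormal, ?_⟩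
    rw [map_smul, map_smul, map_eq_sum_co (fderiv ℝ (fFun p) x), map_eq_sum_co (fderiv ℝ (rFun p) x)]
    have h1 : (1 - ε * rFun p x) * (c • ∑ i, co N i • fderiv ℝ (fFun p) x (bv i))
        + ε * fFun p x * (c • ∑ i, co N i • fderiv ℝ (rFun p) x (bv i)) =
        c * ∑ i, Yv p ε i x * fderiv ℝ φ x (bv i) := by
      simp only [smul_eq_mul, Finset.mul_sum, ← Finset.sum_add_distrib]
      refine Finset.sum_congr rfl fun i _ => ?_
      rw [(hasPD_fFun p x).2, (hasPD_rFun hr).2, hNi, Yv, kF, eF]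
      rcases i with i | i
      · simp only [sg_inl, sp_inl]; ring
      · simp only [sg_inr, sp_inr]; ring
    rw [h1]
    exact mul_pos hc0 hY
  have h2 := hΓ hGam _ hnormal
  rw [boundaryDeriv, map_smul, hk, hN, hNN, smul_eq_mul] at h2
  simpa [hc0.ne', hG.ne'] using h2

section Region

variable {p : Spacetime m n} {R : ℝ}

/-- In the closure of 𝔇_p one has |t - t(p)| ≤ r ≤ R, so |t_i| ≤ R + |t_i(p)| < T: the region never
reaches the ends of the time cube. -/
lemma closure_region_subset (hU : IsTimelikeDomain T U)
    (hR : ∀ q ∈ U ∩ nullExterior p, rFun p q ≤ R) (hT : ∀ i, R + |p.1 i| < T) {q : Spacetime m n}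
    (hq : q ∈ closure (U ∩ nullExterior p)) :
    q ∈ U ∪ lateralBoundary T U ∧ 0 ≤ fFun p q ∧ rFun p q ≤ R ∧ ‖q.1 - p.1‖ ≤ R := by
  have hf : 0 ≤ fFun p q := closure_minimal (fun y hy => le_of_lt hy.2)
    (isClosed_le continuous_const (continuous_fFun p)) hq
  have hr : rFun p q ≤ R := closure_minimal hR
    (isClosed_le (continuous_rFun p) continuous_const) hq
  have ht : ‖q.1 - p.1‖ ≤ R := by
    have := four_fFun p q
    have h1 : ‖q.1 - p.1‖ ^ 2 ≤ rFun p q ^ 2 := by linarith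
    exact (le_of_sq_le_sq h1 (rFun_nonneg p q)).trans hr
  refine ⟨hU.mem_of_closure (closure_mono inter_subset_left hq) fun i => ?_, hf, hr, ht⟩
  have h1 : |(q.1 - p.1) i| ≤ ‖q.1 - p.1‖ := by
    simpa using PiLp.norm_apply_le (q.1 - p.1) i
  rw [PiLp.sub_apply] at h1
  have h2 := abs_le.1 (h1.trans ht)
  have h3 := hT i
  have h4 := neg_abs_le (p.1 i)
  have h5 := le_abs_self (p.1 i)
  constructor <;> linarith

lemma isBounded_region (hU : IsTimelikeDomain T U)
    (hR : ∀ q ∈ U ∩ nullExterior p, rFun p q ≤ R) (hT : ∀ i, R + |p.1 i| < T) :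
    Bornology.IsBounded (U ∩ nullExterior p) := by
  refine (Metric.isBounded_closedBall (x := p) (r := R)).subset fun q hq => ?_
  obtain ⟨-, -, h1, h2⟩ := hU.closure_region_subset hR hT (subset_closure hq)
  rw [mem_closedBall_iff_norm]
  exact max_le h2 h1

/-- Uniqueness for the homogeneous equation. -/
theorem eq_zero (hm : 0 < m) (hU : IsTimelikeDomain T U)
    (hR : ∀ q ∈ U ∩ nullExterior p, rFun p q ≤ R) (hT : ∀ i, R + |p.1 i| < T) {ε : ℝ} (hε : 0 < ε)
    (hεR : ε * R ≤ 1 / 2) {X : Spacetime m n → Spacetime m n} {V z : Spacetime m n → ℝ}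
    (hX : ContDiffOn ℝ 1 X (closure U)) (hV : ContinuousOn V (closure U))
    (hX0 : ∀ q ∈ U, fFun p q = 0 → X q = 0) (hz2 : ContDiffOn ℝ 2 z U)
    (hz1 : ContDiffOn ℝ 1 z (U ∪ lateralBoundary T U))
    (heq : ∀ q ∈ U, box z q + fderiv ℝ z q (X q) + V q * z q = 0)
    (hz0 : ∀ q ∈ lateralBoundary T U, z q = 0)
    (hΓ : ∀ q ∈ Gam T U p ε, ∀ N, IsOuterUnitNormal U q N → boundaryDeriv T U z q N = 0)
    {q₀ : Spacetime m n} (hq₀ : q₀ ∈ U ∩ nullExterior p) : z q₀ = 0 := by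
  by_contra hne
  set S := U ∪ lateralBoundary T U with hS
  set W := U ∩ nullExterior p with hW
  have hD : IsOpen (nullExterior p) := isOpen_lt continuous_const (continuous_fFun p)
  have hWo : IsOpen W := hU.isOpen.inter hD
  have hWb : Bornology.IsBounded W := hU.isBounded_region hR hT
  have hK : IsCompact (closure W) := hWb.isCompact_closure
  have hKS : closure W ⊆ S := fun q hq => (hU.closure_region_subset hR hT hq).1
  have hKU : closure W ⊆ closure U := closure_mono inter_subset_left
  have hKr : ∀ q ∈ closure W, rFun p q ≤ R := fun q hq =>
    (hU.closure_region_subset hR hT hq).2.2.1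
  have hεr : ∀ q ∈ closure W, ε * rFun p q ≤ 1 / 2 := fun q hq =>
    (mul_le_mul_of_nonneg_left (hKr q hq) hε.le).trans hεR
  have he : ∀ q ∈ closure W, 0 < eF p ε q := fun q hq => by rw [eF]; linarith [hεr q hq]
  have hR0 : 0 < R := (rFun_pos hq₀.2).trans_le (hR _ hq₀)
  obtain ⟨C, hC0, hC⟩ := hU.exists_bound hm hK hKS
    (fun q hq => (hU.closure_region_subset hR hT hq).2.1) hX hX0
  obtain ⟨Vb, hVb⟩ := hK.exists_bound_of_continuousOn (hV.mono hKU)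
  -- The exponent is chosen after the bounds C on |𝒳|²/f and Vb on V, and depends on the dimensions
  -- through `dimC`; ε itself stays fixed.
  obtain ⟨a, ha⟩ := exists_nat_gt (max (max 40 (7 * dimC m n))
    (max (96 * C * R ^ 3 / ε) (6 * R ^ 3 * Vb ^ 2 / ε)))
  have ha1 : (40 : ℝ) ≤ a := ((le_max_left _ _).trans (le_max_left _ _)).trans ha.le
  have ha2 : 7 * dimC m n ≤ a := ((le_max_right _ _).trans (le_max_left _ _)).trans ha.le
  have ha3 : 96 * C * R ^ 3 ≤ a * ε := (div_le_iff₀ hε).1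
    (((le_max_left _ _).trans (le_max_right _ _)).trans ha.le)
  have ha4 : 6 * R ^ 3 * Vb ^ 2 ≤ a * ε := (div_le_iff₀ hε).1
    (((le_max_right _ _).trans (le_max_right _ _)).trans ha.le)
  have hUD : UniqueDiffOn ℝ S := hU.uniqueDiffOn
  set z' : Fin m ⊕ Fin n → Spacetime m n → ℝ := fun j y => fderivWithin ℝ z S y (bv j) with hz'
  have hz'c : ∀ j, ContinuousOn (z' j) S := fun j =>
    (hz1.continuousOn_fderivWithin hUD le_rfl).clm_apply continuousOn_const
  have hz'U : ∀ q ∈ U, ∀ j, z' j =ᶠ[𝓝 q] fun y => fderiv ℝ z y (bv j) := fun q hq j => by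
    filter_upwards [hU.isOpen.mem_nhds hq] with y hy
    simp only [hz']
    rw [fderivWithin_of_mem_nhds (mem_of_superset (hU.isOpen.mem_nhds hy) subset_union_left)]
  have hzAt : ∀ q ∈ U, ContDiffAt ℝ 2 z q := fun q hq => hz2.contDiffAt (hU.isOpen.mem_nhds hq)
  -- the current
  have hPU : ∀ i, ContDiffOn ℝ 1 (flux p ε a z z' i) W := fun i q hq => by
    refine contDiffWithinAt_flux hq.2 (he q (subset_closure hq))
      ((hzAt q hq.1).of_le (by norm_num)).contDiffWithinAt (fun j => ?_) i
    refine ContDiffAt.contDiffWithinAt (ContDiffAt.congr_of_eventuallyEq ?_ (hz'U q hq.1 j))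
    exact ((hzAt q hq.1).fderiv_right (m := 1) (by norm_num)).clm_apply contDiffAt_const
  have hPc : ∀ i, ∀ q ∈ closure W, 0 < fFun p q →
      ContinuousWithinAt (flux p ε a z z' i) S q := fun i q hq hf =>
    (contDiffWithinAt_flux (k := 0) hf (he q hq) (contDiffOn_zero.2 hz1.continuousOn q (hKS hq))
      (fun j => contDiffOn_zero.2 (hz'c j) q (hKS hq)) i).continuousWithinAt
  have hdiv : ∀ q ∈ W, a ^ 2 * (ε / rFun p q) / 16 * (hF p ε q ^ a * z q) ^ 2 ≤
      ∑ i, fderiv ℝ (flux p ε a z z' i) q (bv i) := fun q hq => by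
    have h1 := carleman_pointwise (hzAt q hq.1) hq.2 hε (hεr q (subset_closure hq)) (hR q hq) hC0
      (hC q (subset_closure hq) hq.1 hq.2) (hVb q (subset_closure hq)) (heq q hq.1) ha1 ha2 ha3 ha4
    refine h1.trans (le_of_eq (Finset.sum_congr rfl fun i _ => ?_))
    congr 1
    refine EventuallyEq.fderiv_eq ?_
    filter_upwards [eventually_all.2 (hz'U q hq.1)] with y hy
    simp only [flux, hy]
  have hbd : ∀ {u : Spacetime m n → ℝ}, ContinuousOn u S → u =O[𝓟 W] fun _ => (1 : ℝ) :=
    fun hu => by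
      obtain ⟨B, hB⟩ := hK.exists_bound_of_continuousOn (hu.mono hKS)
      exact isBigO_one_of_bound fun q hq => hB q (subset_closure hq)
  obtain ⟨M, hM0, hM⟩ := exists_flux_bound (a := a) hε (fun q hq => hq.2) hR hεR
    (by have : (3 : ℝ) ≤ a := by linarith
        exact_mod_cast this) (hbd hz1.continuousOn) fun j => hbd (hz'c j)
  -- a lower bound of the divergence
  set Q : Spacetime m n → ℝ := fun q => a ^ 2 * (ε / rFun p q) / 16 * (hF p ε q ^ a * z q) ^ 2
    with hQ
  have hr₀ := rFun_pos hq₀.2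
  have he₀ := he q₀ (subset_closure hq₀)
  have hQ0 : 0 < Q q₀ := by
    have h1 : 0 < hF p ε q₀ := mul_pos hq₀.2 (inv_pos.2 he₀)
    have h2 : 0 < (a : ℝ) := by linarith
    simp only [hQ]
    positivity
  have hQc : ContinuousAt Q q₀ := by
    have h1 := (continuous_rFun p).continuousAt (x := q₀)
    have h2 := (contDiffAt_hF_pow hq₀.2 he₀ a (k := 0)).continuousAt
    have h3 := (hzAt q₀ hq₀.1).continuousAt
    exact ((continuousAt_const.mul (continuousAt_const.div h1 hr₀.ne')).div_const _).mul
      ((h2.mul h3).pow 2)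
  obtain ⟨ρ, hρ, hball⟩ := Metric.nhds_basis_closedBall.mem_iff.1
    (inter_mem (hWo.mem_nhds hq₀) (hQc.eventually_const_lt (half_lt_self hQ0)))
  -- On the ball of radius ρ, inside W, the lower bound Q exceeds Q(q₀)/2, so this multiple of the
  -- bump is a continuous, compactly supported minorant of the divergence with positive integral.
  let β : ContDiffBump q₀ := ⟨ρ / 2, ρ, half_pos hρ, half_lt_self hρ⟩
  set d : Spacetime m n → ℝ := fun y => Q q₀ / 2 * β y with hd
  have hdc : Continuous d := continuous_const.mul β.continuous
  have hds : tsupport d ⊆ Metric.closedBall q₀ ρ := by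
    refine (closure_mono (Function.support_subset_iff.2 fun y hy => ?_)).trans
      (by rw [Metric.isClosed_closedBall.closure_eq])
    by_contra h
    exact hy (by
      simp only [hd]
      rw [β.zero_of_le_dist (le_of_lt (by simpa using h)), mul_zero])
  have hdQ : ∀ q ∈ W, d q ≤ ∑ i, fderiv ℝ (flux p ε a z z' i) q (bv i) := fun q hq => by
    refine le_trans ?_ (hdiv q hq)
    by_cases hqb : q ∈ Metric.closedBall q₀ ρ
    · have h1 : Q q₀ / 2 < Q q := (hball hqb).2
      have h2 := β.le_one (x := q)
      have h3 : d q ≤ Q q₀ / 2 := by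
        simp only [hd]
        nlinarith
      exact h3.trans h1.le
    · have h1 : d q = 0 := image_eq_zero_of_notMem_tsupport fun h => hqb (hds h)
      rw [h1]
      have := rFun_pos hq.2
      positivity
  have hdcs : HasCompactSupport d :=
    (isCompact_closedBall q₀ ρ).of_isClosed_subset (isClosed_tsupport d) hds
  have hint := integral_nonpos_of_localWeakDiv (μ := MeasureTheory.Measure.addHaar) (b := bv)
    hWo hWb (contDiff_fFun p) (fun q hq => hq.2) hM0 hM hdc hdcs
    (hds.trans fun y hy => (hball hy).1) fun q hq hf => by
      rcases hKS hq with hqU | hql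
      · exact localWeakDiv_of_mem hWo hPU hdc hdQ ⟨hqU, hf⟩
      obtain ⟨φ, N, hφ, hN, hNN⟩ := hU.normal q hql
      set G : Spacetime m n → ℝ := fun y =>
        ∑ i, sg i * (fderiv ℝ φ y (bv i) * fderiv ℝ φ y (bv i)) with hG
      have hφd : ∀ u, Continuous fun y => fderiv ℝ φ y u := fun u =>
        (hφ.1.continuous_fderiv (by simp)).clm_apply continuous_const
      have hGc : Continuous G := continuous_finsetSum _ fun i _ =>
        continuous_const.mul ((hφd _).mul (hφd _))
      have hGq : 0 < G q := by
        convert hNN using 1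
        rw [metric_eq_sum, hG]
        refine Finset.sum_congr rfl fun i _ => ?_
        rw [hN, metric_bv]
        linear_combination (sg i * co N i * co N i) * sg_mul_self i
      obtain ⟨v, hv⟩ := exists_fderiv_neg hφ.2.2.1
      -- A neighbourhood on which φ stays a defining function at its zeros, these zeros are spatial
      -- boundary points off the cone, and dφ stays spacelike; the sign of the flux then holds at
      -- all boundary points of B, as the weak inequality requires.
      set B : Set (Spacetime m n) := {y | ((∀ᶠ x in 𝓝 y, (x ∈ U ↔ φ x < 0)) ∧
        (φ y = 0 → y ∈ lateralBoundary T U)) ∧ 0 < fFun p y ∧ 0 < G y} with hB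
      have hBq : B ∈ 𝓝 q := by
        filter_upwards [hφ.2.2.2.eventually_nhds, hU.eventually_lateral hql hφ,
          (continuous_fFun p).continuousAt.eventually_const_lt hf,
          hGc.continuousAt.eventually_const_lt hGq] with y h1 h2 h3 h4
        exact ⟨⟨h1, h2⟩, h3, h4⟩
      have hBS : B ∩ {y | φ y ≤ 0} ⊆ S := by
        rintro y ⟨⟨⟨h1, h2⟩, -⟩, h3⟩
        rcases (show φ y ≤ 0 from h3).lt_or_eq with h3 | h3
        · exact Or.inl (h1.self_of_nhds.2 h3)
        · exact Or.inr (h2 h3)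
      refine localWeakDiv_of_boundary hWo hPU hdc hdQ (hφ.1.of_le (by norm_cast)) hBq (fun y hy => ?_)
        (fun i y hy => ?_) (fun y hy h0 => ?_) (v := -v) (by rw [map_neg]; linarith)
      · rw [← hy.1.1.self_of_nhds]
        exact ⟨fun h => h.1, fun h => ⟨h, hy.2.1⟩⟩
      · refine (hPc i y ?_ hy.1.2.1).mono hBS
        exact hD.closure_inter ⟨subset_closure_union U (hBS hy), hy.1.2.1⟩
      · have hyl := hy.1.2 h0
        have hGy : 0 < G y := hy.2.2
        refine hU.sum_fderiv_mul_flux_nonpos hyl ⟨hφ.1, h0, fun h => ?_, hy.1.1⟩ hGy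
          ((hz1 y (Or.inr hyl)).differentiableWithinAt (by simp)) hz0 hy.2.1
          (fun h => hΓ y h)
        simp [hG, h] at hGy
  refine absurd hint (not_le.2 ?_)
  simp only [hd]
  rw [MeasureTheory.integral_const_mul]
  exact mul_pos (half_pos hQ0) β.integral_pos

end Region

end IsTimelikeDomain

lemma box_sub {z₁ z₂ : Spacetime m n → ℝ} {q : Spacetime m n}
    (h₁ : ContDiffAt ℝ 2 z₁ q) (h₂ : ContDiffAt ℝ 2 z₂ q) :
    box (fun y => z₁ y - z₂ y) q = box z₁ q - box z₂ q := by
  have e : ∀ {z : Spacetime m n → ℝ}, ContDiffAt ℝ 2 z q → DifferentiableAt ℝ (fderiv ℝ z) q :=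
    fun h => (h.fderiv_right (m := 1) (by norm_num)).differentiableAt one_ne_zero
  have d : ∀ {z : Spacetime m n → ℝ}, ContDiffAt ℝ 2 z q →
      ∀ᶠ y in 𝓝 q, DifferentiableAt ℝ z y := fun h =>
    (h.eventually (by simp)).mono fun y hy => hy.differentiableAt (by simp)
  have h : fderiv ℝ (fun y => z₁ y - z₂ y) =ᶠ[𝓝 q] fun y => fderiv ℝ z₁ y - fderiv ℝ z₂ y := by
    filter_upwards [d h₁, d h₂] with y hy₁ hy₂
    exact fderiv_fun_sub hy₁ hy₂
  simp only [box, h.fderiv_eq, fderiv_fun_sub (e h₁) (e h₂), sub_apply, Finset.sum_sub_distrib]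
  ring

end

end Ultrahyperbolic

end

theorem theorem4p1 (m n : ℕ) (hm : 0 < m) (hn : 0 < n) :
    ∃ c : ℝ, 0 < c ∧
      ∀ (T : ℝ) (U : Set (Spacetime m n)) (p : Spacetime m n) (R ε : ℝ),
        (Ultrahyperbolic.IsStaticDomain T U ∨ Ultrahyperbolic.IsMovingDomain T U) →
        IsLUB (Ultrahyperbolic.rFun p '' (U ∩ Ultrahyperbolic.nullExterior p)) R →
        (∀ i, R + |p.1 i| < T) →
        0 < ε → ε * R ≤ c →
        ∀ (X : Spacetime m n → Spacetime m n) (V F H z₁ z₂ : Spacetime m n → ℝ),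
          ContDiffOn ℝ ∞ X (closure U) →
          ContDiffOn ℝ ∞ V (closure U) →
          ContDiffOn ℝ ∞ F (closure U) →
          (∀ q ∈ U, Ultrahyperbolic.fFun p q = 0 → X q = 0) →
          Ultrahyperbolic.IsSolution T U X V F H z₁ →
          Ultrahyperbolic.IsSolution T U X V F H z₂ →
          (∀ q ∈ Ultrahyperbolic.Gam T U p ε, ∀ N, Ultrahyperbolic.IsOuterUnitNormal U q N →
            Ultrahyperbolic.boundaryDeriv T U z₁ q N = Ultrahyperbolic.boundaryDeriv T U z₂ q N) →
          ∀ q ∈ U ∩ Ultrahyperbolic.nullExterior p, z₁ q = z₂ q := by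
  open Ultrahyperbolic in
  -- The value 1/2 keeps 1 - εr ≥ 1/2 on the region, so the weight is smooth and positive there; the
  -- dimensions enter only through the exponent a.
  refine ⟨1 / 2, by norm_num, ?_⟩
  intro T U p R ε hdom hlub hT hε hεR X V F H z₁ z₂ hX hV _ hX0 h₁ h₂ hΓ q hq
  have hU : IsTimelikeDomain T U := hdom.elim IsStaticDomain.isTimelikeDomain
    IsMovingDomain.isTimelikeDomain
  have hUD := hU.uniqueDiffOn
  have key := hU.eq_zero (z := fun y => z₁ y - z₂ y) hm (fun y hy => hlub.1 ⟨y, hy, rfl⟩) hT hε hεR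
    (hX.of_le (by norm_cast)) hV.continuousOn hX0
    (h₁.contDiffOn_two.sub h₂.contDiffOn_two) (h₁.contDiffOn_one.sub h₂.contDiffOn_one)
    (fun y hy => ?_) (fun y hy => by rw [h₁.dirichlet y hy, h₂.dirichlet y hy, sub_self])
    (fun y hy N hN => ?_) hq
  · exact sub_eq_zero.1 key
  · have c₁ := h₁.contDiffOn_two.contDiffAt (hU.isOpen.mem_nhds hy)
    have c₂ := h₂.contDiffOn_two.contDiffAt (hU.isOpen.mem_nhds hy)
    rw [box_sub c₁ c₂, fderiv_fun_sub (c₁.differentiableAt (by simp))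
      (c₂.differentiableAt (by simp)), sub_apply]
    linear_combination h₁.equation y hy - h₂.equation y hy
  · have hyS : y ∈ U ∪ lateralBoundary T U := Or.inr hy.1
    have := hΓ y hy N hN
    rw [boundaryDeriv, boundaryDeriv] at this
    rw [boundaryDeriv, fderivWithin_fun_sub (hUD y hyS)
      ((h₁.contDiffOn_one y hyS).differentiableWithinAt (by simp))
      ((h₂.contDiffOn_one y hyS).differentiableWithinAt (by simp)), sub_apply, this, sub_self]
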